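/- Let $n,p\ge 0$, $m\ge 1$, $A\in\mathbb R^{n\times n}$, $B\in\mathbb R^{n\times m}$, $B_u\in\mathbb R^{n\times p}$, let $u\in C^1([0,\infty);\mathbb R^p)$, and let $$M=\begin{bmatrix}M_x&M_{xu}&M_{xw}\\M_{xu}^\top&M_u&M_{uw}\\M_{xw}^\top&M_{uw}^\top&M_w\end{bmatrix}$$ be a real symmetric matrix with $M_w\prec 0$. A trajectory on $[0,t]$ is a pair $(x,x_q)$ such that, for some $w\in L^2([0,t];\mathbb R^m)$ and all $\tau\in[0,t]$, $$\dot x=Ax+Bw+B_uu,\qquad x_q(\tau)=x_q(0)+\int_0^\tau \begin{bmatrix}x\\u\\w\end{bmatrix}^\top M\begin{bmatrix}x\\u\\w\end{bmatrix}ds .$$ For $\mathcal X_0\subseteq\mathbb R^n\times\mathbb R$, the reachable set $\mathcal R(\mathcal X_0,t)$ is the set of the end points $(x(t),x_q(t))$ of the trajectories on $[0,t]$ with $(x(0),x_q(0))\in\mathcal X_0$ and $x_q(\tau)\ge 0$ for all $\tau\in[0,t]$. Put $\mathcal X_+=\mathbb R^n\times[0,\infty)$. For symmetric $E$, $f\in\mathbb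 R^n$, $g\in\mathbb R$ let $\mathcal P(E,f,g)=\{(x,x_q): x^\top Ex-2f^\top x+g+x_q\le 0\}$, and $\gamma\,\mathcal P(E,f,g)=\mathcal P(\gamma E,\gamma f,\gamma g)$. A touching trajectory of a time-dependent set $Q(\cdot)$ on an interval is a trajectory with $(x(t),x_q(t))\in\partial Q(t)$ for all $t$ in the interval ($x_q$ may be negative). For a paraboloid $\mathcal P(E_1,f_1,g_1)$ let $\mathcal T(\mathcal P(E_1,f_1,g_1))$ be the time-varying paraboloid $P(t)=\mathcal P(E(t),f(t),g(t))$, where $(E,f,g)(0)=(E_1,f_1,g_1)$ and $$\dot E=-EA-A^\top E-M_x+(B^\top E+M_{xw}^\top)^\top M_w^{-1}(B^\top E+M_{xw}^\top),$$ $$\dot f=-A^\top f+(M_{xu}+EB_u)u+(EB+M_{xw})M_w^{-1}(B^\top f-M_{uw}^\top u),$$ $$\dot g=\begin{bmatrix}f\\u\end{bmatrix}^\top\begin{bmatrix}BM_w^{-1}B^\top&B_u-BM_w^{-1}M_{uw}^\top\\(B_u-BM_w^{-1}M_{uw}^\top)^\top&M_{uw}M_w^{-1}M_{uw}^\top-M_u\end{bmatrix}\begin{bmatrix}f\\u\end{bmatrix},$$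 defined on the maximal forward interval $\mathcal I(P)$ of existence of $E$. Fix $\mathcal P_0=\mathcal P(E_0,f_0,g_0)$, $\epsilon_q>0$ and $T\ge 0$. Let $\mathcal P_0^{\epsilon_q}$ be the set of $(x,x_q)$ with $-x^\top E_0x+2f_0^\top x-g_0\in[-\epsilon_q,0]$ and $x_q\in[-\epsilon_q,0]$. Let $\Pi$ be the set of all $\mathcal T(\gamma\mathcal P_0)$, $\gamma\ge 1$, such that some touching trajectory of $\mathcal T(\gamma\mathcal P_0)$ starting in $\mathcal P_0^{\epsilon_q}$ has $\dot x_q(0)\ge 0$, and let $\Pi^\cap(t)=\bigcap_{P\in\Pi,\ t\in\mathcal I(P)}P(t)$. Suppose that $\Pi\neq\emptyset$ and 1. there is $K>0$ such that $\|E(t)\|\le K$ (Frobenius norm) for every $(E,f,g)=P\in\Pi$ and every $t\in[0,T]$ at which $P$ is defined; 2. for every touching trajectory $(x,x_q)$ of $\Pi^\cap$ on $[0,T]$ and every $t\in(0,T]$ with $x_q(t)\in[-\epsilon_q,0]$, one has $\dot x_q(t)<0$. Then $\mathcal R(\mathcal P_0,t)=\Pi^\cap(t)\cap\mathcal X_+$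 for all $t\in[0,T]$. -/

import Mathlib

open Set MeasureTheory
open scoped Matrix

noncomputable section

namespace IQCReach

/-- The states `(x, x_q)` of the augmented system. -/
abbrev State (n : ℕ) : Type := (Fin n → ℝ) × ℝ

/-- The data of the system: the matrices of `x' = A x + B w + B_u u`, the input signal `u`, which
is `C¹` on `[0, ∞)`, and the symmetric matrix `M` of the integral quadratic constraint, acting on
the stacked vector `(x, u, w)`, whose `w`-block is negative definite. -/
structure LTISystem (n p m : ℕ) where
  A : Matrix (Fin n) (Fin n) ℝ
  B : Matrix (Fin n) (Fin m) ℝ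
  Bu : Matrix (Fin n) (Fin p) ℝ
  u : ℝ → Fin p → ℝ
  M : Matrix (Fin n ⊕ (Fin p ⊕ Fin m)) (Fin n ⊕ (Fin p ⊕ Fin m)) ℝ
  u_contDiffOn : ContDiffOn ℝ 1 u (Ici 0)
  M_symm : M.IsSymm
  Mw_neg : (-(M.submatrix (fun k : Fin m => Sum.inr (Sum.inr k))
    (fun k : Fin m => Sum.inr (Sum.inr k)))).PosDef

namespace LTISystem

variable {n p m : ℕ} (S : LTISystem n p m)

/-! The blocks of `M`. -/

def Mx : Matrix (Fin n) (Fin n) ℝ := S.M.submatrix Sum.inl Sum.inl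

def Mxu : Matrix (Fin n) (Fin p) ℝ := S.M.submatrix Sum.inl (fun j => Sum.inr (Sum.inl j))

def Mxw : Matrix (Fin n) (Fin m) ℝ := S.M.submatrix Sum.inl (fun k => Sum.inr (Sum.inr k))

def Mu : Matrix (Fin p) (Fin p) ℝ :=
  S.M.submatrix (fun j => Sum.inr (Sum.inl j)) (fun j => Sum.inr (Sum.inl j))

def Muw : Matrix (Fin p) (Fin m) ℝ :=
  S.M.submatrix (fun j => Sum.inr (Sum.inl j)) (fun k => Sum.inr (Sum.inr k))

def Mw : Matrix (Fin m) (Fin m) ℝ :=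
  S.M.submatrix (fun k => Sum.inr (Sum.inr k)) (fun k => Sum.inr (Sum.inr k))

/-- The energy rate `[x; u; w]ᵀ M [x; u; w]`. -/
def rate (x : Fin n → ℝ) (v : Fin p → ℝ) (w : Fin m → ℝ) : ℝ :=
  Sum.elim x (Sum.elim v w) ⬝ᵥ (S.M *ᵥ Sum.elim x (Sum.elim v w))

/-- `(x, x_q)` solves the augmented system on `[0, τ]` with the disturbance `w ∈ L²([0, τ])`, in
the integral (Carathéodory) sense. -/
structure IsTrajectory (τ : ℝ) (w : ℝ → Fin m → ℝ) (x : ℝ → Fin n → ℝ) (xq : ℝ → ℝ) : Prop where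
  w_memLp : MemLp w 2 (volume.restrict (Icc 0 τ))
  x_continuousOn : ContinuousOn x (Icc 0 τ)
  x_eq : ∀ t ∈ Icc 0 τ,
    x t = x 0 + ∫ s in (0 : ℝ)..t, (S.A *ᵥ x s + S.B *ᵥ w s + S.Bu *ᵥ S.u s)
  xq_eq : ∀ t ∈ Icc 0 τ, xq t = xq 0 + ∫ s in (0 : ℝ)..t, S.rate (x s) (S.u s) (w s)

/-- The constrained system: trajectories on `[0, τ]` that start in `X₀` and keep `x_q ≥ 0`. -/
def IsConstrainedTrajectory (X₀ : Set (State n)) (τ : ℝ) (x : ℝ → Fin n → ℝ) (xq : ℝ → ℝ) :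
    Prop :=
  (∃ w, S.IsTrajectory τ w x xq) ∧ (x 0, xq 0) ∈ X₀ ∧ ∀ t ∈ Icc 0 τ, 0 ≤ xq t

/-- The reachable set at time `t` from the set `X₀` of initial states. -/
def reach (X₀ : Set (State n)) (t : ℝ) : Set (State n) :=
  {X | ∃ x xq, S.IsConstrainedTrajectory X₀ t x xq ∧ X = (x t, xq t)}

/-- Touching trajectory on `[0, τ]` of a time-dependent set `Q`: a trajectory (the sign of `x_q`
is not constrained) that stays on the boundary of `Q t`. -/
def IsTouching (Q : ℝ → Set (State n)) (τ : ℝ) (x : ℝ → Fin n → ℝ) (xq : ℝ → ℝ) : Prop :=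
  (∃ w, S.IsTrajectory τ w x xq) ∧ ∀ t ∈ Icc 0 τ, (x t, xq t) ∈ frontier (Q t)

end LTISystem

/-- The parameters `(E, f, g)` of a paraboloid, `E` symmetric. -/
@[ext]
structure Paraboloid (n : ℕ) where
  E : Matrix (Fin n) (Fin n) ℝ
  f : Fin n → ℝ
  g : ℝ
  E_symm : E.IsSymm

namespace Paraboloid

variable {n : ℕ}

/-- The value function `h(x, x_q) = xᵀ E x - 2 fᵀ x + g + x_q`. -/
def value (P : Paraboloid n) (X : State n) : ℝ :=
  X.1 ⬝ᵥ (P.E *ᵥ X.1) - 2 * (P.f ⬝ᵥ X.1) + P.g + X.2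

/-- The paraboloid as a set of states. -/
def toSet (P : Paraboloid n) : Set (State n) := {X | P.value X ≤ 0}

/-- The scaled paraboloid `γ P`. -/
def scale (γ : ℝ) (P : Paraboloid n) : Paraboloid n where
  E := γ • P.E
  f := γ • P.f
  g := γ * P.g
  E_symm := by
    have h := P.E_symm
    unfold Matrix.IsSymm at h ⊢
    rw [Matrix.transpose_smul, h]

/-- The set of states near the boundary of `P` in the half-space `x_q ≤ 0`. -/
def nearZero (P : Paraboloid n) (ε : ℝ) : Set (State n) :=
  {X | -(X.1 ⬝ᵥ (P.E *ᵥ X.1)) + 2 * (P.f ⬝ᵥ X.1) - P.g ∈ Icc (-ε) 0 ∧ X.2 ∈ Icc (-ε) 0}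

end Paraboloid

/-- The norm `√(tr (Aᵀ A))`. -/
def frobNorm {n : ℕ} (A : Matrix (Fin n) (Fin n) ℝ) : ℝ := Real.sqrt (Aᵀ * A).trace

namespace LTISystem

variable {n p m : ℕ} (S : LTISystem n p m)

/-- Right-hand side of the Riccati equation for `E`. -/
def rhsE (E : Matrix (Fin n) (Fin n) ℝ) : Matrix (Fin n) (Fin n) ℝ :=
  -(E * S.A) - S.Aᵀ * E - S.Mx
    + (S.Bᵀ * E + S.Mxwᵀ)ᵀ * S.Mw⁻¹ * (S.Bᵀ * E + S.Mxwᵀ)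

/-- Right-hand side of the equation for `f`; `v` is the value of the input. -/
def rhsf (E : Matrix (Fin n) (Fin n) ℝ) (f : Fin n → ℝ) (v : Fin p → ℝ) : Fin n → ℝ :=
  -(S.Aᵀ *ᵥ f) + (S.Mxu + E * S.Bu) *ᵥ v
    + ((E * S.B + S.Mxw) * S.Mw⁻¹) *ᵥ (S.Bᵀ *ᵥ f - S.Muwᵀ *ᵥ v)

/-- The derivative of `g`, i.e. `[f; v]ᵀ G [f; v]` with
`G = [B Mw⁻¹ Bᵀ, Bu - B Mw⁻¹ Muwᵀ; (Bu - B Mw⁻¹ Muwᵀ)ᵀ, Muw Mw⁻¹ Muwᵀ - Mu]`. -/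
def rhsg (f : Fin n → ℝ) (v : Fin p → ℝ) : ℝ :=
  f ⬝ᵥ ((S.B * S.Mw⁻¹ * S.Bᵀ) *ᵥ f)
    + 2 * (f ⬝ᵥ ((S.Bu - S.B * S.Mw⁻¹ * S.Muwᵀ) *ᵥ v))
    + v ⬝ᵥ ((S.Muw * S.Mw⁻¹ * S.Muwᵀ - S.Mu) *ᵥ v)

/-- The parameters `P s = (E s, f s, g s)` solve the initial value problem on `[0, τ]` with initial
value `P₀`. On `[0, τ]` there is at most one such `P`. -/
structure IsSolution (P₀ : Paraboloid n) (τ : ℝ) (P : ℝ → Paraboloid n) : Prop where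
  init : P 0 = P₀
  E_deriv : ∀ t ∈ Icc 0 τ, ∀ i j,
    HasDerivWithinAt (fun s => (P s).E i j) (S.rhsE (P t).E i j) (Icc 0 τ) t
  f_deriv : ∀ t ∈ Icc 0 τ,
    HasDerivWithinAt (fun s => (P s).f) (S.rhsf (P t).E (P t).f (S.u t)) (Icc 0 τ) t
  g_eq : ∀ t ∈ Icc 0 τ, (P t).g = P₀.g + ∫ s in (0 : ℝ)..t, S.rhsg (P s).f (S.u s)

/-- The interval of definition of the time-varying paraboloid issued from `P₀`: the times up to
which the initial value problem has a solution. -/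
def domain (P₀ : Paraboloid n) : Set ℝ := {t | 0 ≤ t ∧ ∃ P, S.IsSolution P₀ t P}

/-- The time-varying paraboloid issued from `P₀`, meant for `t ∈ S.domain P₀`, where the
parameters exist and are unique. -/
def timeVarying (P₀ : Paraboloid n) (t : ℝ) : Set (State n) :=
  {X | ∃ P, S.IsSolution P₀ t P ∧ X ∈ (P t).toSet}

/-- The scalings `γ ≥ 1` for which the touching trajectory of the time-varying paraboloid issued
from `γ P₀` that starts at some state of `P₀.nearZero ε` has `x_q'(0) ≥ 0`. A touching trajectory
is determined by its initial state, so the length `τ` of the interval on which it is looked at is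
irrelevant. -/
def scalings (P₀ : Paraboloid n) (ε : ℝ) : Set ℝ :=
  {γ | 1 ≤ γ ∧ ∃ X ∈ P₀.nearZero ε, ∃ τ ∈ S.domain (P₀.scale γ), 0 < τ ∧
    ∃ x xq, S.IsTouching (S.timeVarying (P₀.scale γ)) τ x xq ∧ (x 0, xq 0) = X ∧
      ∃ d, HasDerivWithinAt xq d (Icc 0 τ) 0 ∧ 0 ≤ d}

/-- The intersection at time `t` of all the time-varying paraboloids issued from `γ P₀`, where `γ`
runs through `S.scalings P₀ ε`, that are defined at time `t`. -/
def parInter (P₀ : Paraboloid n) (ε : ℝ) (t : ℝ) : Set (State n) :=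
  ⋂ γ ∈ S.scalings P₀ ε, ⋂ _ : t ∈ S.domain (P₀.scale γ), S.timeVarying (P₀.scale γ) t

/-- The solutions of the Riccati equations belonging to the family are bounded on `[0, T]`, as far
as they are defined, by a common constant. -/
def RiccatiBounded (P₀ : Paraboloid n) (ε T : ℝ) : Prop :=
  ∃ K : ℝ, 0 < K ∧ ∀ γ ∈ S.scalings P₀ ε, ∀ t ∈ Icc 0 T, ∀ P,
    S.IsSolution (P₀.scale γ) t P → frobNorm (P t).E ≤ K

/-- Along every touching trajectory of the intersection on `[0, T]` the energy is strictly
decreasing at each time `t ∈ (0, T]` at which it lies in `[-ε, 0]`. -/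
def FallingTouching (P₀ : Paraboloid n) (ε T : ℝ) : Prop :=
  ∀ x xq, S.IsTouching (S.parInter P₀ ε) T x xq →
    ∀ t ∈ Ioc 0 T, xq t ∈ Icc (-ε) 0 → derivWithin xq (Icc 0 T) t < 0

end LTISystem

/-- The half-space `x_q ≥ 0`. -/
def nonnegStates (n : ℕ) : Set (State n) := {X | 0 ≤ X.2}

end IQCReach

end

namespace IQCReach

open Filter Topology
open scoped NNReal

/-! ### Ordinary differential equations with a globally Lipschitz right-hand side -/

section ODE

variable {Y : Type*} [NormedAddCommGroup Y] [NormedSpace ℝ Y]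

/-! Write `h_γ` for the value function of the time-varying paraboloid issued from `γ P₀`. The
Riccati equations are made so that along every trajectory the derivative of `h_γ` is a completed
square, `wForm (w - optw)`, which is nonpositive because `M_w ≺ 0` (`value_deriv_eq`). Thus `h_γ`
never increases, and it is constant exactly when `w = optw` almost everywhere.

Over-approximation (`reach_subset`): a start in `P₀` with `x_q ≥ 0` has `base ≤ 0`, so replacing
`base` by `γ * base` with `γ ≥ 1` keeps the initial value nonpositive, and monotonicity does the
rest.

Conversely, let a state with `x_q ≥ 0` lie on one member `γ` and in all others. Follow the touching
trajectory of `γ` back to time `0`. Changing the scaling by `s` changes the initial value to first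
order in `s`, while the loss of value along the trajectory is only of order `s²`, since the touching
disturbances differ by `O(s)`. As the final values are nonpositive for all scalings, so are the
initial ones (`mul_base_nonpos`). Hence the trajectory touches the whole intersection, and scaling
`1` shows that it starts in `P₀`. Falling energy then forbids negative `x_q` before a time with `x_q
≥ 0` (`nonneg_of_falling`, `exists_trajectory`).

A general state of the intersection is reduced to this case. Backwards in time, a large constant
disturbance raises the energy and leaves the paraboloid of scaling `1`
(`exists_escaping_trajectory`). The last time at which some value is nonnegative gives a state of
the first kind, and the two trajectories are concatenated (`mem_reach`).

That last time exists by compactness, which takes two preparations. The scalings are downward closed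
in `[1, ∞)`, and their closure still carries solutions on `[0, T]` (`mem_scalings_of_le`,
`exists_isFamily`). If they are unbounded, the Riccati bound forces `E₀ = 0`; the values are then
quadratic in `γ` with nonpositive leading coefficient, so large scalings can be ignored
(`exists_scaling_bound`). -/

theorem hasDerivWithinAt_Ici_of_Icc {y : ℝ → Y} {y' : Y} {a b t : ℝ}
    (h : HasDerivWithinAt y y' (Icc a b) t) (ht : t ∈ Ico a b) :
    HasDerivWithinAt y y' (Ici t) t :=
  h.mono_of_mem_nhdsWithin
    (mem_of_superset (Icc_mem_nhdsGE ht.2) (Icc_subset_Icc_left ht.1))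

/-- A solution with speed at most `M` stays in the ball of radius `M * T`, so Picard–Lindelöf on
that ball already covers the whole interval. -/
theorem exists_solution_of_bounded [CompleteSpace Y] {F : ℝ → Y → Y} {T M : ℝ} {K : ℝ≥0}
    (hT : 0 ≤ T) (hlip : ∀ t ∈ Icc 0 T, LipschitzWith K (F t))
    (hcont : ∀ y, ContinuousOn (fun t => F t y) (Icc 0 T))
    (hM : ∀ t ∈ Icc 0 T, ∀ y, ‖F t y‖ ≤ M) (y₀ : Y) :
    ∃ y : ℝ → Y, y 0 = y₀ ∧
      ∀ t ∈ Icc 0 T, HasDerivWithinAt y (F t (y t)) (Icc 0 T) t := by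
  have hM0 : 0 ≤ M := (norm_nonneg _).trans (hM 0 ⟨le_rfl, hT⟩ 0)
  have hp : IsPicardLindelof F (tmin := 0) (tmax := T) ⟨0, le_rfl, hT⟩ y₀
      (M.toNNReal * T.toNNReal) 0 M.toNNReal K :=
    { lipschitzOnWith := fun t ht => (hlip t ht).lipschitzOnWith
      continuousOn := fun y _ => hcont y
      norm_le := fun t ht y _ => by rw [Real.coe_toNNReal M hM0]; exact hM t ht y
      mul_max_le := by simp [hM0, hT] }
  exact hp.exists_eq_forall_mem_Icc_hasDerivWithinAt₀

/-- Coordinatewise projection onto the cube `[-R, R]^ι`. -/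
def clamp {ι : Type*} (R : ℝ) (y : ι → ℝ) : ι → ℝ := fun i => max (-R) (min R (y i))

theorem abs_clamp_apply_sub_le {ι : Type*} (R : ℝ) (y z : ι → ℝ) (i : ι) :
    |clamp R y i - clamp R z i| ≤ |y i - z i| :=
  calc |max (-R) (min R (y i)) - max (-R) (min R (z i))| ≤ |min R (y i) - min R (z i)| := by
        simpa using abs_max_sub_max_le_max (-R) (min R (y i)) (-R) (min R (z i))
    _ ≤ |y i - z i| := by simpa using abs_min_sub_min_le_max R (y i) R (z i)

theorem abs_clamp_apply_le {ι : Type*} {R : ℝ} (hR : 0 ≤ R) (y : ι → ℝ) (i : ι) :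
    |clamp R y i| ≤ R :=
  abs_le.2 ⟨le_max_left _ _, max_le (by linarith) (min_le_left _ _)⟩

theorem abs_clamp_apply_le_abs {ι : Type*} {R : ℝ} (hR : 0 ≤ R) (y : ι → ℝ) (i : ι) :
    |clamp R y i| ≤ |y i| := by
  have := abs_clamp_apply_sub_le R y 0 i
  simpa [clamp, hR] using this

theorem clamp_apply_eq {ι : Type*} {R : ℝ} {y : ι → ℝ} {i : ι} (h : |y i| ≤ R) :
    clamp R y i = y i := by
  have := abs_le.1 h
  simp [clamp, this.1, this.2]

/-- Global existence for a globally Lipschitz right-hand side, forward in time. -/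
theorem exists_solution_of_lipschitz {ι : Type*} [Fintype ι] {F : ℝ → (ι → ℝ) → (ι → ℝ)}
    {T : ℝ} {K : ℝ≥0} (hT : 0 ≤ T) (hlip : ∀ t ∈ Icc 0 T, LipschitzWith K (F t))
    (hcont : ∀ y, ContinuousOn (fun t => F t y) (Icc 0 T)) (y₀ : ι → ℝ) :
    ∃ y : ℝ → (ι → ℝ), y 0 = y₀ ∧
      ∀ t ∈ Icc 0 T, HasDerivWithinAt y (F t (y t)) (Icc 0 T) t := by
  obtain ⟨b, hb⟩ := isCompact_Icc.exists_bound_of_continuousOn (hcont 0)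
  have hb0 : 0 ≤ b := (norm_nonneg _).trans (hb 0 ⟨le_rfl, hT⟩)
  have hgrow : ∀ t ∈ Icc 0 T, ∀ y, ‖F t y‖ ≤ K * ‖y‖ + b := fun t ht y => by
    have h1 := (hlip t ht).norm_sub_le y 0
    rw [sub_zero] at h1
    calc ‖F t y‖ = ‖(F t y - F t 0) + F t 0‖ := by rw [sub_add_cancel]
      _ ≤ _ := (norm_add_le _ _).trans (add_le_add h1 (hb t ht))
  -- `R` is the Grönwall bound for solutions of the original equation. Clamping the argument at `R`
  -- makes the right-hand side bounded; since clamping does not increase norms, the same Grönwall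
  -- estimate holds for the clamped equation, whose solution therefore never notices the clamping.
  set R : ℝ := gronwallBound ‖y₀‖ K b T with hR
  have hR0 : 0 ≤ R := by
    have := gronwallBound_mono (norm_nonneg y₀) hb0 K.2 hT
    rw [gronwallBound_x0] at this
    exact (norm_nonneg _).trans this
  have hcl : LipschitzWith 1 (clamp (ι := ι) R) := LipschitzWith.mk_one fun y z => by
    rw [dist_pi_le_iff dist_nonneg]
    intro i
    rw [Real.dist_eq]
    exact (abs_clamp_apply_sub_le R y z i).trans (by rw [← Real.dist_eq]; exact dist_le_pi_dist y z i)
  have hn : ∀ y : ι → ℝ, ‖clamp R y‖ ≤ R := fun y =>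
    (pi_norm_le_iff_of_nonneg hR0).2 fun i => abs_clamp_apply_le hR0 y i
  have hn' : ∀ y : ι → ℝ, ‖clamp R y‖ ≤ ‖y‖ := fun y =>
    (pi_norm_le_iff_of_nonneg (norm_nonneg y)).2 fun i =>
      (abs_clamp_apply_le_abs hR0 y i).trans (norm_le_pi_norm y i)
  obtain ⟨y, hy0, hy⟩ := exists_solution_of_bounded (F := fun t y => F t (clamp R y))
    (M := K * R + b) (K := K * 1) hT (fun t ht => (hlip t ht).comp hcl) (fun y => hcont _)
    (fun t ht y => (hgrow t ht _).trans (by gcongr; exact hn y)) y₀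
  have hle := norm_le_gronwallBound_of_norm_deriv_right_le (δ := ‖y₀‖) (K := K) (ε := b)
    (fun t ht => (hy t ht).continuousWithinAt)
    (fun t ht => hasDerivWithinAt_Ici_of_Icc (hy t (Ico_subset_Icc_self ht)) ht)
    (by rw [hy0])
    (fun t ht => (hgrow t (Ico_subset_Icc_self ht) _).trans (by gcongr; exact hn' _))
  refine ⟨y, hy0, fun t ht => ?_⟩
  have h1 : clamp R (y t) = y t := by
    funext i
    refine clamp_apply_eq ((norm_le_pi_norm (y t) i).trans ((hle t ht).trans ?_))
    exact gronwallBound_mono (norm_nonneg y₀) hb0 K.2 (by linarith [ht.2])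
  have h2 := hy t ht
  simp only [h1] at h2
  exact h2

/-- Global existence for a globally Lipschitz right-hand side, with the value prescribed at an
arbitrary time. -/
theorem exists_solution_through {ι : Type*} [Fintype ι] {F : ℝ → (ι → ℝ) → (ι → ℝ)}
    {T t₁ : ℝ} {K : ℝ≥0} (ht₁ : t₁ ∈ Icc 0 T) (hlip : ∀ t ∈ Icc 0 T, LipschitzWith K (F t))
    (hcont : ∀ y, ContinuousOn (fun t => F t y) (Icc 0 T)) (y₁ : ι → ℝ) :
    ∃ y : ℝ → (ι → ℝ), y t₁ = y₁ ∧
      ∀ t ∈ Icc 0 T, HasDerivWithinAt y (F t (y t)) (Icc 0 T) t := by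
  have hmaps : MapsTo (fun s => t₁ - s) (Icc 0 t₁) (Icc 0 t₁) := fun s hs =>
    ⟨by linarith [hs.2], by linarith [hs.1]⟩
  have hsub : Icc 0 t₁ ⊆ Icc 0 T := Icc_subset_Icc_right ht₁.2
  -- Solve backwards from `t₁` to `0` by reversing time, then forwards from the value reached at
  -- `0`; uniqueness on `[0, t₁]` makes the forward solution pass through `y₁`.
  obtain ⟨z, hz0, hz⟩ := exists_solution_of_lipschitz (F := fun s y => -F (t₁ - s) y) (K := K)
    ht₁.1 (fun s hs => (hlip _ (hsub (hmaps hs))).neg)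
    (fun y => (((hcont y).mono hsub).comp (by fun_prop) hmaps).neg) y₁
  obtain ⟨y, hy0, hy⟩ := exists_solution_of_lipschitz (ht₁.1.trans ht₁.2) hlip hcont (z t₁)
  have hback : ∀ s ∈ Icc 0 t₁,
      HasDerivWithinAt (fun s => z (t₁ - s)) (F s (z (t₁ - s))) (Icc 0 t₁) s := fun s hs => by
    have h1 := (hz (t₁ - s) (hmaps hs)).scomp s
      ((hasDerivWithinAt_id s (Icc 0 t₁)).const_sub t₁) hmaps
    simpa using! h1
  have hy' : ∀ s ∈ Icc 0 t₁, HasDerivWithinAt y (F s (y s)) (Icc 0 t₁) s := fun s hs =>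
    (hy s (hsub hs)).mono hsub
  have heq := ODE_solution_unique_of_mem_Icc_right (v := F) (K := K) (s := fun _ => univ)
    (fun t ht => (hlip t (hsub (Ico_subset_Icc_self ht))).lipschitzOnWith)
    (fun t ht => (hy' t ht).continuousWithinAt)
    (fun t ht => hasDerivWithinAt_Ici_of_Icc (hy' t (Ico_subset_Icc_self ht)) ht)
    (fun _ _ => mem_univ _)
    (fun t ht => (hback t ht).continuousWithinAt)
    (fun t ht => hasDerivWithinAt_Ici_of_Icc (hback t (Ico_subset_Icc_self ht)) ht)
    (fun _ _ => mem_univ _) (by simpa using hy0)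
  refine ⟨y, ?_, hy⟩
  have := heq ⟨ht₁.1, le_rfl⟩
  simpa [hz0] using this

theorem exists_lipschitzOnWith_of_contDiff {Z : Type*} [NormedAddCommGroup Z] [NormedSpace ℝ Z]
    {G : Y → Z} (hG : ContDiff ℝ 1 G) {s : Set Y} (hs : IsCompact s) :
    ∃ K : ℝ≥0, LipschitzOnWith K G s :=
  LocallyLipschitzOn.exists_lipschitzOnWith_of_compact hs (hG.locallyLipschitz.locallyLipschitzOn)

end ODE

/-! ### Integral functions of integrable functions -/

/-- `F` is on `[0, τ]` an integral function of the integrable function `f`. -/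
def HasPrimitive (F f : ℝ → ℝ) (τ : ℝ) : Prop :=
  IntervalIntegrable f volume 0 τ ∧ ∀ t ∈ Icc 0 τ, F t = F 0 + ∫ s in (0 : ℝ)..t, f s

namespace HasPrimitive

variable {F G f g : ℝ → ℝ} {τ : ℝ}

theorem intervalIntegrable_of_mem (h : HasPrimitive F f τ) {a b : ℝ} (ha : a ∈ Icc 0 τ)
    (hb : b ∈ Icc 0 τ) : IntervalIntegrable f volume a b :=
  h.1.mono_set (by
    rw [uIcc_of_le (ha.1.trans ha.2)]
    exact uIcc_subset_Icc ha hb)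

theorem sub_eq (h : HasPrimitive F f τ) {a b : ℝ} (ha : a ∈ Icc 0 τ) (hb : b ∈ Icc 0 τ) :
    F b - F a = ∫ s in a..b, f s := by
  have h0 : (0 : ℝ) ∈ Icc 0 τ := ⟨le_rfl, ha.1.trans ha.2⟩
  rw [h.2 b hb, h.2 a ha, ← intervalIntegral.integral_add_adjacent_intervals
    (h.intervalIntegrable_of_mem h0 ha) (h.intervalIntegrable_of_mem ha hb)]
  ring

theorem continuousOn (h : HasPrimitive F f τ) : ContinuousOn F (Icc 0 τ) := by
  rcases le_or_gt 0 τ with hτ | hτ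
  · have h1 := intervalIntegral.continuousOn_primitive_interval' h.1 left_mem_uIcc
    rw [uIcc_of_le hτ] at h1
    exact (continuousOn_const.add h1).congr h.2
  · rw [Icc_eq_empty (not_le.2 hτ)]
    exact continuousOn_empty _

theorem of_hasDerivWithinAt (hf : ContinuousOn f (Icc 0 τ))
    (h : ∀ t ∈ Icc 0 τ, HasDerivWithinAt F (f t) (Icc 0 τ) t) (hτ : 0 ≤ τ) :
    HasPrimitive F f τ := by
  have hi : IntervalIntegrable f volume 0 τ :=
    ContinuousOn.intervalIntegrable (by rwa [uIcc_of_le hτ])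
  refine ⟨hi, fun t ht => ?_⟩
  have hsub : Icc 0 t ⊆ Icc 0 τ := Icc_subset_Icc_right ht.2
  rw [intervalIntegral.integral_eq_sub_of_hasDerivAt_of_le ht.1
    (fun s hs => (h s (hsub hs)).continuousWithinAt.mono hsub)
    (fun s hs => (h s (hsub (Ioo_subset_Icc_self hs))).hasDerivAt
      (Icc_mem_nhds hs.1 (hs.2.trans_le ht.2)))
    (hi.mono_set (by rw [uIcc_of_le hτ, uIcc_of_le ht.1]; exact hsub))]
  ring

theorem hasDerivWithinAt (h : HasPrimitive F f τ) (hf : ContinuousOn f (Icc 0 τ)) {t : ℝ}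
    (ht : t ∈ Icc 0 τ) : HasDerivWithinAt F (f t) (Icc 0 τ) t := by
  have hτ : 0 ≤ τ := ht.1.trans ht.2
  rcases hτ.eq_or_lt with h0 | h0
  -- Within a single point every number is a derivative.
  · subst h0
    have : t = 0 := le_antisymm ht.2 ht.1
    rw [Icc_self, this]
    exact HasFDerivWithinAt.of_finite (finite_singleton _)
  have : Fact (t ∈ Icc 0 τ) := ⟨ht⟩
  have h1 : HasDerivWithinAt (fun u => ∫ s in (0 : ℝ)..u, f s) (f t) (Icc 0 τ) t :=
    intervalIntegral.integral_hasDerivWithinAt_right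
      (h.intervalIntegrable_of_mem ⟨le_rfl, hτ⟩ ht)
      (hf.stronglyMeasurableAtFilter_nhdsWithin measurableSet_Icc t) (hf t ht)
  exact (h1.const_add (F 0)).congr h.2 (h.2 t ht)

theorem congr_right (h : HasPrimitive F f τ) (hτ : 0 ≤ τ) (hfg : ∀ t ∈ Icc 0 τ, f t = g t) :
    HasPrimitive F g τ := by
  refine ⟨h.1.congr (fun t ht => hfg t ?_), fun t ht => ?_⟩
  · rw [uIoc_of_le hτ] at ht
    exact Ioc_subset_Icc_self ht
  · rw [h.2 t ht]
    congr 1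
    refine intervalIntegral.integral_congr fun s hs => hfg s ?_
    rw [uIcc_of_le ht.1] at hs
    exact ⟨hs.1, hs.2.trans ht.2⟩

theorem add (hF : HasPrimitive F f τ) (hG : HasPrimitive G g τ) :
    HasPrimitive (fun t => F t + G t) (fun t => f t + g t) τ := by
  refine ⟨hF.1.add hG.1, fun t ht => ?_⟩
  have h0 : (0 : ℝ) ∈ Icc 0 τ := ⟨le_rfl, ht.1.trans ht.2⟩
  rw [intervalIntegral.integral_add (hF.intervalIntegrable_of_mem h0 ht)
    (hG.intervalIntegrable_of_mem h0 ht)]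
  simp only [hF.2 t ht, hG.2 t ht]
  ring

theorem const_mul (c : ℝ) (hF : HasPrimitive F f τ) :
    HasPrimitive (fun t => c * F t) (fun t => c * f t) τ := by
  refine ⟨hF.1.const_mul c, fun t ht => ?_⟩
  rw [intervalIntegral.integral_const_mul]
  simp only [hF.2 t ht]
  ring

theorem sub (hF : HasPrimitive F f τ) (hG : HasPrimitive G g τ) :
    HasPrimitive (fun t => F t - G t) (fun t => f t - g t) τ := by
  simpa [sub_eq_add_neg] using! hF.add (hG.const_mul (-1))

theorem sum {ι : Type*} (s : Finset ι) {F f : ι → ℝ → ℝ}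
    (h : ∀ i ∈ s, HasPrimitive (F i) (f i) τ) :
    HasPrimitive (fun t => ∑ i ∈ s, F i t) (fun t => ∑ i ∈ s, f i t) τ := by
  classical
  induction s using Finset.induction_on with
  | empty => simp [HasPrimitive]
  | insert a s ha ih =>
    simp only [Finset.sum_insert ha]
    exact (h a (Finset.mem_insert_self a s)).add
      (ih fun i hi => h i (Finset.mem_insert_of_mem hi))

theorem mono (h : HasPrimitive F f τ) {σ : ℝ} (hσ : σ ∈ Icc 0 τ) : HasPrimitive F f σ :=
  ⟨h.intervalIntegrable_of_mem ⟨le_rfl, hσ.1.trans hσ.2⟩ hσ, fun t ht =>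
    h.2 t ⟨ht.1, ht.2.trans hσ.2⟩⟩

/-- The product rule. -/
theorem mul (hτ : 0 ≤ τ) (hF : HasPrimitive F f τ) (hG : HasPrimitive G g τ) :
    HasPrimitive (fun t => F t * G t) (fun t => f t * G t + F t * g t) τ := by
  have hFc := hF.continuousOn
  have hGc := hG.continuousOn
  rw [← uIcc_of_le hτ] at hFc hGc
  refine ⟨(hF.1.mul_continuousOn hGc).add (hG.1.continuousOn_mul hFc), fun t ht => ?_⟩
  have hF' := hF.mono ht
  have hG' := hG.mono ht
  set A : ℝ → ℝ := fun t => F 0 + ∫ s in (0 : ℝ)..t, f s with hA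
  set B : ℝ → ℝ := fun t => G 0 + ∫ s in (0 : ℝ)..t, g s with hB
  have hconst : ∀ c : ℝ, AbsolutelyContinuousOnInterval (fun _ : ℝ => c) 0 t := fun c =>
    (LipschitzWith.const c).lipschitzOnWith.absolutelyContinuousOnInterval
  have hAac : AbsolutelyContinuousOnInterval A 0 t :=
    (hconst _).add (hF'.1.absolutelyContinuousOnInterval_intervalIntegral left_mem_uIcc)
  have hBac : AbsolutelyContinuousOnInterval B 0 t :=
    (hconst _).add (hG'.1.absolutelyContinuousOnInterval_intervalIntegral left_mem_uIcc)
  have h1 := hAac.integral_deriv_mul_eq_sub hBac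
  have hFA : ∀ s ∈ Icc 0 t, F s = A s := hF'.2
  have hGB : ∀ s ∈ Icc 0 t, G s = B s := hG'.2
  have h2 : ∫ s in (0 : ℝ)..t, deriv A s * B s + A s * deriv B s =
      ∫ s in (0 : ℝ)..t, f s * G s + F s * g s := by
    apply intervalIntegral.integral_congr_ae
    filter_upwards [hF'.1.ae_hasDerivAt_integral, hG'.1.ae_hasDerivAt_integral] with s h3 h4 hs
    have hs' : s ∈ uIcc 0 t := uIoc_subset_uIcc hs
    have hs'' : s ∈ Icc 0 t := by rwa [uIcc_of_le ht.1] at hs'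
    rw [((h3 hs' 0 left_mem_uIcc).const_add (F 0)).deriv,
      ((h4 hs' 0 left_mem_uIcc).const_add (G 0)).deriv, hFA s hs'', hGB s hs'']
  rw [← h2, h1, ← hFA t ⟨ht.1, le_rfl⟩, ← hGB t ⟨ht.1, le_rfl⟩, ← hFA 0 ⟨le_rfl, ht.1⟩,
    ← hGB 0 ⟨le_rfl, ht.1⟩]
  ring

end HasPrimitive

/-! ### Completion of squares -/

theorem dotProduct_mulVec_eq_transpose {k l : Type*} [Fintype k] [Fintype l] (x : k → ℝ)
    (A : Matrix k l ℝ) (v : l → ℝ) : x ⬝ᵥ (A *ᵥ v) = (Aᵀ *ᵥ x) ⬝ᵥ v := by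
  rw [Matrix.dotProduct_mulVec, Matrix.mulVec_transpose]

namespace LTISystem

variable {n p m : ℕ} (S : LTISystem n p m)

/-- The quadratic form of the disturbance. -/
def wForm (z : Fin m → ℝ) : ℝ := z ⬝ᵥ (S.Mw *ᵥ z)

/-- The disturbance along touching trajectories of the time-varying paraboloid. -/
noncomputable def optw (E : Matrix (Fin n) (Fin n) ℝ) (f : Fin n → ℝ) (v : Fin p → ℝ) (x : Fin n → ℝ) :
    Fin m → ℝ :=
  -(S.Mw⁻¹ *ᵥ ((S.Bᵀ * E + S.Mxwᵀ) *ᵥ x + (S.Muwᵀ *ᵥ v - S.Bᵀ *ᵥ f)))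

/-- The right-hand side of the state equation. -/
def drift (x : Fin n → ℝ) (v : Fin p → ℝ) (w : Fin m → ℝ) : Fin n → ℝ :=
  S.A *ᵥ x + S.B *ᵥ w + S.Bu *ᵥ v

theorem Mx_symm : S.Mxᵀ = S.Mx := by
  ext i j; exact S.M_symm.apply _ _

theorem Mw_symm : S.Mwᵀ = S.Mw := by
  ext i j; exact S.M_symm.apply _ _

theorem neg_Mw_posDef : (-S.Mw).PosDef := S.Mw_neg

theorem isUnit_det_Mw : IsUnit S.Mw.det := by
  have h := (S.neg_Mw_posDef.isUnit).neg
  rw [neg_neg] at h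
  exact (Matrix.isUnit_iff_isUnit_det _).1 h

theorem Mw_inv_symm : (S.Mw⁻¹)ᵀ = S.Mw⁻¹ := by
  rw [Matrix.transpose_nonsing_inv, Mw_symm]

theorem wForm_neg {z : Fin m → ℝ} (hz : z ≠ 0) : S.wForm z < 0 := by
  have h := S.neg_Mw_posDef.dotProduct_mulVec_pos hz
  simp only [star_trivial, Matrix.neg_mulVec, dotProduct_neg] at h
  unfold wForm
  linarith

theorem wForm_zero : S.wForm 0 = 0 := by simp [wForm]

theorem wForm_nonpos (z : Fin m → ℝ) : S.wForm z ≤ 0 := by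
  rcases eq_or_ne z 0 with rfl | hz
  · rw [wForm_zero]
  · exact (S.wForm_neg hz).le

theorem wForm_eq_zero {z : Fin m → ℝ} (h : S.wForm z = 0) : z = 0 := by
  by_contra hz
  exact (S.wForm_neg hz).ne h

theorem wForm_smul (c : ℝ) (z : Fin m → ℝ) : S.wForm (c • z) = c ^ 2 * S.wForm z := by
  simp only [wForm, Matrix.mulVec_smul, smul_dotProduct, dotProduct_smul, smul_eq_mul]
  ring

theorem rate_eq (x : Fin n → ℝ) (v : Fin p → ℝ) (w : Fin m → ℝ) :
    S.rate x v w = x ⬝ᵥ (S.Mx *ᵥ x) + 2 * (x ⬝ᵥ (S.Mxu *ᵥ v)) + 2 * (x ⬝ᵥ (S.Mxw *ᵥ w))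
      + v ⬝ᵥ (S.Mu *ᵥ v) + 2 * (v ⬝ᵥ (S.Muw *ᵥ w)) + w ⬝ᵥ (S.Mw *ᵥ w) := by
  have h1 : v ⬝ᵥ (S.Mxuᵀ *ᵥ x) = x ⬝ᵥ (S.Mxu *ᵥ v) := by
    rw [dotProduct_mulVec_eq_transpose, Matrix.transpose_transpose, dotProduct_comm]
  have h2 : w ⬝ᵥ (S.Mxwᵀ *ᵥ x) = x ⬝ᵥ (S.Mxw *ᵥ w) := by
    rw [dotProduct_mulVec_eq_transpose, Matrix.transpose_transpose, dotProduct_comm]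
  have h3 : w ⬝ᵥ (S.Muwᵀ *ᵥ v) = v ⬝ᵥ (S.Muw *ᵥ w) := by
    rw [dotProduct_mulVec_eq_transpose, Matrix.transpose_transpose, dotProduct_comm]
  have e1 : S.Mxuᵀ = S.M.submatrix (fun j => Sum.inr (Sum.inl j)) Sum.inl := by
    ext i j; exact S.M_symm.apply _ _
  have e2 : S.Mxwᵀ = S.M.submatrix (fun j => Sum.inr (Sum.inr j)) Sum.inl := by
    ext i j; exact S.M_symm.apply _ _
  have e3 : S.Muwᵀ = S.M.submatrix (fun j => Sum.inr (Sum.inr j)) (fun j => Sum.inr (Sum.inl j)) := by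
    ext i j; exact S.M_symm.apply _ _
  have key : S.rate x v w = (x ⬝ᵥ (S.Mx *ᵥ x) + x ⬝ᵥ (S.Mxu *ᵥ v) + x ⬝ᵥ (S.Mxw *ᵥ w))
      + (v ⬝ᵥ (S.Mxuᵀ *ᵥ x) + v ⬝ᵥ (S.Mu *ᵥ v) + v ⬝ᵥ (S.Muw *ᵥ w))
      + (w ⬝ᵥ (S.Mxwᵀ *ᵥ x) + w ⬝ᵥ (S.Muwᵀ *ᵥ v) + w ⬝ᵥ (S.Mw *ᵥ w)) := by
    rw [e1, e2, e3]
    simp only [rate, dotProduct, Matrix.mulVec, Fintype.sum_sum_type, Sum.elim_inl, Sum.elim_inr,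
      Mx, Mxu, Mxw, Mu, Muw, Mw, Matrix.submatrix_apply, mul_add, Finset.sum_add_distrib]
    ring
  rw [key, h1, h2, h3]
  ring

/-- Completion of the square in `w`: `2 y` is the coefficient of the linear term in `w` of the
derivative of the value function, so the vertex is `-Mw⁻¹ y`, which is `optw`. -/
theorem wForm_sub_optw (E : Matrix (Fin n) (Fin n) ℝ) (f : Fin n → ℝ) (v : Fin p → ℝ)
    (x : Fin n → ℝ) (w : Fin m → ℝ) :
    let y := (S.Bᵀ * E + S.Mxwᵀ) *ᵥ x + (S.Muwᵀ *ᵥ v - S.Bᵀ *ᵥ f)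
    S.wForm (w - S.optw E f v x) =
      y ⬝ᵥ (S.Mw⁻¹ *ᵥ y) + 2 * (y ⬝ᵥ w) + w ⬝ᵥ (S.Mw *ᵥ w) := by
  intro y
  have h0 : S.optw E f v x = -(S.Mw⁻¹ *ᵥ y) := rfl
  have h1 : S.Mw *ᵥ (S.Mw⁻¹ *ᵥ y) = y := by
    rw [Matrix.mulVec_mulVec, Matrix.mul_nonsing_inv _ S.isUnit_det_Mw, Matrix.one_mulVec]
  have h2 : (S.Mw⁻¹ *ᵥ y) ⬝ᵥ (S.Mw *ᵥ w) = y ⬝ᵥ w := by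
    rw [dotProduct_mulVec_eq_transpose, Mw_symm, h1]
  clear_value y
  rw [h0, sub_neg_eq_add, wForm, Matrix.mulVec_add, h1, dotProduct_add, add_dotProduct,
    add_dotProduct, h2, dotProduct_comm w y, dotProduct_comm (S.Mw⁻¹ *ᵥ y) y]
  ring

/-- The derivative of the value function along trajectories. -/
theorem value_deriv_eq {E : Matrix (Fin n) (Fin n) ℝ} (hE : E.IsSymm) (f : Fin n → ℝ)
    (v : Fin p → ℝ) (x : Fin n → ℝ) (w : Fin m → ℝ) :
    x ⬝ᵥ (S.rhsE E *ᵥ x) + 2 * (x ⬝ᵥ (E *ᵥ S.drift x v w)) - 2 * (S.rhsf E f v ⬝ᵥ x)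
      - 2 * (f ⬝ᵥ S.drift x v w) + S.rhsg f v + S.rate x v w
      = S.wForm (w - S.optw E f v x) := by
  rw [wForm_sub_optw]
  -- The vector `y` is split into `a`, linear in `x`, and `b`, free of `x`. In `yᵀ Mw⁻¹ y` the
  -- Riccati equation supplies the `a`-`a` term, the equation for `f` the mixed term and the
  -- equation for `g` the `b`-`b` term.
  set a := (S.Bᵀ * E + S.Mxwᵀ) *ᵥ x with ha
  set b := S.Muwᵀ *ᵥ v - S.Bᵀ *ᵥ f with hb
  have hEt : Eᵀ = E := hE
  have hN : (S.Bᵀ * E + S.Mxwᵀ)ᵀ = E * S.B + S.Mxw := by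
    rw [Matrix.transpose_add, Matrix.transpose_mul, Matrix.transpose_transpose,
      Matrix.transpose_transpose, hEt]
  have hN' : (E * S.B + S.Mxw)ᵀ = S.Bᵀ * E + S.Mxwᵀ := by
    rw [← hN, Matrix.transpose_transpose]
  have t1 : x ⬝ᵥ (S.rhsE E *ᵥ x) =
      -2 * (x ⬝ᵥ (E *ᵥ (S.A *ᵥ x))) - x ⬝ᵥ (S.Mx *ᵥ x) + a ⬝ᵥ (S.Mw⁻¹ *ᵥ a) := by
    have h1 : x ⬝ᵥ ((S.Aᵀ * E) *ᵥ x) = x ⬝ᵥ (E *ᵥ (S.A *ᵥ x)) := by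
      rw [dotProduct_mulVec_eq_transpose, Matrix.transpose_mul, Matrix.transpose_transpose, hEt,
        dotProduct_comm, Matrix.mulVec_mulVec]
    have h2 : x ⬝ᵥ (((S.Bᵀ * E + S.Mxwᵀ)ᵀ * S.Mw⁻¹ * (S.Bᵀ * E + S.Mxwᵀ)) *ᵥ x) =
        a ⬝ᵥ (S.Mw⁻¹ *ᵥ a) := by
      rw [Matrix.mul_assoc, ← Matrix.mulVec_mulVec, dotProduct_mulVec_eq_transpose,
        Matrix.transpose_transpose, ← Matrix.mulVec_mulVec]
    rw [rhsE, Matrix.add_mulVec, dotProduct_add, h2, Matrix.sub_mulVec, Matrix.sub_mulVec,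
      Matrix.neg_mulVec, dotProduct_sub, dotProduct_sub, dotProduct_neg, h1,
      ← Matrix.mulVec_mulVec]
    ring
  have t2 : S.rhsf E f v ⬝ᵥ x = -(f ⬝ᵥ (S.A *ᵥ x)) + x ⬝ᵥ (S.Mxu *ᵥ v)
      + x ⬝ᵥ (E *ᵥ (S.Bu *ᵥ v)) - a ⬝ᵥ (S.Mw⁻¹ *ᵥ b) := by
    have h1 : (S.Aᵀ *ᵥ f) ⬝ᵥ x = f ⬝ᵥ (S.A *ᵥ x) := (dotProduct_mulVec_eq_transpose _ _ _).symm
    have h2 : (((E * S.B + S.Mxw) * S.Mw⁻¹) *ᵥ (S.Bᵀ *ᵥ f - S.Muwᵀ *ᵥ v)) ⬝ᵥ x =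
        -(a ⬝ᵥ (S.Mw⁻¹ *ᵥ b)) := by
      rw [← neg_sub, ← hb, Matrix.mulVec_neg, neg_dotProduct, dotProduct_comm,
        ← Matrix.mulVec_mulVec, dotProduct_mulVec_eq_transpose, hN']
    rw [rhsf, add_dotProduct, add_dotProduct, neg_dotProduct, h1, h2, dotProduct_comm _ x,
      Matrix.add_mulVec, dotProduct_add, ← Matrix.mulVec_mulVec]
    ring
  have t3 : S.rhsg f v = b ⬝ᵥ (S.Mw⁻¹ *ᵥ b) + 2 * (f ⬝ᵥ (S.Bu *ᵥ v)) - v ⬝ᵥ (S.Mu *ᵥ v) := by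
    have h1 : f ⬝ᵥ ((S.B * S.Mw⁻¹ * S.Bᵀ) *ᵥ f) = (S.Bᵀ *ᵥ f) ⬝ᵥ (S.Mw⁻¹ *ᵥ (S.Bᵀ *ᵥ f)) := by
      rw [Matrix.mul_assoc, ← Matrix.mulVec_mulVec, dotProduct_mulVec_eq_transpose,
        ← Matrix.mulVec_mulVec]
    have h2 : f ⬝ᵥ ((S.B * S.Mw⁻¹ * S.Muwᵀ) *ᵥ v) =
        (S.Bᵀ *ᵥ f) ⬝ᵥ (S.Mw⁻¹ *ᵥ (S.Muwᵀ *ᵥ v)) := by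
      rw [Matrix.mul_assoc, ← Matrix.mulVec_mulVec, dotProduct_mulVec_eq_transpose,
        ← Matrix.mulVec_mulVec]
    have h3 : v ⬝ᵥ ((S.Muw * S.Mw⁻¹ * S.Muwᵀ) *ᵥ v) =
        (S.Muwᵀ *ᵥ v) ⬝ᵥ (S.Mw⁻¹ *ᵥ (S.Muwᵀ *ᵥ v)) := by
      rw [Matrix.mul_assoc, ← Matrix.mulVec_mulVec, dotProduct_mulVec_eq_transpose,
        ← Matrix.mulVec_mulVec]
    have h4 : (S.Muwᵀ *ᵥ v) ⬝ᵥ (S.Mw⁻¹ *ᵥ (S.Bᵀ *ᵥ f)) =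
        (S.Bᵀ *ᵥ f) ⬝ᵥ (S.Mw⁻¹ *ᵥ (S.Muwᵀ *ᵥ v)) := by
      rw [dotProduct_mulVec_eq_transpose, Mw_inv_symm, dotProduct_comm]
    rw [rhsg, Matrix.sub_mulVec, Matrix.sub_mulVec, dotProduct_sub, dotProduct_sub, h1, h2, h3, hb,
      Matrix.mulVec_sub, sub_dotProduct, dotProduct_sub, dotProduct_sub, h4]
    ring
  have t4 : a ⬝ᵥ w = x ⬝ᵥ (E *ᵥ (S.B *ᵥ w)) + x ⬝ᵥ (S.Mxw *ᵥ w) := by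
    rw [ha, ← hN', ← dotProduct_mulVec_eq_transpose, Matrix.add_mulVec, dotProduct_add,
      ← Matrix.mulVec_mulVec]
  have t5 : b ⬝ᵥ w = v ⬝ᵥ (S.Muw *ᵥ w) - f ⬝ᵥ (S.B *ᵥ w) := by
    rw [hb, sub_dotProduct, ← dotProduct_mulVec_eq_transpose, ← dotProduct_mulVec_eq_transpose]
  have t6 : b ⬝ᵥ (S.Mw⁻¹ *ᵥ a) = a ⬝ᵥ (S.Mw⁻¹ *ᵥ b) := by
    rw [dotProduct_mulVec_eq_transpose, Mw_inv_symm, dotProduct_comm]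
  have t7 : x ⬝ᵥ (E *ᵥ S.drift x v w) = x ⬝ᵥ (E *ᵥ (S.A *ᵥ x)) + x ⬝ᵥ (E *ᵥ (S.B *ᵥ w))
      + x ⬝ᵥ (E *ᵥ (S.Bu *ᵥ v)) := by
    rw [drift, Matrix.mulVec_add, Matrix.mulVec_add, dotProduct_add, dotProduct_add]
  have t8 : f ⬝ᵥ S.drift x v w = f ⬝ᵥ (S.A *ᵥ x) + f ⬝ᵥ (S.B *ᵥ w) + f ⬝ᵥ (S.Bu *ᵥ v) := by
    rw [drift, dotProduct_add, dotProduct_add]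
  rw [t1, t2, t3, t7, t8, rate_eq, Matrix.mulVec_add, dotProduct_add, add_dotProduct,
    add_dotProduct, add_dotProduct, t4, t5, t6]
  ring

/-- The energy rate as a function of the disturbance. -/
theorem rate_eq_rate_add_wForm (x : Fin n → ℝ) (v : Fin p → ℝ) (w : Fin m → ℝ) :
    S.rate x v w = S.rate x v (S.optw 0 0 v x) + S.wForm (w - S.optw 0 0 v x) := by
  have hdrift : ∀ w, x ⬝ᵥ ((0 : Matrix (Fin n) (Fin n) ℝ) *ᵥ S.drift x v w) = 0 := by simp
  -- With `E = 0` and `f = 0` all terms but the rate are independent of `w`, so two instances of the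
  -- identity can be subtracted.
  have h1 := S.value_deriv_eq (E := 0) (by simp [Matrix.IsSymm]) 0 v x w
  have h2 := S.value_deriv_eq (E := 0) (by simp [Matrix.IsSymm]) 0 v x (S.optw 0 0 v x)
  simp only [hdrift, zero_dotProduct, sub_self, wForm_zero] at h1 h2
  linarith

theorem rate_smul (c : ℝ) (x : Fin n → ℝ) (v : Fin p → ℝ) (w : Fin m → ℝ) :
    S.rate (c • x) (c • v) (c • w) = c ^ 2 * S.rate x v w := by
  simp only [rate_eq, Matrix.mulVec_smul, smul_dotProduct, dotProduct_smul, smul_eq_mul]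
  ring

theorem optw_smul (c : ℝ) (E : Matrix (Fin n) (Fin n) ℝ) (f : Fin n → ℝ) (v : Fin p → ℝ)
    (x : Fin n → ℝ) : S.optw E (c • f) (c • v) (c • x) = c • S.optw E f v x := by
  simp only [optw, Matrix.mulVec_smul, smul_neg, ← smul_sub, ← smul_add]

/-- As `c` grows, `optw (c • E) (c • f) v x` moves along a ray from `optw 0 0 v x`, which maximizes
the concave function `w ↦ rate x v w`. The rate thus drops by a multiple of `c ^ 2`. This makes the
condition `x_q'(0) ≥ 0` easier to meet for smaller scalings. -/
theorem rate_optw_smul_anti {E : Matrix (Fin n) (Fin n) ℝ} {f : Fin n → ℝ} (v : Fin p → ℝ)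
    (x : Fin n → ℝ) {γ γ' : ℝ} (h0 : 0 ≤ γ') (h : γ' ≤ γ) :
    S.rate x v (S.optw (γ • E) (γ • f) v x) ≤ S.rate x v (S.optw (γ' • E) (γ' • f) v x) := by
  have key : ∀ c : ℝ, S.optw (c • E) (c • f) v x - S.optw 0 0 v x =
      c • (S.Mw⁻¹ *ᵥ (S.Bᵀ *ᵥ f - (S.Bᵀ * E) *ᵥ x)) := by
    intro c
    have e : (S.Bᵀ * (c • E) + S.Mxwᵀ) *ᵥ x + (S.Muwᵀ *ᵥ v - S.Bᵀ *ᵥ (c • f)) =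
        ((S.Bᵀ * (0 : Matrix (Fin n) (Fin n) ℝ) + S.Mxwᵀ) *ᵥ x + (S.Muwᵀ *ᵥ v - S.Bᵀ *ᵥ 0))
          - c • (S.Bᵀ *ᵥ f - (S.Bᵀ * E) *ᵥ x) := by
      simp only [Matrix.mul_smul, Matrix.add_mulVec, Matrix.smul_mulVec, Matrix.mulVec_smul,
        Matrix.mul_zero, Matrix.zero_mulVec, Matrix.mulVec_zero, smul_sub]
      abel
    unfold optw
    rw [e, Matrix.mulVec_sub, Matrix.mulVec_smul]
    abel
  rw [S.rate_eq_rate_add_wForm x v (S.optw (γ • E) (γ • f) v x),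
    S.rate_eq_rate_add_wForm x v (S.optw (γ' • E) (γ' • f) v x), key, key, wForm_smul, wForm_smul]
  have h1 : γ' ^ 2 ≤ γ ^ 2 := by gcongr
  have h2 := S.wForm_nonpos (S.Mw⁻¹ *ᵥ (S.Bᵀ *ᵥ f - (S.Bᵀ * E) *ᵥ x))
  nlinarith

end LTISystem

/-! ### Trajectories -/

theorem HasPrimitive.dotProduct {ι : Type*} [Fintype ι] {X Y X' Y' : ℝ → ι → ℝ} {τ : ℝ}
    (hτ : 0 ≤ τ) (hX : ∀ i, HasPrimitive (fun t => X t i) (fun t => X' t i) τ)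
    (hY : ∀ i, HasPrimitive (fun t => Y t i) (fun t => Y' t i) τ) :
    HasPrimitive (fun t => X t ⬝ᵥ Y t) (fun t => X' t ⬝ᵥ Y t + X t ⬝ᵥ Y' t) τ := by
  have h := HasPrimitive.sum Finset.univ fun i _ => (hX i).mul hτ (hY i)
  simp only [Finset.sum_add_distrib] at h
  exact h

theorem HasPrimitive.mulVec {ι κ : Type*} [Fintype κ] {N N' : ℝ → Matrix ι κ ℝ}
    {Y Y' : ℝ → κ → ℝ} {τ : ℝ} (hτ : 0 ≤ τ)
    (hN : ∀ i j, HasPrimitive (fun t => N t i j) (fun t => N' t i j) τ)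
    (hY : ∀ i, HasPrimitive (fun t => Y t i) (fun t => Y' t i) τ) (i : ι) :
    HasPrimitive (fun t => (N t *ᵥ Y t) i) (fun t => (N' t *ᵥ Y t + N t *ᵥ Y' t) i) τ :=
  HasPrimitive.dotProduct (X := fun t => N t i) (X' := fun t => N' t i) hτ (hN i) hY

theorem eq_add_integral_of_hasDerivWithinAt {Y : Type*} [NormedAddCommGroup Y] [NormedSpace ℝ Y]
    [CompleteSpace Y] {y y' : ℝ → Y} {T : ℝ} (hc : ContinuousOn y' (Icc 0 T))
    (h : ∀ t ∈ Icc 0 T, HasDerivWithinAt y (y' t) (Icc 0 T) t) {t : ℝ} (ht : t ∈ Icc 0 T) :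
    y t = y 0 + ∫ s in (0 : ℝ)..t, y' s := by
  have hsub : Icc 0 t ⊆ Icc 0 T := Icc_subset_Icc_right ht.2
  rw [intervalIntegral.integral_eq_sub_of_hasDerivAt_of_le ht.1
    (fun s hs => (h s (hsub hs)).continuousWithinAt.mono hsub)
    (fun s hs => (h s (hsub (Ioo_subset_Icc_self hs))).hasDerivAt
      (Icc_mem_nhds hs.1 (hs.2.trans_le ht.2)))
    (ContinuousOn.intervalIntegrable (by rw [uIcc_of_le ht.1]; exact hc.mono hsub))]
  abel

/-- Solutions of linear inhomogeneous equations exist globally. -/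
theorem exists_affine_solution {ι : Type*} [Fintype ι] {N : ℝ → Matrix ι ι ℝ} {k : ℝ → ι → ℝ}
    {T t₁ : ℝ} (ht₁ : t₁ ∈ Icc 0 T) (hN : ContinuousOn N (Icc 0 T))
    (hk : ContinuousOn k (Icc 0 T)) (x₁ : ι → ℝ) :
    ∃ x : ℝ → ι → ℝ, x t₁ = x₁ ∧
      ∀ t ∈ Icc 0 T, HasDerivWithinAt x (N t *ᵥ x t + k t) (Icc 0 T) t := by
  have hsum : ContinuousOn (fun t => ∑ i, ∑ j, |N t i j|) (Icc 0 T) := by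
    refine continuousOn_finsetSum _ fun i _ => continuousOn_finsetSum _ fun j _ => ?_
    exact (((continuous_apply j).comp (continuous_apply i)).comp_continuousOn
      (f := N) hN).abs
  obtain ⟨C, hC⟩ := isCompact_Icc.exists_bound_of_continuousOn hsum
  refine exists_solution_through (F := fun t y => N t *ᵥ y + k t) (K := C.toNNReal) ht₁
    (fun t ht => LipschitzWith.of_dist_le_mul fun y z => ?_) (fun y => ?_) x₁
  · rw [dist_add_right, dist_eq_norm, ← Matrix.mulVec_sub, dist_eq_norm]
    have hC' : ∑ i, ∑ j, |N t i j| ≤ C := (le_abs_self _).trans (hC t ht)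
    refine (pi_norm_le_iff_of_nonneg (by positivity)).2 fun i => ?_
    calc |∑ j, N t i j * (y - z) j| ≤ ∑ j, |N t i j * (y - z) j| := Finset.abs_sum_le_sum_abs _ _
      _ ≤ ∑ j, |N t i j| * ‖y - z‖ := by
        gcongr with j
        rw [abs_mul]
        gcongr
        exact norm_le_pi_norm (y - z) j
      _ = (∑ j, |N t i j|) * ‖y - z‖ := by rw [Finset.sum_mul]
      _ ≤ C.toNNReal * ‖y - z‖ := by
        gcongr
        refine (le_trans ?_ hC').trans (Real.le_coe_toNNReal C)
        exact Finset.single_le_sum (f := fun i => ∑ j, |N t i j|)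
          (fun i _ => Finset.sum_nonneg fun j _ => abs_nonneg _) (Finset.mem_univ i)
  · exact ContinuousOn.add ((Continuous.matrix_mulVec continuous_id continuous_const).comp_continuousOn hN) hk

namespace LTISystem

variable {n p m : ℕ} (S : LTISystem n p m)

theorem continuous_rate : Continuous fun z : (Fin n → ℝ) × (Fin p → ℝ) × (Fin m → ℝ) =>
    S.rate z.1 z.2.1 z.2.2 := by
  simp only [rate_eq]
  fun_prop

theorem continuous_drift : Continuous fun z : (Fin n → ℝ) × (Fin p → ℝ) × (Fin m → ℝ) =>
    S.drift z.1 z.2.1 z.2.2 := by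
  unfold drift
  fun_prop

theorem continuous_optw : Continuous fun z : Matrix (Fin n) (Fin n) ℝ × (Fin n → ℝ) ×
    (Fin p → ℝ) × (Fin n → ℝ) => S.optw z.1 z.2.1 z.2.2.1 z.2.2.2 := by
  unfold optw
  fun_prop

theorem continuous_wForm : Continuous S.wForm := by
  unfold wForm
  fun_prop

theorem continuous_rhsE : Continuous S.rhsE := by
  unfold rhsE
  fun_prop

theorem continuous_rhsf : Continuous fun z : Matrix (Fin n) (Fin n) ℝ × (Fin n → ℝ) ×
    (Fin p → ℝ) => S.rhsf z.1 z.2.1 z.2.2 := by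
  unfold rhsf
  fun_prop

theorem continuous_rhsg : Continuous fun z : (Fin n → ℝ) × (Fin p → ℝ) =>
    S.rhsg z.1 z.2 := by
  unfold rhsg
  fun_prop

variable {S}

theorem continuousOn_rate {s : Set ℝ} {x : ℝ → Fin n → ℝ} {v : ℝ → Fin p → ℝ}
    {w : ℝ → Fin m → ℝ} (hx : ContinuousOn x s) (hv : ContinuousOn v s) (hw : ContinuousOn w s) :
    ContinuousOn (fun t => S.rate (x t) (v t) (w t)) s :=
  S.continuous_rate.comp_continuousOn (f := fun t => (x t, v t, w t)) (hx.prodMk (hv.prodMk hw))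

theorem continuousOn_drift {s : Set ℝ} {x : ℝ → Fin n → ℝ} {v : ℝ → Fin p → ℝ}
    {w : ℝ → Fin m → ℝ} (hx : ContinuousOn x s) (hv : ContinuousOn v s) (hw : ContinuousOn w s) :
    ContinuousOn (fun t => S.drift (x t) (v t) (w t)) s :=
  S.continuous_drift.comp_continuousOn (f := fun t => (x t, v t, w t)) (hx.prodMk (hv.prodMk hw))

theorem continuousOn_optw {s : Set ℝ} {E : ℝ → Matrix (Fin n) (Fin n) ℝ}
    {f x : ℝ → Fin n → ℝ} {v : ℝ → Fin p → ℝ} (hE : ContinuousOn E s) (hf : ContinuousOn f s)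
    (hv : ContinuousOn v s) (hx : ContinuousOn x s) :
    ContinuousOn (fun t => S.optw (E t) (f t) (v t) (x t)) s :=
  S.continuous_optw.comp_continuousOn (f := fun t => (E t, f t, v t, x t))
    (hE.prodMk (hf.prodMk (hv.prodMk hx)))

theorem continuousOn_rhsf {s : Set ℝ} {E : ℝ → Matrix (Fin n) (Fin n) ℝ}
    {f : ℝ → Fin n → ℝ} {v : ℝ → Fin p → ℝ} (hE : ContinuousOn E s) (hf : ContinuousOn f s)
    (hv : ContinuousOn v s) : ContinuousOn (fun t => S.rhsf (E t) (f t) (v t)) s :=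
  S.continuous_rhsf.comp_continuousOn (f := fun t => (E t, f t, v t)) (hE.prodMk (hf.prodMk hv))

theorem continuousOn_rhsg {s : Set ℝ} {f : ℝ → Fin n → ℝ} {v : ℝ → Fin p → ℝ}
    (hf : ContinuousOn f s) (hv : ContinuousOn v s) :
    ContinuousOn (fun t => S.rhsg (f t) (v t)) s :=
  S.continuous_rhsg.comp_continuousOn (f := fun t => (f t, v t)) (hf.prodMk hv)

variable (S)

theorem continuousOn_u {τ : ℝ} : ContinuousOn S.u (Icc 0 τ) :=
  S.u_contDiffOn.continuousOn.mono Icc_subset_Ici_self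

variable {S}

namespace IsSolution

variable {P₀ : Paraboloid n} {τ : ℝ} {P : ℝ → Paraboloid n}

theorem mono (h : S.IsSolution P₀ τ P) {σ : ℝ} (hσ : σ ≤ τ) : S.IsSolution P₀ σ P :=
  have hsub : Icc 0 σ ⊆ Icc 0 τ := Icc_subset_Icc_right hσ
  { init := h.init
    E_deriv := fun t ht i j => (h.E_deriv t (hsub ht) i j).mono hsub
    f_deriv := fun t ht => (h.f_deriv t (hsub ht)).mono hsub
    g_eq := fun t ht => h.g_eq t (hsub ht) }

theorem continuousOn_E (h : S.IsSolution P₀ τ P) : ContinuousOn (fun s => (P s).E) (Icc 0 τ) :=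
  continuousOn_pi.2 fun i => continuousOn_pi.2 fun j => fun t ht =>
    (h.E_deriv t ht i j).continuousWithinAt

theorem continuousOn_f (h : S.IsSolution P₀ τ P) : ContinuousOn (fun s => (P s).f) (Icc 0 τ) :=
  fun t ht => (h.f_deriv t ht).continuousWithinAt

theorem hasPrimitive_E (h : S.IsSolution P₀ τ P) (hτ : 0 ≤ τ) (i j : Fin n) :
    HasPrimitive (fun s => (P s).E i j) (fun s => S.rhsE (P s).E i j) τ :=
  HasPrimitive.of_hasDerivWithinAt
    (continuousOn_pi.1 (continuousOn_pi.1
      (S.continuous_rhsE.comp_continuousOn h.continuousOn_E) i) j)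
    (fun t ht => h.E_deriv t ht i j) hτ

theorem hasPrimitive_f (h : S.IsSolution P₀ τ P) (hτ : 0 ≤ τ) (i : Fin n) :
    HasPrimitive (fun s => (P s).f i) (fun s => S.rhsf (P s).E (P s).f (S.u s) i) τ :=
  HasPrimitive.of_hasDerivWithinAt
    (continuousOn_pi.1 (continuousOn_rhsf h.continuousOn_E h.continuousOn_f S.continuousOn_u) i)
    (fun t ht => hasDerivWithinAt_pi.1 (h.f_deriv t ht) i) hτ

theorem continuousOn_rhsg (h : S.IsSolution P₀ τ P) :
    ContinuousOn (fun s => S.rhsg (P s).f (S.u s)) (Icc 0 τ) :=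
  LTISystem.continuousOn_rhsg h.continuousOn_f S.continuousOn_u

theorem hasPrimitive_g (h : S.IsSolution P₀ τ P) (hτ : 0 ≤ τ) :
    HasPrimitive (fun s => (P s).g) (fun s => S.rhsg (P s).f (S.u s)) τ :=
  ⟨ContinuousOn.intervalIntegrable (by rw [uIcc_of_le hτ]; exact h.continuousOn_rhsg),
    fun t ht => by simp only [h.g_eq t ht, h.init]⟩

theorem continuousOn_optw (h : S.IsSolution P₀ τ P) {x : ℝ → Fin n → ℝ}
    (hx : ContinuousOn x (Icc 0 τ)) :
    ContinuousOn (fun s => S.optw (P s).E (P s).f (S.u s) (x s)) (Icc 0 τ) :=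
  LTISystem.continuousOn_optw h.continuousOn_E h.continuousOn_f S.continuousOn_u hx

end IsSolution

namespace IsTrajectory

variable {τ : ℝ} {w : ℝ → Fin m → ℝ} {x : ℝ → Fin n → ℝ} {xq : ℝ → ℝ}

theorem memLp_w (h : S.IsTrajectory τ w x xq) (k : Fin m) :
    MemLp (fun s => w s k) 2 (volume.restrict (Icc 0 τ)) :=
  h.w_memLp.eval k

theorem intervalIntegrable_of_integrable {f : ℝ → ℝ} (hτ : 0 ≤ τ)
    (h : Integrable f (volume.restrict (Icc 0 τ))) : IntervalIntegrable f volume 0 τ := by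
  rw [intervalIntegrable_iff_integrableOn_Icc_of_le hτ]
  exact h

theorem intervalIntegrable_w (h : S.IsTrajectory τ w x xq) (hτ : 0 ≤ τ) (k : Fin m) :
    IntervalIntegrable (fun s => w s k) volume 0 τ :=
  intervalIntegrable_of_integrable hτ ((h.memLp_w k).integrable one_le_two)

theorem intervalIntegrable_continuousOn_dotProduct (h : S.IsTrajectory τ w x xq) (hτ : 0 ≤ τ)
    {b : ℝ → Fin m → ℝ} (hb : ContinuousOn b (Icc 0 τ)) :
    IntervalIntegrable (fun s => b s ⬝ᵥ w s) volume 0 τ := by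
  have : IntervalIntegrable (∑ k, fun s => b s k * w s k) volume 0 τ :=
    IntervalIntegrable.sum _ fun k _ => (h.intervalIntegrable_w hτ k).continuousOn_mul (by
      rw [uIcc_of_le hτ]; exact (continuous_apply k).comp_continuousOn hb)
  convert! this using 2 with s
  simp [dotProduct]

theorem intervalIntegrable_quadratic (h : S.IsTrajectory τ w x xq) (hτ : 0 ≤ τ)
    (N : Matrix (Fin m) (Fin m) ℝ) :
    IntervalIntegrable (fun s => w s ⬝ᵥ (N *ᵥ w s)) volume 0 τ := by
  have : IntervalIntegrable (∑ k, ∑ l, fun s => N k l * (w s k * w s l)) volume 0 τ :=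
    IntervalIntegrable.sum _ fun k _ => IntervalIntegrable.sum _ fun l _ =>
      (intervalIntegrable_of_integrable hτ ((h.memLp_w k).integrable_mul (h.memLp_w l))).const_mul _
  convert! this using 2 with s
  simp only [dotProduct, Matrix.mulVec, Finset.sum_apply, Finset.mul_sum]
  exact Finset.sum_congr rfl fun k _ => Finset.sum_congr rfl fun l _ => by ring

/-- The rate is a polynomial of degree two in `w` with coefficients continuous in time: its linear
part is integrable since `L²` is contained in `L¹` on bounded intervals, its quadratic part since
products of `L²` functions are integrable. -/
theorem intervalIntegrable_rate (h : S.IsTrajectory τ w x xq) (hτ : 0 ≤ τ) :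
    IntervalIntegrable (fun s => S.rate (x s) (S.u s) (w s)) volume 0 τ := by
  have h1 : ContinuousOn (fun s => S.rate (x s) (S.u s) 0) (uIcc 0 τ) := by
    rw [uIcc_of_le hτ]
    exact continuousOn_rate h.x_continuousOn S.continuousOn_u continuousOn_const
  have h2 : ContinuousOn (fun s => (2 : ℝ) • (S.Mxwᵀ *ᵥ x s + S.Muwᵀ *ᵥ S.u s)) (Icc 0 τ) := by
    have : Continuous fun z : (Fin n → ℝ) × (Fin p → ℝ) =>
      (2 : ℝ) • (S.Mxwᵀ *ᵥ z.1 + S.Muwᵀ *ᵥ z.2) := by fun_prop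
    exact this.comp_continuousOn (f := fun s => (x s, S.u s)) (h.x_continuousOn.prodMk S.continuousOn_u)
  convert! (h1.intervalIntegrable.add (h.intervalIntegrable_continuousOn_dotProduct hτ h2)).add
    (h.intervalIntegrable_quadratic hτ S.Mw) using 2 with s
  simp only [rate_eq, smul_dotProduct, add_dotProduct, ← dotProduct_mulVec_eq_transpose,
    Matrix.mulVec_zero, dotProduct_zero, smul_eq_mul]
  ring

theorem intervalIntegrable_drift_apply (h : S.IsTrajectory τ w x xq) (hτ : 0 ≤ τ) (i : Fin n) :
    IntervalIntegrable (fun s => S.drift (x s) (S.u s) (w s) i) volume 0 τ := by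
  have h1 : ContinuousOn (fun s => S.drift (x s) (S.u s) 0 i) (uIcc 0 τ) := by
    rw [uIcc_of_le hτ]
    exact continuousOn_pi.1
      (continuousOn_drift h.x_continuousOn S.continuousOn_u continuousOn_const) i
  convert! h1.intervalIntegrable.add (h.intervalIntegrable_continuousOn_dotProduct hτ
    (b := fun _ => S.B i) continuousOn_const) using 2 with s
  simp only [drift, Pi.add_apply, Matrix.mulVec_zero, Pi.zero_apply]
  have : (S.B *ᵥ w s) i = S.B i ⬝ᵥ w s := rfl
  rw [this]
  ring

theorem intervalIntegrable_drift (h : S.IsTrajectory τ w x xq) (hτ : 0 ≤ τ) :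
    IntervalIntegrable (fun s => S.drift (x s) (S.u s) (w s)) volume 0 τ := by
  rw [intervalIntegrable_iff]
  exact Integrable.of_eval fun i => intervalIntegrable_iff.1 (h.intervalIntegrable_drift_apply hτ i)

theorem hasPrimitive_x (h : S.IsTrajectory τ w x xq) (hτ : 0 ≤ τ) (i : Fin n) :
    HasPrimitive (fun s => x s i) (fun s => S.drift (x s) (S.u s) (w s) i) τ := by
  refine ⟨h.intervalIntegrable_drift_apply hτ i, fun t ht => ?_⟩
  have h1 := congrFun (h.x_eq t ht) i
  have h2 : IntervalIntegrable (fun s => S.drift (x s) (S.u s) (w s)) volume 0 t :=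
    (h.intervalIntegrable_drift hτ).mono_set (by
      rw [uIcc_of_le hτ, uIcc_of_le ht.1]; exact Icc_subset_Icc_right ht.2)
  have h3 := (ContinuousLinearMap.proj (R := ℝ) (φ := fun _ : Fin n => ℝ) i).intervalIntegral_comp_comm h2
  exact h1.trans (congrArg (x 0 i + ·) h3.symm)

theorem hasPrimitive_xq (h : S.IsTrajectory τ w x xq) (hτ : 0 ≤ τ) :
    HasPrimitive xq (fun s => S.rate (x s) (S.u s) (w s)) τ :=
  ⟨h.intervalIntegrable_rate hτ, h.xq_eq⟩

theorem mono (h : S.IsTrajectory τ w x xq) {σ : ℝ} (hσ : σ ≤ τ) : S.IsTrajectory σ w x xq :=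
  have hsub : Icc 0 σ ⊆ Icc 0 τ := Icc_subset_Icc_right hσ
  { w_memLp := h.w_memLp.mono_measure (Measure.restrict_mono hsub le_rfl)
    x_continuousOn := h.x_continuousOn.mono hsub
    x_eq := fun t ht => h.x_eq t (hsub ht)
    xq_eq := fun t ht => h.xq_eq t (hsub ht) }

/-- The value function decreases along trajectories at the rate given by the deviation from the
touching disturbance. -/
theorem hasPrimitive_value (h : S.IsTrajectory τ w x xq) (hτ : 0 ≤ τ) {P₀ : Paraboloid n}
    {P : ℝ → Paraboloid n} (hP : S.IsSolution P₀ τ P) :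
    HasPrimitive (fun s => (P s).value (x s, xq s))
      (fun s => S.wForm (w s - S.optw (P s).E (P s).f (S.u s) (x s))) τ := by
  have h1 := HasPrimitive.dotProduct hτ (h.hasPrimitive_x hτ)
    (HasPrimitive.mulVec hτ (fun i j => hP.hasPrimitive_E hτ i j) (h.hasPrimitive_x hτ))
  have h2 := HasPrimitive.dotProduct hτ (hP.hasPrimitive_f hτ) (h.hasPrimitive_x hτ)
  have h3 := ((h1.sub (h2.const_mul 2)).add (hP.hasPrimitive_g hτ)).add (h.hasPrimitive_xq hτ)
  refine HasPrimitive.congr_right h3 hτ fun t _ => ?_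
  have hs : S.drift (x t) (S.u t) (w t) ⬝ᵥ ((P t).E *ᵥ x t) =
      x t ⬝ᵥ ((P t).E *ᵥ S.drift (x t) (S.u t) (w t)) := by
    rw [dotProduct_mulVec_eq_transpose, (P t).E_symm, dotProduct_comm]
  simp only [dotProduct_add]
  rw [← S.value_deriv_eq (P t).E_symm, hs]
  ring

/-- The derivative is a value of the nonpositive form `wForm`. This is the invariance of each
paraboloid, on which both inclusions rest. -/
theorem value_antitoneOn (h : S.IsTrajectory τ w x xq) (hτ : 0 ≤ τ) {P₀ : Paraboloid n}
    {P : ℝ → Paraboloid n} (hP : S.IsSolution P₀ τ P) :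
    AntitoneOn (fun s => (P s).value (x s, xq s)) (Icc 0 τ) := by
  intro a ha b hb hab
  have h1 := (h.hasPrimitive_value hτ hP).sub_eq ha hb
  have h2 : ∫ s in a..b, S.wForm (w s - S.optw (P s).E (P s).f (S.u s) (x s)) ≤ 0 := by
    have h3 := intervalIntegral.integral_nonneg (μ := volume) hab
      (f := fun s => -S.wForm (w s - S.optw (P s).E (P s).f (S.u s) (x s)))
      fun s _ => neg_nonneg.2 (S.wForm_nonpos _)
    rw [intervalIntegral.integral_neg] at h3
    linarith
  simp only
  linarith

end IsTrajectory

/-- Classical solutions give trajectories. -/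
theorem exists_isTrajectory {T : ℝ} (t₁ q₁ : ℝ) {w : ℝ → Fin m → ℝ}
    {x : ℝ → Fin n → ℝ} (hw : ContinuousOn w (Icc 0 T))
    (hx : ∀ t ∈ Icc 0 T, HasDerivWithinAt x (S.drift (x t) (S.u t) (w t)) (Icc 0 T) t) :
    ∃ xq, S.IsTrajectory T w x xq ∧ xq t₁ = q₁ := by
  have hxc : ContinuousOn x (Icc 0 T) := fun t ht => (hx t ht).continuousWithinAt
  obtain ⟨C, hC⟩ := isCompact_Icc.exists_bound_of_continuousOn hw
  refine ⟨fun t => q₁ - (∫ s in (0 : ℝ)..t₁, S.rate (x s) (S.u s) (w s)) +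
    ∫ s in (0 : ℝ)..t, S.rate (x s) (S.u s) (w s), ⟨?_, hxc, fun t ht => ?_, fun t ht => ?_⟩, ?_⟩
  · refine MemLp.of_bound (hw.aestronglyMeasurable measurableSet_Icc) C ?_
    exact (ae_restrict_mem measurableSet_Icc).mono fun s hs => hC s hs
  · exact eq_add_integral_of_hasDerivWithinAt (y' := fun t => S.drift (x t) (S.u t) (w t))
      (continuousOn_drift hxc S.continuousOn_u hw) hx ht
  · simp
  · simp

/-- Trajectories can be concatenated. -/
theorem IsTrajectory.concat {a b : ℝ} (hab : a ∈ Icc 0 b) {w₁ w₂ : ℝ → Fin m → ℝ}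
    {x₁ x₂ : ℝ → Fin n → ℝ} {q₁ q₂ : ℝ → ℝ} (h₁ : S.IsTrajectory a w₁ x₁ q₁)
    (h₂ : S.IsTrajectory b w₂ x₂ q₂) (hx : x₁ a = x₂ a) (hq : q₁ a = q₂ a) :
    S.IsTrajectory b (fun s => if s ≤ a then w₁ s else w₂ s)
      (fun s => if s ≤ a then x₁ s else x₂ s) (fun s => if s ≤ a then q₁ s else q₂ s) := by
  have hb : 0 ≤ b := hab.1.trans hab.2
  have h0 : (0 : ℝ) ≤ a := hab.1
  -- The gluing of integral equations at time `a`, stated for values in a normed space so that it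
  -- serves both `x` and `x_q`.
  have split : ∀ {Z : Type} [NormedAddCommGroup Z] [NormedSpace ℝ Z] (F₁ F₂ : ℝ → Z) (y₁ y₂ : ℝ → Z)
      (F : ℝ → Z), IntervalIntegrable F₁ volume 0 a → IntervalIntegrable F₂ volume 0 b →
      (∀ t ∈ Icc 0 a, y₁ t = y₁ 0 + ∫ s in (0 : ℝ)..t, F₁ s) →
      (∀ t ∈ Icc 0 b, y₂ t = y₂ 0 + ∫ s in (0 : ℝ)..t, F₂ s) → y₁ a = y₂ a →
      (∀ s, s ≤ a → F s = F₁ s) → (∀ s, a < s → F s = F₂ s) → ∀ t ∈ Icc 0 b,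
      (if t ≤ a then y₁ t else y₂ t) = y₁ 0 + ∫ s in (0 : ℝ)..t, F s := by
    intro Z _ _ F₁ F₂ y₁ y₂ F i₁ i₂ e₁ e₂ hy f₁ f₂ t ht
    have hleft : ∀ t ∈ Icc 0 a, ∫ s in (0 : ℝ)..t, F s = ∫ s in (0 : ℝ)..t, F₁ s := fun t ht =>
      intervalIntegral.integral_congr fun s hs => by
        rw [uIcc_of_le ht.1] at hs
        exact f₁ s (hs.2.trans ht.2)
    by_cases hta : t ≤ a
    · rw [if_pos hta, e₁ t ⟨ht.1, hta⟩, hleft t ⟨ht.1, hta⟩]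
    · push Not at hta
      rw [if_neg (not_le.2 hta)]
      have hi : ∀ c d, c ∈ Icc 0 b → d ∈ Icc 0 b → IntervalIntegrable F₂ volume c d :=
        fun c d hc hd => i₂.mono_set (by rw [uIcc_of_le hb]; exact uIcc_subset_Icc hc hd)
      have iF₁ : IntervalIntegrable F volume 0 a := i₁.congr fun s hs => by
        rw [uIoc_of_le h0] at hs
        exact (f₁ s hs.2).symm
      have iF₂ : IntervalIntegrable F volume a t := (hi a t hab ht).congr fun s hs => by
        rw [uIoc_of_le hta.le] at hs
        exact (f₂ s hs.1).symm
      have hright : ∫ s in a..t, F s = ∫ s in a..t, F₂ s := by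
        refine intervalIntegral.integral_congr_ae (Eventually.of_forall fun s hs => ?_)
        rw [uIoc_of_le hta.le] at hs
        exact f₂ s hs.1
      rw [← intervalIntegral.integral_add_adjacent_intervals iF₁ iF₂, hleft a ⟨h0, le_rfl⟩,
        hright, ← add_assoc, ← e₁ a ⟨h0, le_rfl⟩, hy, e₂ a hab, e₂ t ht, add_assoc,
        intervalIntegral.integral_add_adjacent_intervals (hi 0 a ⟨le_rfl, hb⟩ hab) (hi a t hab ht)]
  refine ⟨?_, ?_, ?_, ?_⟩
  · have hpw : (fun s => if s ≤ a then w₁ s else w₂ s) = (Iic a).piecewise w₁ w₂ := by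
      funext s; simp [Set.piecewise]
    rw [hpw]
    refine MemLp.piecewise measurableSet_Iic ?_ ?_
    · refine h₁.w_memLp.mono_measure ?_
      rw [Measure.restrict_restrict measurableSet_Iic]
      exact Measure.restrict_mono (fun s (hs : s ∈ Iic a ∩ Icc 0 b) => (⟨hs.2.1, hs.1⟩ : s ∈ Icc 0 a)) le_rfl
    · exact h₂.w_memLp.mono_measure Measure.restrict_le_self
  · refine ContinuousOn.if (p := fun s => s ≤ a) ?_ ?_ ?_
    · intro s hs
      have h3 : s ∈ frontier (Iic a) := hs.2
      rw [frontier_Iic] at h3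
      rw [mem_singleton_iff.1 h3, hx]
    · refine h₁.x_continuousOn.mono fun s hs => ?_
      have h3 : s ∈ closure (Iic a) := hs.2
      rw [closure_Iic] at h3
      exact ⟨hs.1.1, h3⟩
    · exact h₂.x_continuousOn.mono inter_subset_left
  · have := split (fun s => S.drift (x₁ s) (S.u s) (w₁ s)) (fun s => S.drift (x₂ s) (S.u s) (w₂ s))
      x₁ x₂ (fun s => S.drift (if s ≤ a then x₁ s else x₂ s) (S.u s) (if s ≤ a then w₁ s else w₂ s))
      (h₁.intervalIntegrable_drift h0) (h₂.intervalIntegrable_drift hb) h₁.x_eq h₂.x_eq hx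
      (fun s hs => by simp [hs]) (fun s hs => by simp [not_le.2 hs])
    intro t ht
    simp only [if_pos h0]
    exact this t ht
  · have := split (fun s => S.rate (x₁ s) (S.u s) (w₁ s)) (fun s => S.rate (x₂ s) (S.u s) (w₂ s))
      q₁ q₂ (fun s => S.rate (if s ≤ a then x₁ s else x₂ s) (S.u s) (if s ≤ a then w₁ s else w₂ s))
      (h₁.intervalIntegrable_rate h0) (h₂.intervalIntegrable_rate hb) h₁.xq_eq h₂.xq_eq hq
      (fun s hs => by simp [hs]) (fun s hs => by simp [not_le.2 hs])
    intro t ht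
    simp only [if_pos h0]
    exact this t ht

/-- Touching trajectories exist, globally in time, through every state. -/
theorem IsSolution.exists_closedLoop {P₀ : Paraboloid n} {T : ℝ} {P : ℝ → Paraboloid n}
    (hP : S.IsSolution P₀ T P) {t₁ : ℝ} (ht₁ : t₁ ∈ Icc 0 T) (X : State n) :
    ∃ x xq, S.IsTrajectory T (fun s => S.optw (P s).E (P s).f (S.u s) (x s)) x xq ∧
      (x t₁, xq t₁) = X := by
  -- Inserting `optw` for `w` turns the state equation into an affine one with continuous
  -- coefficients, which has no blow-up.
  have hN : ContinuousOn (fun s => S.A - S.B * (S.Mw⁻¹ * (S.Bᵀ * (P s).E + S.Mxwᵀ))) (Icc 0 T) := by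
    have : Continuous fun E : Matrix (Fin n) (Fin n) ℝ =>
      S.A - S.B * (S.Mw⁻¹ * (S.Bᵀ * E + S.Mxwᵀ)) := by fun_prop
    exact this.comp_continuousOn hP.continuousOn_E
  have hk : ContinuousOn (fun s => S.Bu *ᵥ S.u s -
      S.B *ᵥ (S.Mw⁻¹ *ᵥ (S.Muwᵀ *ᵥ S.u s - S.Bᵀ *ᵥ (P s).f))) (Icc 0 T) := by
    have : Continuous fun z : (Fin n → ℝ) × (Fin p → ℝ) => S.Bu *ᵥ z.2 -
      S.B *ᵥ (S.Mw⁻¹ *ᵥ (S.Muwᵀ *ᵥ z.2 - S.Bᵀ *ᵥ z.1)) := by fun_prop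
    exact this.comp_continuousOn (hP.continuousOn_f.prodMk S.continuousOn_u)
  obtain ⟨x, hx1, hx⟩ := exists_affine_solution ht₁ hN hk X.1
  have hx' : ∀ t ∈ Icc 0 T, HasDerivWithinAt x
      (S.drift (x t) (S.u t) (S.optw (P t).E (P t).f (S.u t) (x t))) (Icc 0 T) t := fun t ht => by
    convert! hx t ht using 1
    simp only [drift, optw, Matrix.mulVec_neg, Matrix.mulVec_add, Matrix.sub_mulVec,
      ← Matrix.mulVec_mulVec]
    abel
  obtain ⟨xq, hxq, hq⟩ := exists_isTrajectory t₁ X.2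
    (hP.continuousOn_optw fun t ht => (hx t ht).continuousWithinAt) hx'
  exact ⟨x, xq, hxq, Prod.ext hx1 hq⟩

/-- The value function is constant along trajectories driven by the touching disturbance. -/
theorem IsTrajectory.value_eq_of_optw {P₀ : Paraboloid n} {T : ℝ} {P : ℝ → Paraboloid n}
    (hP : S.IsSolution P₀ T P) {x : ℝ → Fin n → ℝ} {xq : ℝ → ℝ}
    (h : S.IsTrajectory T (fun s => S.optw (P s).E (P s).f (S.u s) (x s)) x xq) {a b : ℝ}
    (ha : a ∈ Icc 0 T) (hb : b ∈ Icc 0 T) :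
    (P a).value (x a, xq a) = (P b).value (x b, xq b) := by
  have h1 := (h.hasPrimitive_value (ha.1.trans ha.2) hP).sub_eq ha hb
  simp only [sub_self, wForm_zero, intervalIntegral.integral_zero] at h1
  linarith

end LTISystem

/-! ### The parameter equations -/

/-- The space of parameters `(E, f, g)` with the supremum norm. -/
abbrev ParamSpace (n : ℕ) : Type := (Fin n → Fin n → ℝ) × (Fin n → ℝ) × ℝ

/-- The parameters of a paraboloid as a point of a normed space. -/
def Paraboloid.params {n : ℕ} (P : Paraboloid n) : ParamSpace n := (fun i j => P.E i j, P.f, P.g)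

theorem Paraboloid.params_injective {n : ℕ} : Function.Injective (Paraboloid.params (n := n)) := by
  intro P Q h
  simp only [Paraboloid.params, Prod.mk.injEq] at h
  exact Paraboloid.ext (Matrix.ext fun i j => congrFun (congrFun h.1 i) j) h.2.1 h.2.2

theorem norm_le_of_entry_le {n : ℕ} {E : Fin n → Fin n → ℝ} {K : ℝ} (hK : 0 ≤ K)
    (h : ∀ i j, |E i j| ≤ K) : ‖E‖ ≤ K :=
  (pi_norm_le_iff_of_nonneg hK).2 fun i => (pi_norm_le_iff_of_nonneg hK).2 fun j => h i j

theorem entry_le_norm {n : ℕ} (E : Fin n → Fin n → ℝ) (i j : Fin n) : |E i j| ≤ ‖E‖ :=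
  (norm_le_pi_norm (E i) j).trans (norm_le_pi_norm E i)

namespace LTISystem

variable {n p m : ℕ} (S : LTISystem n p m)

/-- The right-hand side of the parameter equations. -/
noncomputable def field (v : Fin p → ℝ) (y : ParamSpace n) : ParamSpace n :=
  (fun i j => S.rhsE (Matrix.of y.1) i j, S.rhsf (Matrix.of y.1) y.2.1 v, S.rhsg y.2.1 v)

theorem contDiff_field : ContDiff ℝ 1 fun z : (Fin p → ℝ) × (Fin n → Fin n → ℝ) × (Fin n → ℝ) =>
    S.field z.1 (z.2.1, z.2.2, 0) := by
  refine ContDiff.prodMk ?_ (ContDiff.prodMk ?_ ?_)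
  · refine contDiff_pi.2 fun i => contDiff_pi.2 fun j => ?_
    simp only [rhsE, Matrix.add_apply, Matrix.sub_apply, Matrix.neg_apply, Matrix.mul_apply,
      Matrix.transpose_apply, Matrix.of_apply]
    fun_prop
  · refine contDiff_pi.2 fun i => ?_
    simp only [rhsf, Pi.add_apply, Pi.neg_apply, Pi.sub_apply, Matrix.mulVec, dotProduct,
      Matrix.add_apply, Matrix.mul_apply, Matrix.transpose_apply, Matrix.of_apply]
    fun_prop
  · simp only [rhsg, Matrix.mulVec, dotProduct]
    fun_prop

/-- The field does not involve `g`, so bounds on `E`, `f` and the input suffice and `g` is left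
free. -/
theorem exists_field_lipschitz (V C : ℝ) : ∃ K : ℝ≥0, ∀ v, ‖v‖ ≤ V →
    LipschitzOnWith K (S.field v) {y | ‖y.1‖ ≤ C ∧ ‖y.2.1‖ ≤ C} := by
  obtain ⟨K, hK⟩ := exists_lipschitzOnWith_of_contDiff S.contDiff_field
    ((isCompact_closedBall (0 : Fin p → ℝ) V).prod
      ((isCompact_closedBall (0 : Fin n → Fin n → ℝ) C).prod
        (isCompact_closedBall (0 : Fin n → ℝ) C)))
  refine ⟨K, fun v hv => LipschitzOnWith.of_dist_le_mul fun y hy z hz => ?_⟩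
  have h := hK.dist_le_mul (v, y.1, y.2.1) ⟨by simpa using hv, by simpa using hy.1, by simpa using hy.2⟩
    (v, z.1, z.2.1) ⟨by simpa using hv, by simpa using hz.1, by simpa using hz.2⟩
  refine h.trans (mul_le_mul_of_nonneg_left ?_ K.2)
  simp only [Prod.dist_eq, dist_self]
  refine max_le (le_max_of_le_left dist_nonneg) (max_le (le_max_left _ _) ?_)
  exact (le_max_left _ _).trans (le_max_right _ _)

theorem exists_u_bound (T : ℝ) : ∃ V : ℝ, ∀ t ∈ Icc 0 T, ‖S.u t‖ ≤ V :=
  isCompact_Icc.exists_bound_of_continuousOn S.continuousOn_u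

variable {S}

theorem IsSolution.hasDerivWithinAt_params {P₀ : Paraboloid n} {τ : ℝ} {P : ℝ → Paraboloid n}
    (h : S.IsSolution P₀ τ P) {t : ℝ} (ht : t ∈ Icc 0 τ) :
    HasDerivWithinAt (fun s => (P s).params) (S.field (S.u t) (P t).params) (Icc 0 τ) t := by
  have hτ : 0 ≤ τ := ht.1.trans ht.2
  refine HasDerivWithinAt.prodMk ?_ (HasDerivWithinAt.prodMk (h.f_deriv t ht) ?_)
  · exact hasDerivWithinAt_pi.2 fun i => hasDerivWithinAt_pi.2 fun j => h.E_deriv t ht i j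
  · exact (h.hasPrimitive_g hτ).hasDerivWithinAt h.continuousOn_rhsg ht

theorem IsSolution.continuousOn_params {P₀ : Paraboloid n} {τ : ℝ} {P : ℝ → Paraboloid n}
    (h : S.IsSolution P₀ τ P) : ContinuousOn (fun s => (P s).params) (Icc 0 τ) :=
  fun _ ht => (h.hasDerivWithinAt_params ht).continuousWithinAt

/-- Continuous dependence on the initial values. -/
theorem exists_dist_params_le (S : LTISystem n p m) (T C : ℝ) : ∃ L : ℝ, 0 ≤ L ∧
    ∀ τ ∈ Icc 0 T, ∀ P₀ Q₀ P Q, S.IsSolution P₀ τ P → S.IsSolution Q₀ τ Q →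
    (∀ t ∈ Icc 0 τ, ‖(P t).params.1‖ ≤ C ∧ ‖(P t).f‖ ≤ C) →
    (∀ t ∈ Icc 0 τ, ‖(Q t).params.1‖ ≤ C ∧ ‖(Q t).f‖ ≤ C) →
    ∀ t ∈ Icc 0 τ, dist (P t).params (Q t).params ≤ L * dist P₀.params Q₀.params := by
  obtain ⟨V, hV⟩ := S.exists_u_bound T
  obtain ⟨K, hK⟩ := S.exists_field_lipschitz V C
  refine ⟨Real.exp (K * T), (Real.exp_pos _).le, fun τ hτ P₀ Q₀ P Q hP hQ hPC hQC t ht => ?_⟩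
  have h := dist_le_of_trajectories_ODE_of_mem (v := fun t => S.field (S.u t)) (K := K)
    (s := fun _ => {y | ‖y.1‖ ≤ C ∧ ‖y.2.1‖ ≤ C}) (a := 0) (b := τ)
    (f := fun s => (P s).params) (g := fun s => (Q s).params) (δ := dist P₀.params Q₀.params)
    (fun t ht => hK _ (hV t ⟨ht.1, ht.2.le.trans hτ.2⟩))
    hP.continuousOn_params
    (fun t ht => hasDerivWithinAt_Ici_of_Icc
      (hP.hasDerivWithinAt_params (Ico_subset_Icc_self ht)) ht)
    (fun t ht => hPC t (Ico_subset_Icc_self ht))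
    hQ.continuousOn_params
    (fun t ht => hasDerivWithinAt_Ici_of_Icc
      (hQ.hasDerivWithinAt_params (Ico_subset_Icc_self ht)) ht)
    (fun t ht => hQC t (Ico_subset_Icc_self ht))
    (by simp only [hP.init, hQ.init]; exact le_rfl) t ht
  refine h.trans ?_
  rw [mul_comm]
  gcongr
  linarith [ht.2, hτ.2]

theorem IsSolution.exists_bound {P₀ : Paraboloid n} {τ : ℝ} {P : ℝ → Paraboloid n}
    (h : S.IsSolution P₀ τ P) : ∃ C, ∀ t ∈ Icc 0 τ, ‖(P t).params.1‖ ≤ C ∧ ‖(P t).f‖ ≤ C := by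
  obtain ⟨C, hC⟩ := isCompact_Icc.exists_bound_of_continuousOn h.continuousOn_params
  exact ⟨C, fun t ht => ⟨(norm_fst_le _).trans (hC t ht),
    ((norm_fst_le _).trans (norm_snd_le _)).trans (hC t ht)⟩⟩

theorem IsSolution.unique {P₀ : Paraboloid n} {τ : ℝ} {P Q : ℝ → Paraboloid n}
    (hP : S.IsSolution P₀ τ P) (hQ : S.IsSolution P₀ τ Q) {t : ℝ} (ht : t ∈ Icc 0 τ) :
    P t = Q t := by
  obtain ⟨C, hC⟩ := hP.exists_bound
  obtain ⟨D, hD⟩ := hQ.exists_bound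
  obtain ⟨L, -, hL⟩ := S.exists_dist_params_le τ (max C D)
  have h := hL τ ⟨ht.1.trans ht.2, le_rfl⟩ P₀ P₀ P Q hP hQ
    (fun t ht => ⟨(hC t ht).1.trans (le_max_left _ _), (hC t ht).2.trans (le_max_left _ _)⟩)
    (fun t ht => ⟨(hD t ht).1.trans (le_max_right _ _), (hD t ht).2.trans (le_max_right _ _)⟩) t ht
  rw [dist_self, mul_zero] at h
  exact Paraboloid.params_injective (dist_le_zero.1 h)

/-! ### Existence for the parameter equations by truncating the Riccati equation -/

variable (S)

/-- The Riccati right-hand side, rewritten so that its values are symmetric, and frozen outside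
the cube of matrices with entries in `[-C, C]`. -/
noncomputable def truncE (C : ℝ) (E : Fin n → Fin n → ℝ) : Fin n → Fin n → ℝ := fun i j =>
  (-((Matrix.of fun i => clamp C (E i))ᵀ * S.A) - S.Aᵀ * (Matrix.of fun i => clamp C (E i)) - S.Mx
    + (S.Bᵀ * (Matrix.of fun i => clamp C (E i)) + S.Mxwᵀ)ᵀ * S.Mw⁻¹ *
      (S.Bᵀ * (Matrix.of fun i => clamp C (E i)) + S.Mxwᵀ)) i j

/-- The transpose in the first term makes the first two terms transposes of each other for an
arbitrary matrix. Symmetry of solutions then follows by integration, without being assumed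
beforehand. -/
theorem truncE_symm (C : ℝ) (E : Fin n → Fin n → ℝ) (i j : Fin n) :
    S.truncE C E i j = S.truncE C E j i := by
  unfold truncE
  set D : Matrix (Fin n) (Fin n) ℝ := Matrix.of fun i => clamp C (E i)
  rw [← Matrix.transpose_apply
    (-(Dᵀ * S.A) - S.Aᵀ * D - S.Mx + (S.Bᵀ * D + S.Mxwᵀ)ᵀ * S.Mw⁻¹ * (S.Bᵀ * D + S.Mxwᵀ)) i j]
  simp only [Matrix.transpose_add, Matrix.transpose_sub, Matrix.transpose_neg,
    Matrix.transpose_mul, Matrix.transpose_transpose, Mx_symm, Mw_inv_symm, Matrix.mul_assoc]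
  abel_nf

theorem truncE_eq {C : ℝ} {E : Matrix (Fin n) (Fin n) ℝ} (hE : E.IsSymm)
    (h : ∀ i j, |E i j| ≤ C) (i j : Fin n) : S.truncE C (fun i j => E i j) i j = S.rhsE E i j := by
  have h1 : (Matrix.of fun i => clamp C (fun j => E i j)) = E := by
    ext i j
    exact clamp_apply_eq (h i j)
  unfold truncE rhsE
  simp only [h1]
  rw [show Eᵀ = E from hE]

theorem exists_truncE_lipschitz {C : ℝ} (hC : 0 ≤ C) :
    ∃ K : ℝ≥0, LipschitzWith K (S.truncE C) := by
  have hG : ContDiff ℝ 1 fun (D : Fin n → Fin n → ℝ) (i j : Fin n) =>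
      (-((Matrix.of D)ᵀ * S.A) - S.Aᵀ * (Matrix.of D) - S.Mx
        + (S.Bᵀ * (Matrix.of D) + S.Mxwᵀ)ᵀ * S.Mw⁻¹ * (S.Bᵀ * (Matrix.of D) + S.Mxwᵀ)) i j := by
    refine contDiff_pi.2 fun i => contDiff_pi.2 fun j => ?_
    simp only [Matrix.add_apply, Matrix.sub_apply, Matrix.neg_apply, Matrix.mul_apply,
      Matrix.transpose_apply, Matrix.of_apply]
    fun_prop
  obtain ⟨K, hK⟩ := exists_lipschitzOnWith_of_contDiff hG
    (isCompact_closedBall (0 : Fin n → Fin n → ℝ) C)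
  have hmem : ∀ E : Fin n → Fin n → ℝ, (fun i => clamp C (E i)) ∈ Metric.closedBall 0 C :=
    fun E => by
      rw [mem_closedBall_zero_iff]
      exact norm_le_of_entry_le hC fun i j => abs_clamp_apply_le hC (E i) j
  refine ⟨K, LipschitzWith.of_dist_le_mul fun E D => ?_⟩
  refine (hK.dist_le_mul _ (hmem E) _ (hmem D)).trans (mul_le_mul_of_nonneg_left ?_ K.2)
  rw [dist_eq_norm]
  refine norm_le_of_entry_le dist_nonneg fun i j => ?_
  refine (abs_clamp_apply_sub_le C (E i) (D i) j).trans ?_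
  rw [dist_eq_norm]
  exact entry_le_norm (E - D) i j

/-- The truncated right-hand side is bounded and globally Lipschitz, so nothing prevents existence
on all of `[0, T]`; the true Riccati equation could blow up. -/
theorem exists_truncE_solution {C : ℝ} (hC : 0 ≤ C) {T : ℝ} (hT : 0 ≤ T)
    {E₀ : Matrix (Fin n) (Fin n) ℝ} (hE₀ : E₀.IsSymm) :
    ∃ E : ℝ → Matrix (Fin n) (Fin n) ℝ, E 0 = E₀ ∧ (∀ t, (E t).IsSymm) ∧
      ∀ t ∈ Icc 0 T, HasDerivWithinAt (fun s i j => E s i j) (S.truncE C fun i j => E t i j)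
        (Icc 0 T) t := by
  obtain ⟨K, hK⟩ := S.exists_truncE_lipschitz hC
  obtain ⟨M, hM⟩ : ∃ M : ℝ, ∀ E, ‖S.truncE C E‖ ≤ M := by
    refine ⟨K * C + ‖S.truncE C 0‖, fun E => ?_⟩
    -- Clamping is idempotent, so only arguments in the cube matter, and there the Lipschitz
    -- estimate gives a bound.
    have h1 : S.truncE C E = S.truncE C fun i => clamp C (E i) := by
      have : ∀ i, clamp C (clamp C (E i)) = clamp C (E i) := fun i => funext fun j =>
        clamp_apply_eq (abs_clamp_apply_le hC (E i) j)
      unfold truncE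
      simp only [this]
    have h2 := hK.norm_sub_le (fun i => clamp C (E i)) 0
    rw [sub_zero] at h2
    have h3 : ‖fun i => clamp C (E i)‖ ≤ C :=
      norm_le_of_entry_le hC fun i j => abs_clamp_apply_le hC (E i) j
    rw [h1]
    calc _ = ‖(S.truncE C (fun i => clamp C (E i)) - S.truncE C 0) + S.truncE C 0‖ := by
          rw [sub_add_cancel]
      _ ≤ _ := norm_add_le _ _
      _ ≤ _ := by gcongr; exact h2.trans (by gcongr)
  obtain ⟨E, hE0, hE⟩ := exists_solution_of_bounded (F := fun _ => S.truncE C) hT (fun _ _ => hK)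
    (fun _ => continuousOn_const) (fun _ _ => hM) (fun i j => E₀ i j)
  have hc : ContinuousOn (fun t => S.truncE C (E t)) (Icc 0 T) :=
    hK.continuous.comp_continuousOn fun t ht => (hE t ht).continuousWithinAt
  have hsymm : ∀ t ∈ Icc 0 T, ∀ i j, E t i j = E t j i := by
    intro t ht i j
    have key : ∀ i j, E t i j = E₀ i j + ∫ s in (0 : ℝ)..t, S.truncE C (E s) i j := fun i j => by
      have := (HasPrimitive.of_hasDerivWithinAt (F := fun t => E t i j)
        (continuousOn_pi.1 (continuousOn_pi.1 hc i) j)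
        (fun t ht => hasDerivWithinAt_pi.1 (hasDerivWithinAt_pi.1 (hE t ht) i) j) hT).2 t ht
      simp only [hE0] at this
      exact this
    rw [key, key j i, hE₀.apply]
    congr 1
    exact intervalIntegral.integral_congr fun s _ => S.truncE_symm C _ i j
  classical
  have hval : ∀ t ∈ Icc 0 T, (fun i j => (if t ∈ Icc 0 T then Matrix.of (E t) else E₀) i j) = E t :=
    fun t ht => by rw [if_pos ht]; rfl
  -- A `Paraboloid` needs a symmetric matrix at every real time, so outside `[0, T]`, where the
  -- solution is arbitrary, the value is replaced by `E₀`.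
  refine ⟨fun t => if t ∈ Icc 0 T then Matrix.of (E t) else E₀, ?_, fun t => ?_, fun t ht => ?_⟩
  · simp only [if_pos (show (0 : ℝ) ∈ Icc 0 T from ⟨le_rfl, hT⟩), hE0]
    rfl
  · by_cases ht : t ∈ Icc 0 T
    · simp only [if_pos ht]
      ext i j
      exact hsymm t ht j i
    · simp only [if_neg ht]
      exact hE₀
  · rw [hval t ht]
    exact (hE t ht).congr hval (hval t ht)

/-- A solution of the Riccati equation extends to a solution of the parameter equations. -/
theorem exists_isSolution_of_riccati {P₀ : Paraboloid n} {τ : ℝ} (hτ : 0 ≤ τ)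
    {E : ℝ → Matrix (Fin n) (Fin n) ℝ} (hE0 : E 0 = P₀.E) (hs : ∀ t, (E t).IsSymm)
    (hE : ∀ t ∈ Icc 0 τ, ∀ i j,
      HasDerivWithinAt (fun s => E s i j) (S.rhsE (E t) i j) (Icc 0 τ) t) :
    ∃ P, S.IsSolution P₀ τ P ∧ ∀ t, (P t).E = E t := by
  have hEc : ContinuousOn E (Icc 0 τ) :=
    continuousOn_pi.2 fun i => continuousOn_pi.2 fun j => fun t ht =>
      (hE t ht i j).continuousWithinAt
  -- Once `E` is known, the equation for `f` is affine, and `g` is a plain integral.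
  have hN : ContinuousOn (fun t => -S.Aᵀ + (E t * S.B + S.Mxw) * S.Mw⁻¹ * S.Bᵀ) (Icc 0 τ) := by
    have : Continuous fun E : Matrix (Fin n) (Fin n) ℝ =>
      -S.Aᵀ + (E * S.B + S.Mxw) * S.Mw⁻¹ * S.Bᵀ := by fun_prop
    exact this.comp_continuousOn hEc
  have hk : ContinuousOn (fun t => S.rhsf (E t) 0 (S.u t)) (Icc 0 τ) :=
    continuousOn_rhsf hEc continuousOn_const S.continuousOn_u
  obtain ⟨f, hf0, hf⟩ := exists_affine_solution (t₁ := 0) ⟨le_rfl, hτ⟩ hN hk P₀.f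
  refine ⟨fun t => ⟨E t, f t, P₀.g + ∫ s in (0 : ℝ)..t, S.rhsg (f s) (S.u s), hs t⟩,
    ⟨?_, hE, fun t ht => ?_, fun t _ => rfl⟩, fun _ => rfl⟩
  · ext1
    · exact hE0
    · exact hf0
    · simp
  · convert! hf t ht using 1
    simp only [rhsf, Matrix.mulVec_zero, Matrix.mulVec_sub, Matrix.add_mulVec, Matrix.neg_mulVec,
      Matrix.mulVec_neg, zero_sub, neg_zero, ← Matrix.mulVec_mulVec]
    abel

/-- While the entries stay in the cube the truncation is inactive, and the symmetric solution
satisfies the Riccati equation itself. -/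
theorem exists_isSolution_of_truncE {P₀ : Paraboloid n} {C T τ : ℝ} (hτ : τ ∈ Icc 0 T)
    {E : ℝ → Matrix (Fin n) (Fin n) ℝ} (hE0 : E 0 = P₀.E) (hs : ∀ t, (E t).IsSymm)
    (hE : ∀ t ∈ Icc 0 T, HasDerivWithinAt (fun s i j => E s i j) (S.truncE C fun i j => E t i j)
        (Icc 0 T) t)
    (hC : ∀ t ∈ Icc 0 τ, ∀ i j, |E t i j| ≤ C) :
    ∃ P, S.IsSolution P₀ τ P ∧ ∀ t, (P t).E = E t := by
  have hsub : Icc 0 τ ⊆ Icc 0 T := Icc_subset_Icc_right hτ.2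
  refine S.exists_isSolution_of_riccati hτ.1 hE0 hs fun t ht i j => ?_
  rw [← S.truncE_eq (hs t) (hC t ht)]
  exact (hasDerivWithinAt_pi.1 (hasDerivWithinAt_pi.1 (hE t (hsub ht)) i) j).mono hsub

/-- Local existence. -/
theorem exists_isSolution_local (P₀ : Paraboloid n) : ∃ τ, 0 < τ ∧ ∃ P, S.IsSolution P₀ τ P := by
  -- The surplus `1` puts the initial matrix strictly inside the cube, so that continuity keeps the
  -- solution there for a short time.
  set C : ℝ := ‖P₀.params.1‖ + 1 with hC
  have hC0 : 0 ≤ C := by positivity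
  obtain ⟨E, hE0, hs, hE⟩ := S.exists_truncE_solution hC0 zero_le_one P₀.E_symm
  have h0 : (0 : ℝ) ∈ Icc (0 : ℝ) 1 := ⟨le_rfl, zero_le_one⟩
  have hcont := (hE 0 h0).continuousWithinAt.norm
  have h1 : ‖fun i j => E 0 i j‖ < C := by
    rw [hE0, hC]
    exact lt_add_one ‖P₀.params.1‖
  have h2 : ∀ᶠ t in 𝓝[Icc 0 1] (0 : ℝ), ‖fun i j => E t i j‖ < C := hcont.eventually_lt_const h1
  rw [nhdsWithin_Icc_eq_nhdsGE zero_lt_one] at h2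
  obtain ⟨δ, hδ, hδ'⟩ := mem_nhdsGE_iff_exists_Icc_subset.1 h2
  have hδ0 : (0 : ℝ) < δ := hδ
  refine ⟨min δ 1, by positivity, ?_⟩
  obtain ⟨P, hP, -⟩ := S.exists_isSolution_of_truncE (P₀ := P₀) (τ := min δ 1)
    ⟨by positivity, min_le_right _ _⟩ hE0 hs hE fun t ht i j =>
      (entry_le_norm (fun i j => E t i j) i j).trans
        (hδ' ⟨ht.1, ht.2.trans (min_le_left _ _)⟩ : _ < C).le
  exact ⟨P, hP⟩

/-- An a priori bound of the Riccati solution implies existence on the whole interval. -/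
theorem exists_isSolution_of_bound {P₀ : Paraboloid n} {T K : ℝ} (hT : 0 ≤ T) (hK : 0 ≤ K)
    (h : ∀ t ∈ Icc 0 T, ∀ P, S.IsSolution P₀ t P → ∀ i j, |(P t).E i j| ≤ K) :
    ∃ P, S.IsSolution P₀ T P := by
  obtain ⟨E, hE0, hs, hE⟩ := S.exists_truncE_solution (C := K + 1) (by positivity) hT P₀.E_symm
  have hc : ContinuousOn (fun t => ‖fun i j => E t i j‖) (Icc 0 T) :=
    ContinuousOn.norm fun t ht => (hE t ht).continuousWithinAt
  have hlt : ∀ t ∈ Icc 0 T, ‖fun i j => E t i j‖ < K + 1 := by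
    by_contra! hcon
    obtain ⟨t₁, ht₁, hle⟩ := hcon
    have hcomp : IsCompact (Icc 0 T ∩ (fun t => ‖fun i j => E t i j‖) ⁻¹' Ici (K + 1)) :=
      isCompact_Icc.of_isClosed_subset (hc.preimage_isClosed_of_isClosed isClosed_Icc isClosed_Ici)
        inter_subset_left
    -- At the first time `t` with norm at least `K + 1` the truncation has not yet acted on `[0,
    -- t]`, so there is a genuine solution up to `t`, and the a priori bound `K` contradicts the
    -- size at `t`.
    obtain ⟨t, ⟨ht, htK⟩, hmin⟩ := hcomp.exists_isLeast ⟨t₁, ht₁, hle⟩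
    have hbefore : ∀ s ∈ Ico 0 t, ‖fun i j => E s i j‖ < K + 1 := fun s hs => by
      by_contra! hc
      exact absurd (hmin ⟨⟨hs.1, hs.2.le.trans ht.2⟩, hc⟩) (not_le.2 hs.2)
    have hzero : ‖fun i j => E 0 i j‖ ≤ K := by
      obtain ⟨τ, hτ, P, hP⟩ := S.exists_isSolution_local P₀
      have hb := h 0 ⟨le_rfl, hT⟩ P (hP.mono hτ.le)
      rw [hP.init, ← hE0] at hb
      exact norm_le_of_entry_le hK hb
    have hat : ‖fun i j => E t i j‖ = K + 1 := by
      obtain ⟨s, hs, hsK⟩ := intermediate_value_Icc ht.1 (hc.mono (Icc_subset_Icc_right ht.2))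
        ⟨hzero.trans (by linarith), htK⟩
      have : t ≤ s := hmin ⟨⟨hs.1, hs.2.trans ht.2⟩, hsK.ge⟩
      rwa [le_antisymm hs.2 this] at hsK
    have hupto : ∀ s ∈ Icc 0 t, ‖fun i j => E s i j‖ ≤ K + 1 := fun s hs =>
      hs.2.eq_or_lt.elim (fun h => by rw [h]; exact hat.le) fun h => (hbefore s ⟨hs.1, h⟩).le
    obtain ⟨P, hP, hPE⟩ := S.exists_isSolution_of_truncE ht hE0 hs hE fun s hs i j =>
      (entry_le_norm (fun i j => E s i j) i j).trans (hupto s hs)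
    have h1 := h t ht P hP
    rw [hPE] at h1
    have h2 := norm_le_of_entry_le (E := fun i j => E t i j) hK h1
    have h3 : K + 1 ≤ ‖fun i j => E t i j‖ := htK
    linarith
  obtain ⟨P, hP, -⟩ := S.exists_isSolution_of_truncE ⟨hT, le_rfl⟩ hE0 hs hE fun s hs i j =>
    (entry_le_norm (fun i j => E s i j) i j).trans (hlt s hs).le
  exact ⟨P, hP⟩

/-- Existence on a given interval is stable under small changes of the initial value. -/
theorem exists_isSolution_of_near {T K : ℝ} (hT : 0 ≤ T) (hK : 0 ≤ K) :
    ∃ L : ℝ, 0 < L ∧ ∀ P₀ Q₀ P, S.IsSolution P₀ T P →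
      (∀ t ∈ Icc 0 T, ∀ i j, |(P t).E i j| ≤ K) → ‖Q₀.params.1 - P₀.params.1‖ ≤ L →
      ∃ Q, S.IsSolution Q₀ T Q ∧ ∀ t ∈ Icc 0 T, ∀ i j, |(Q t).E i j| ≤ K + 1 := by
  obtain ⟨M, hM⟩ := S.exists_truncE_lipschitz (C := K + 1) (by positivity)
  -- Grönwall enlarges distances by at most `exp (M * T)`. Initial values this close stay within
  -- distance `1`, hence inside the cube of size `K + 1`. The radius does not depend on the
  -- solution, which is what the passage to the closure of the scalings requires.
  refine ⟨Real.exp (-(M * T)), Real.exp_pos _, fun P₀ Q₀ P hP hPK hdist => ?_⟩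
  obtain ⟨E, hE0, hs, hE⟩ := S.exists_truncE_solution (C := K + 1) (by positivity) hT Q₀.E_symm
  have hPE : ∀ t ∈ Icc 0 T, HasDerivWithinAt (fun s => (P s).params.1)
      (S.truncE (K + 1) (P t).params.1) (Icc 0 T) t := fun t ht =>
    hasDerivWithinAt_pi.2 fun i => hasDerivWithinAt_pi.2 fun j => by
      have h1 : S.truncE (K + 1) (P t).params.1 i j = S.rhsE (P t).E i j :=
        S.truncE_eq (P t).E_symm (fun i j => (hPK t ht i j).trans (by linarith)) i j
      rw [h1]
      exact hP.E_deriv t ht i j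
  have hd := dist_le_of_trajectories_ODE (v := fun _ => S.truncE (K + 1)) (K := M)
    (f := fun s i j => E s i j) (g := fun s => (P s).params.1) (a := 0) (b := T)
    (δ := Real.exp (-(M * T))) (fun _ => hM)
    (fun t ht => (hE t ht).continuousWithinAt)
    (fun t ht => hasDerivWithinAt_Ici_of_Icc (hE t (Ico_subset_Icc_self ht)) ht)
    (fun t ht => (hPE t ht).continuousWithinAt)
    (fun t ht => hasDerivWithinAt_Ici_of_Icc (hPE t (Ico_subset_Icc_self ht)) ht)
    (by simp only [hE0, hP.init]; rw [dist_eq_norm]; exact hdist)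
  have hb : ∀ t ∈ Icc 0 T, ∀ i j, |E t i j| ≤ K + 1 := fun t ht i j => by
    have h1 : ‖(fun i j => E t i j) - (P t).params.1‖ ≤ 1 := by
      rw [← dist_eq_norm]
      refine (hd t ht).trans ?_
      rw [← Real.exp_add, Real.exp_le_one_iff]
      have : (M : ℝ) * (t - 0) ≤ M * T := by gcongr; linarith [ht.2]
      linarith
    have h2 := (entry_le_norm _ i j).trans h1
    have h3 := hPK t ht i j
    simp only [Pi.sub_apply, Paraboloid.params] at h2
    calc |E t i j| = |(E t i j - (P t).E i j) + (P t).E i j| := by rw [sub_add_cancel]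
      _ ≤ _ := abs_add_le _ _
      _ ≤ _ := by linarith
  obtain ⟨Q, hQ, hQE⟩ := S.exists_isSolution_of_truncE ⟨hT, le_rfl⟩ hE0 hs hE hb
  exact ⟨Q, hQ, fun t ht => by rw [hQE]; exact hb t ht⟩

/-- A bound of `f` that depends only on bounds of `E` and of the initial value. -/
theorem exists_f_bound {T : ℝ} (hT : 0 ≤ T) {K Φ : ℝ} (hK : 0 ≤ K) (hΦ : 0 ≤ Φ) :
    ∃ C : ℝ, ∀ P₀ P, S.IsSolution P₀ T P → (∀ t ∈ Icc 0 T, ∀ i j, |(P t).E i j| ≤ K) →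
      ‖P₀.f‖ ≤ Φ → ∀ t ∈ Icc 0 T, ‖(P t).f‖ ≤ C := by
  obtain ⟨V, hV⟩ := S.exists_u_bound T
  have hcomp := (isCompact_closedBall (0 : Fin n → Fin n → ℝ) K).prod
    ((isCompact_closedBall (0 : Fin n → ℝ) 1).prod (isCompact_closedBall (0 : Fin p → ℝ) V))
  have hcont : Continuous fun z : (Fin n → Fin n → ℝ) × (Fin n → ℝ) × (Fin p → ℝ) =>
      S.rhsf (Matrix.of z.1) z.2.1 z.2.2 := S.continuous_rhsf
  obtain ⟨a, ha⟩ := hcomp.exists_bound_of_continuousOn hcont.continuousOn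
  have hV0 : 0 ≤ V := (norm_nonneg _).trans (hV 0 ⟨le_rfl, hT⟩)
  have ha0 : 0 ≤ a := (norm_nonneg _).trans (ha (0, 0, 0) (by simp [hK, hV0]))
  have hgrow : ∀ E : Matrix (Fin n) (Fin n) ℝ, (∀ i j, |E i j| ≤ K) → ∀ f v, ‖v‖ ≤ V →
      ‖S.rhsf E f v‖ ≤ a * ‖f‖ + a := by
    intro E hE f v hv
    have hEmem : (fun i j => E i j) ∈ Metric.closedBall (0 : Fin n → Fin n → ℝ) K := by
      rw [mem_closedBall_zero_iff]; exact norm_le_of_entry_le hK hE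
    -- The right-hand side is affine in `f`: its linear part is controlled on the unit ball, its
    -- constant part at `f = 0`, and compactness bounds both by the same `a`.
    have h1 : S.rhsf E f v = ‖f‖ • S.rhsf E (‖f‖⁻¹ • f) 0 + S.rhsf E 0 v := by
      have hf : ‖f‖ • (‖f‖⁻¹ • f) = f := by
        rcases eq_or_ne f 0 with rfl | hf
        · simp
        · rw [smul_smul, mul_inv_cancel₀ (norm_ne_zero_iff.2 hf), one_smul]
      have h2 : ‖f‖ • S.rhsf E (‖f‖⁻¹ • f) 0 = S.rhsf E (‖f‖ • (‖f‖⁻¹ • f)) 0 := by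
        simp only [rhsf, Matrix.mulVec_smul, Matrix.mulVec_zero, smul_add, smul_neg, smul_zero,
          sub_zero]
      rw [h2, hf]
      simp only [rhsf, Matrix.mulVec_zero, Matrix.mulVec_sub]
      abel_nf
    have h3 : ‖S.rhsf E (‖f‖⁻¹ • f) 0‖ ≤ a := by
      refine ha ((fun i j => E i j), ‖f‖⁻¹ • f, 0) ⟨hEmem, ?_, by simpa using hV0⟩
      rw [mem_closedBall_zero_iff, norm_smul, norm_inv, norm_norm]
      exact inv_mul_le_one
    have h4 : ‖S.rhsf E 0 v‖ ≤ a :=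
      ha ((fun i j => E i j), 0, v) ⟨hEmem, by simp, by simpa using hv⟩
    rw [h1]
    refine (norm_add_le _ _).trans (add_le_add ?_ h4)
    rw [norm_smul, norm_norm, mul_comm]
    gcongr
  refine ⟨gronwallBound Φ a a T, fun P₀ P hP hPK hf t ht => ?_⟩
  have h := norm_le_gronwallBound_of_norm_deriv_right_le (δ := Φ) (K := a) (ε := a)
    hP.continuousOn_f
    (fun t ht => hasDerivWithinAt_Ici_of_Icc (hP.f_deriv t (Ico_subset_Icc_self ht)) ht)
    (by rw [hP.init]; exact hf)
    (fun t ht => hgrow _ (hPK t (Ico_subset_Icc_self ht)) _ _ (hV t (Ico_subset_Icc_self ht))) t ht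
  exact h.trans (gronwallBound_mono hΦ ha0 ha0 (by linarith [ht.2]))

end LTISystem

/-! ### The sets bounded by paraboloids -/

namespace Paraboloid

variable {n : ℕ}

/-- The part of the value function that depends on `x` only. -/
def base (P : Paraboloid n) (x : Fin n → ℝ) : ℝ := x ⬝ᵥ (P.E *ᵥ x) - 2 * (P.f ⬝ᵥ x) + P.g

theorem value_eq (P : Paraboloid n) (x : Fin n → ℝ) (q : ℝ) : P.value (x, q) = P.base x + q := rfl

theorem base_scale (γ : ℝ) (P : Paraboloid n) (x : Fin n → ℝ) :
    (P.scale γ).base x = γ * P.base x := by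
  simp only [base, scale, Matrix.smul_mulVec, dotProduct_smul, smul_dotProduct, smul_eq_mul]
  ring

theorem scale_one (P : Paraboloid n) : P.scale 1 = P := by
  ext1 <;> simp [scale]

theorem params_scale (γ : ℝ) (P : Paraboloid n) : (P.scale γ).params = γ • P.params := rfl

/-- The value function depends continuously on the parameters and the state. -/
theorem continuous_value : Continuous fun z : ParamSpace n × State n =>
    z.2.1 ⬝ᵥ ((Matrix.of z.1.1) *ᵥ z.2.1) - 2 * (z.1.2.1 ⬝ᵥ z.2.1) + z.1.2.2 + z.2.2 := by
  refine Continuous.add (Continuous.add (Continuous.sub ?_ ?_) ?_) ?_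
  · simp only [dotProduct, Matrix.mulVec, Matrix.of_apply]
    fun_prop
  · simp only [dotProduct]
    fun_prop
  · fun_prop
  · fun_prop

theorem _root_.ContinuousOn.paraboloid_value {Z : Type*} [TopologicalSpace Z] {s : Set Z}
    {P : Z → Paraboloid n} {X : Z → State n} (hP : ContinuousOn (fun z => (P z).params) s)
    (hX : ContinuousOn X s) : ContinuousOn (fun z => (P z).value (X z)) s :=
  continuous_value.comp_continuousOn (f := fun z => ((P z).params, X z)) (hP.prodMk hX)

/-- The value grows at unit rate in `x_q`, so raising `x_q` slightly from the zero level leaves the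
set. -/
theorem frontier_toSet (P : Paraboloid n) : frontier P.toSet = {X | P.value X = 0} := by
  have hc : Continuous P.value := by
    rw [← continuousOn_univ]
    exact ContinuousOn.paraboloid_value (P := fun _ => P) continuousOn_const continuousOn_id
  have hclosed : IsClosed P.toSet := isClosed_le hc continuous_const
  ext X
  constructor
  · intro hX
    have h1 : P.value X ≤ 0 := hclosed.frontier_subset hX
    refine h1.antisymm (not_lt.1 fun h2 => hX.2 ?_)
    exact mem_interior.2 ⟨{X | P.value X < 0}, fun Y (hY : P.value Y < 0) => hY.le,
      isOpen_lt hc continuous_const, h2⟩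
  · intro hX
    have hX' : P.value X = 0 := hX
    refine ⟨subset_closure hX'.le, fun h => ?_⟩
    have h1 : Tendsto (fun δ : ℝ => (X.1, X.2 + δ)) (𝓝[>] 0) (𝓝 X) := by
      have : Tendsto (fun δ : ℝ => (X.1, X.2 + δ)) (𝓝 0) (𝓝 (X.1, X.2 + 0)) :=
        Continuous.tendsto (by fun_prop) 0
      rw [add_zero] at this
      exact this.mono_left nhdsWithin_le_nhds
    obtain ⟨δ, h2, h3⟩ := ((h1.eventually (mem_interior_iff_mem_nhds.1 h)).and
      self_mem_nhdsWithin).exists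
    have h4 : P.value (X.1, X.2 + δ) ≤ 0 := h2
    have h5 : P.value (X.1, X.2 + δ) = P.value X + δ := by
      simp only [value]; ring
    have h6 : (0 : ℝ) < δ := h3
    linarith

end Paraboloid

theorem abs_entry_le_frobNorm {n : ℕ} (A : Matrix (Fin n) (Fin n) ℝ) (i j : Fin n) :
    |A i j| ≤ frobNorm A := by
  refine Real.le_sqrt_of_sq_le ?_
  rw [sq_abs, Matrix.trace]
  have h1 : ∀ j, (Aᵀ * A) j j = ∑ i, A i j ^ 2 := fun j => by
    simp only [Matrix.mul_apply, Matrix.transpose_apply, sq]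
  calc A i j ^ 2 ≤ ∑ i, A i j ^ 2 :=
        Finset.single_le_sum (f := fun i => A i j ^ 2) (fun _ _ => sq_nonneg _) (Finset.mem_univ i)
    _ = (Aᵀ * A) j j := (h1 j).symm
    _ ≤ ∑ j, (Aᵀ * A) j j :=
        Finset.single_le_sum (f := fun j => (Aᵀ * A) j j)
          (fun j _ => by rw [h1]; exact Finset.sum_nonneg fun _ _ => sq_nonneg _)
          (Finset.mem_univ j)

/-- A function that strictly decreases whenever it takes a value in `[-ε, 0]` at a positive time
does not become negative before a time at which it is nonnegative. -/
theorem nonneg_of_falling {q : ℝ → ℝ} {T ε t : ℝ} (hε : 0 < ε) (hq : ContinuousOn q (Icc 0 T))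
    (hfall : ∀ s ∈ Ioc 0 T, q s ∈ Icc (-ε) 0 → derivWithin q (Icc 0 T) s < 0)
    (ht : t ∈ Icc 0 T) (hqt : 0 ≤ q t) : ∀ s ∈ Icc 0 t, 0 ≤ q s := by
  intro s₀ hs₀
  by_contra! hneg
  -- A level in the falling band `(-ε, 0)` above `q s₀`. At the last time `s` with `q s ≤ c` one has
  -- `q s = c`, but falling pushes `q` below `c` right after `s`.
  obtain ⟨c, hc, hc0⟩ : ∃ c, max (q s₀) (-ε) < c ∧ c < 0 := exists_between (by simp [hneg, hε])
  have hsub : Icc s₀ t ⊆ Icc 0 T := Icc_subset_Icc hs₀.1 ht.2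
  have hcomp : IsCompact (Icc s₀ t ∩ q ⁻¹' Iic c) :=
    isCompact_Icc.of_isClosed_subset
      ((hq.mono hsub).preimage_isClosed_of_isClosed isClosed_Icc isClosed_Iic) inter_subset_left
  obtain ⟨s, ⟨hs, hsc⟩, hmax⟩ := hcomp.exists_isGreatest
    ⟨s₀, ⟨le_rfl, hs₀.2⟩, (le_max_left _ _).trans hc.le⟩
  have hst : s < t := hs.2.lt_of_ne fun h => by
    rw [h] at hsc
    exact absurd (hqt.trans hsc) (not_le.2 hc0)
  have hqs : q s = c := by
    refine le_antisymm hsc (not_lt.1 fun hlt => ?_)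
    obtain ⟨r, hr, hrc⟩ := intermediate_value_Icc hs.2 (hq.mono ((Icc_subset_Icc_left hs.1).trans hsub))
      ⟨hlt.le, hc0.le.trans hqt⟩
    have : r ≤ s := hmax ⟨⟨hs.1.trans hr.1, hr.2⟩, hrc.le⟩
    rw [le_antisymm this hr.1] at hrc
    exact hlt.ne hrc
  have hs0 : 0 < s := by
    refine lt_of_le_of_lt hs₀.1 (hs.1.lt_of_ne fun h => ?_)
    rw [← h] at hqs
    exact absurd ((le_max_left _ _).trans_lt hc) (by rw [hqs]; exact lt_irrefl _)
  have hd := hfall s ⟨hs0, hst.le.trans ht.2⟩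
    ⟨by rw [hqs]; exact ((le_max_right _ _).trans_lt hc).le, by rw [hqs]; exact hc0.le⟩
  -- `derivWithin` is `0` where there is no derivative, so a negative value proves
  -- differentiability.
  have hdiff : DifferentiableWithinAt ℝ q (Icc 0 T) s := by
    by_contra h
    rw [derivWithin_zero_of_not_differentiableWithinAt h] at hd
    exact lt_irrefl _ hd
  have h1 := hasDerivWithinAt_Ici_of_Icc hdiff.hasDerivWithinAt ⟨hs0.le, hst.trans_le ht.2⟩
  have h2 := (h1.mono Ioi_subset_Ici_self).limsup_slope_le' (lt_irrefl s) hd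
  have h3 : ∀ᶠ r in 𝓝[>] s, r ∈ Ioc s t := Ioc_mem_nhdsGT hst
  obtain ⟨r, h4, h5⟩ := (h2.and h3).exists
  have h6 : q r < q s := by
    rw [slope_def_field, div_neg_iff] at h4
    rcases h4 with h4 | h4
    · linarith [h5.1]
    · linarith
  have : r ≤ s := hmax ⟨⟨hs.1.trans h5.1.le, h5.2⟩, by rw [← hqs]; exact h6.le⟩
  exact absurd h5.1 (not_lt.2 this)

namespace LTISystem

variable {n p m : ℕ} {S : LTISystem n p m}

theorem IsSolution.timeVarying_eq {P₀ : Paraboloid n} {τ t : ℝ} {P : ℝ → Paraboloid n}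
    (h : S.IsSolution P₀ τ P) (ht : t ∈ Icc 0 τ) : S.timeVarying P₀ t = (P t).toSet := by
  ext X
  constructor
  · rintro ⟨Q, hQ, hX⟩
    rwa [(h.mono ht.2).unique hQ ⟨ht.1, le_rfl⟩]
  · exact fun hX => ⟨P, h.mono ht.2, hX⟩

/-- Along a trajectory of constant value, the energy is differentiable at the initial time. -/
theorem IsTrajectory.hasDerivWithinAt_xq {P₀ : Paraboloid n} {τ : ℝ} {P : ℝ → Paraboloid n}
    (hP : S.IsSolution P₀ τ P) (hτ : 0 ≤ τ) {w : ℝ → Fin m → ℝ} {x : ℝ → Fin n → ℝ} {xq : ℝ → ℝ}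
    (h : S.IsTrajectory τ w x xq)
    (hv : (P 0).value (x 0, xq 0) = (P τ).value (x τ, xq τ)) {t : ℝ} (ht : t ∈ Icc 0 τ) :
    HasDerivWithinAt xq (S.rate (x t) (S.u t) (S.optw (P t).E (P t).f (S.u t) (x t)))
      (Icc 0 τ) t := by
  have hprim := h.hasPrimitive_value hτ hP
  have h0 := hprim.sub_eq ⟨le_rfl, hτ⟩ ⟨hτ, le_rfl⟩
  simp only [hv, sub_self] at h0
  have hint := hprim.1.neg
  -- The integrand has one sign and integral zero, so it vanishes almost everywhere. By definiteness
  -- `w` is the touching disturbance almost everywhere, and the rate of `x_q` may be replaced by a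
  -- continuous function.
  have h1 : ∫ s in (0 : ℝ)..τ, -S.wForm (w s - S.optw (P s).E (P s).f (S.u s) (x s)) = 0 := by
    rw [intervalIntegral.integral_neg, ← h0, neg_zero]
  rw [intervalIntegral.integral_eq_zero_iff_of_le_of_nonneg_ae hτ
    (ae_of_all _ fun s => neg_nonneg.2 (S.wForm_nonpos _)) hint] at h1
  have hw : ∀ᵐ s ∂(volume.restrict (Ioc 0 τ)), w s = S.optw (P s).E (P s).f (S.u s) (x s) := by
    filter_upwards [h1] with s hs
    exact sub_eq_zero.1 (S.wForm_eq_zero (neg_eq_zero.1 hs))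
  have hc : ContinuousOn (fun s => S.optw (P s).E (P s).f (S.u s) (x s)) (Icc 0 τ) :=
    hP.continuousOn_optw h.x_continuousOn
  have hrc := continuousOn_rate (S := S) h.x_continuousOn S.continuousOn_u hc
  have hprim' : HasPrimitive xq
      (fun s => S.rate (x s) (S.u s) (S.optw (P s).E (P s).f (S.u s) (x s))) τ := by
    refine ⟨ContinuousOn.intervalIntegrable (by rwa [uIcc_of_le hτ]), fun t ht => ?_⟩
    rw [h.xq_eq t ht]
    congr 1
    refine intervalIntegral.integral_congr_ae ?_
    rw [ae_restrict_iff' measurableSet_Ioc] at hw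
    filter_upwards [hw] with s hs hst
    rw [uIoc_of_le ht.1] at hst
    rw [hs ⟨hst.1, hst.2.trans ht.2⟩]
  exact hprim'.hasDerivWithinAt hrc ht

/-- The set of scalings is downward closed in `[1, ∞)`. -/
theorem mem_scalings_of_le {P₀ : Paraboloid n} {ε γ γ' : ℝ} (hγ : γ ∈ S.scalings P₀ ε)
    (h1 : 1 ≤ γ') (h : γ' ≤ γ) : γ' ∈ S.scalings P₀ ε := by
  obtain ⟨-, X, hX, τ, ⟨-, P, hP⟩, hτ, x, xq, ⟨⟨w, hw⟩, htouch⟩, hinit, d, hd, hd0⟩ := hγ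
  subst hinit
  have hval : ∀ t ∈ Icc 0 τ, (P t).value (x t, xq t) = 0 := fun t ht => by
    have := htouch t ht
    rwa [hP.timeVarying_eq ht, Paraboloid.frontier_toSet] at this
  have h0 : (0 : ℝ) ∈ Icc 0 τ := ⟨le_rfl, hτ.le⟩
  have hder := hw.hasDerivWithinAt_xq hP hτ.le
    ((hval 0 h0).trans (hval τ ⟨hτ.le, le_rfl⟩).symm) h0
  have hdeq := (uniqueDiffOn_Icc hτ 0 h0).eq_deriv _ hd hder
  rw [hP.init] at hdeq
  have hv0 := hval 0 h0
  rw [hP.init, Paraboloid.value_eq, Paraboloid.base_scale] at hv0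
  obtain ⟨hXb, hXq⟩ := hX
  set b := P₀.base (x 0) with hb
  have hXb' : -b ∈ Icc (-ε) 0 := by
    have : -b = -(x 0 ⬝ᵥ (P₀.E *ᵥ x 0)) + 2 * (P₀.f ⬝ᵥ x 0) - P₀.g := by
      rw [hb, Paraboloid.base]; ring
    rw [this]
    exact hXb
  simp only [mem_Icc] at hXb' hXq
  obtain ⟨τ', hτ', P', hP'⟩ := S.exists_isSolution_local (P₀.scale γ')
  have h0' : (0 : ℝ) ∈ Icc 0 τ' := ⟨le_rfl, hτ'.le⟩
  -- Keep `x 0` and lower the energy deficit to the boundary of `γ' P₀`: from `0 ≤ b` and `1 ≤ γ' ≤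
  -- γ`, the new energy `-(γ' * b)` lies between `-(γ * b) ≥ -ε` and `0`.
  obtain ⟨x', xq', hx', hinit'⟩ := hP'.exists_closedLoop h0' (x 0, -(γ' * b))
  have hx0 : x' 0 = x 0 := congrArg Prod.fst hinit'
  have hq0 : xq' 0 = -(γ' * b) := congrArg Prod.snd hinit'
  have hval' : ∀ t ∈ Icc 0 τ', (P' t).value (x' t, xq' t) = 0 := fun t ht => by
    rw [hx'.value_eq_of_optw hP' ht h0', hP'.init, Paraboloid.value_eq, Paraboloid.base_scale, hx0,
      hq0, ← hb]
    ring
  refine ⟨h1, (x 0, -(γ' * b)), ⟨hXb, ?_⟩, τ', ⟨hτ'.le, P', hP'⟩, hτ', x', xq',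
    ⟨⟨_, hx'⟩, fun t ht => ?_⟩, hinit', _, hx'.hasDerivWithinAt_xq hP' hτ'.le
      ((hval' 0 h0').trans (hval' τ' ⟨hτ'.le, le_rfl⟩).symm) h0', ?_⟩
  · have hb0 : 0 ≤ b := by linarith [hXb'.2]
    have : γ' * b ≤ γ * b := by gcongr
    have : 0 ≤ γ' * b := by positivity
    constructor <;> dsimp only <;> linarith [hXq.1]
  · rw [hP'.timeVarying_eq ht, Paraboloid.frontier_toSet]
    exact hval' t ht
  · rw [hP'.init, hx0]
    refine le_trans ?_ (S.rate_optw_smul_anti (S.u 0) (x 0) (by linarith) h)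
    rw [hdeq] at hd0
    exact hd0

end LTISystem

/-! ### Families of time-varying paraboloids -/

namespace LTISystem

variable {n p m : ℕ}

/-- For the scalings `γ ∈ G`, the parameter equations with initial value `γ P₀` have solutions
`P γ` on `[0, T]` with a common bound of their Riccati matrices. -/
structure IsFamily (S : LTISystem n p m) (P₀ : Paraboloid n) (T K : ℝ) (G : Set ℝ)
    (P : ℝ → ℝ → Paraboloid n) : Prop where
  nonneg : 0 ≤ T
  bound_nonneg : 0 ≤ K
  closed : IsClosed G
  one_le : ∀ γ ∈ G, 1 ≤ γ
  mem_of_le : ∀ γ ∈ G, ∀ γ', 1 ≤ γ' → γ' ≤ γ → γ' ∈ G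
  sol : ∀ γ ∈ G, S.IsSolution (P₀.scale γ) T (P γ)
  bound : ∀ γ ∈ G, ∀ t ∈ Icc 0 T, ∀ i j, |(P γ t).E i j| ≤ K

/-- The a priori bound excludes blow-up, so every scaling has a solution on all of `[0, T]`. Limits
of scalings inherit one from a neighbour within the uniform stability radius, at the price of the
bound `K + 1`. The closure is wanted so that bounded sets of scalings become compact. -/
theorem exists_isFamily {S : LTISystem n p m} {P₀ : Paraboloid n} {ε T : ℝ} (hT : 0 ≤ T)
    (hE : S.RiccatiBounded P₀ ε T) :
    ∃ K P, S.IsFamily P₀ T K (closure (S.scalings P₀ ε)) P := by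
  obtain ⟨K, hK, hbound⟩ := hE
  have hsol : ∀ γ ∈ S.scalings P₀ ε, ∃ P, S.IsSolution (P₀.scale γ) T P ∧
      ∀ t ∈ Icc 0 T, ∀ i j, |(P t).E i j| ≤ K := fun γ hγ => by
    have hb : ∀ t ∈ Icc 0 T, ∀ P, S.IsSolution (P₀.scale γ) t P → ∀ i j, |(P t).E i j| ≤ K :=
      fun t ht P hP i j => (abs_entry_le_frobNorm _ i j).trans (hbound γ hγ t ht P hP)
    obtain ⟨P, hP⟩ := S.exists_isSolution_of_bound hT hK.le hb
    exact ⟨P, hP, fun t ht => hb t ht P (hP.mono ht.2)⟩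
  obtain ⟨L, hL, hnear⟩ := S.exists_isSolution_of_near hT hK.le
  have hcl : ∀ γ ∈ closure (S.scalings P₀ ε), ∃ P, S.IsSolution (P₀.scale γ) T P ∧
      ∀ t ∈ Icc 0 T, ∀ i j, |(P t).E i j| ≤ K + 1 := fun γ hγ => by
    obtain ⟨γ', hγ', hd⟩ := Metric.mem_closure_iff.1 hγ (L / (‖P₀.params.1‖ + 1)) (by positivity)
    obtain ⟨P, hP, hPK⟩ := hsol γ' hγ'
    refine hnear (P₀.scale γ') (P₀.scale γ) P hP hPK ?_
    have h1 : (P₀.scale γ).params.1 - (P₀.scale γ').params.1 = (γ - γ') • P₀.params.1 := by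
      rw [Paraboloid.params_scale, Paraboloid.params_scale, Prod.smul_fst, Prod.smul_fst, sub_smul]
    rw [h1, norm_smul, ← dist_eq_norm]
    have h2 := (lt_div_iff₀ (by positivity)).1 hd
    nlinarith [norm_nonneg P₀.params.1, dist_nonneg (x := γ) (y := γ')]
  have : Nonempty (Paraboloid n) := ⟨P₀⟩
  choose! P hP hPK using hcl
  have hone : ∀ γ ∈ closure (S.scalings P₀ ε), 1 ≤ γ := fun γ hγ =>
    closure_minimal (fun γ hγ => hγ.1) isClosed_Ici hγ
  refine ⟨K + 1, P, hT, by positivity, isClosed_closure, hone, fun γ hγ γ' h1 hle => ?_, hP, hPK⟩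
  rcases hle.eq_or_lt with rfl | hlt
  · exact hγ
  -- A scaling strictly below a limit of scalings lies below an actual one, where downward
  -- closedness applies.
  · obtain ⟨γ'', h2, h3⟩ := mem_closure_iff.1 hγ (Ioi γ') isOpen_Ioi hlt
    exact subset_closure (mem_scalings_of_le h3 h1 (le_of_lt h2))

/-- By homogeneity of degree two a bound on the unit ball is enough. -/
theorem exists_wForm_bound (S : LTISystem n p m) :
    ∃ c : ℝ, 0 ≤ c ∧ ∀ z, -S.wForm z ≤ c * ‖z‖ ^ 2 := by
  obtain ⟨c, hc⟩ := (isCompact_closedBall (0 : Fin m → ℝ) 1).exists_bound_of_continuousOn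
    S.continuous_wForm.continuousOn
  refine ⟨c, (norm_nonneg _).trans (hc 0 (by simp)), fun z => ?_⟩
  rcases eq_or_ne z 0 with rfl | hz
  · simp [wForm_zero]
  have hz' : ‖z‖ ≠ 0 := norm_ne_zero_iff.2 hz
  have h1 : z = ‖z‖ • (‖z‖⁻¹ • z) := by rw [smul_smul, mul_inv_cancel₀ hz', one_smul]
  have h2 : ‖S.wForm (‖z‖⁻¹ • z)‖ ≤ c := hc _ (by
    rw [mem_closedBall_zero_iff, norm_smul, norm_inv, norm_norm, inv_mul_cancel₀ hz'])
  have h3 : S.wForm z = ‖z‖ ^ 2 * S.wForm (‖z‖⁻¹ • z) := by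
    rw [← wForm_smul, ← h1]
  rw [h3]
  have := (abs_le.1 h2).1
  nlinarith [sq_nonneg ‖z‖]

theorem contDiff_optw (S : LTISystem n p m) : ContDiff ℝ 1
    fun z : (Fin n → Fin n → ℝ) × (Fin n → ℝ) × (Fin p → ℝ) × (Fin n → ℝ) =>
      S.optw (Matrix.of z.1) z.2.1 z.2.2.1 z.2.2.2 := by
  refine contDiff_pi.2 fun i => ?_
  simp only [optw, Pi.add_apply, Pi.neg_apply, Pi.sub_apply, Matrix.mulVec, dotProduct,
    Matrix.add_apply, Matrix.mul_apply, Matrix.transpose_apply, Matrix.of_apply]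
  fun_prop

/-! ### Dependence on the scaling, first order condition, touching trajectories -/

namespace IsFamily

variable {S : LTISystem n p m} {P₀ : Paraboloid n} {T K : ℝ} {G : Set ℝ}
  {P : ℝ → ℝ → Paraboloid n}

theorem isCompact_inter_Iic (h : S.IsFamily P₀ T K G P) (N : ℝ) : IsCompact (G ∩ Iic N) :=
  isCompact_Icc.of_isClosed_subset (h.closed.inter isClosed_Iic)
    fun γ hγ => (⟨h.one_le γ hγ.1, hγ.2⟩ : γ ∈ Icc 1 N)

/-- The cutoff `N` bounds the initial vectors `γ f₀`, hence all `f`. The solutions then share a set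
on which the field is Lipschitz, and their initial values differ by `(γ - γ')` times fixed
parameters. -/
theorem exists_dist_le (h : S.IsFamily P₀ T K G P) (N : ℝ) : ∃ L : ℝ, 0 ≤ L ∧
    ∀ γ ∈ G ∩ Iic N, ∀ γ' ∈ G ∩ Iic N, ∀ t ∈ Icc 0 T,
      dist (P γ t).params (P γ' t).params ≤ L * |γ - γ'| := by
  obtain ⟨C, hC⟩ := S.exists_f_bound h.nonneg h.bound_nonneg
    (Φ := |N| * ‖P₀.f‖) (by positivity)
  obtain ⟨L, hL, hdist⟩ := S.exists_dist_params_le T (max K C)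
  refine ⟨L * ‖P₀.params‖, by positivity, fun γ hγ γ' hγ' t ht => ?_⟩
  have key : ∀ γ ∈ G ∩ Iic N, ∀ t ∈ Icc 0 T,
      ‖(P γ t).params.1‖ ≤ max K C ∧ ‖(P γ t).f‖ ≤ max K C := fun γ hγ t ht => by
    refine ⟨(norm_le_of_entry_le h.bound_nonneg (h.bound γ hγ.1 t ht)).trans (le_max_left _ _),
      (hC _ _ (h.sol γ hγ.1) (h.bound γ hγ.1) ?_ t ht).trans (le_max_right _ _)⟩
    have h1 : (P₀.scale γ).f = γ • P₀.f := rfl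
    rw [h1, norm_smul, Real.norm_eq_abs]
    have := h.one_le γ hγ.1
    gcongr ?_ * _
    exact abs_le_abs_of_nonneg (by linarith) hγ.2
  refine (hdist T ⟨h.nonneg, le_rfl⟩ _ _ _ _ (h.sol γ hγ.1) (h.sol γ' hγ'.1) (key γ hγ)
    (key γ' hγ') t ht).trans_eq ?_
  rw [Paraboloid.params_scale, Paraboloid.params_scale, dist_eq_norm, ← sub_smul, norm_smul,
    Real.norm_eq_abs]
  ring

theorem continuousOn_params (h : S.IsFamily P₀ T K G P) (N : ℝ) :
    ContinuousOn (fun z : ℝ × ℝ => (P z.1 z.2).params) ((G ∩ Iic N) ×ˢ Icc 0 T) := by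
  obtain ⟨L, hL, hdist⟩ := h.exists_dist_le N
  refine continuousOn_prod_of_continuousOn_lipschitzOnWith _ L.toNNReal
    (fun γ hγ => (h.sol γ hγ.1).continuousOn_params) fun t ht => ?_
  refine LipschitzOnWith.of_dist_le_mul fun γ hγ γ' hγ' => ?_
  rw [Real.coe_toNNReal L hL, Real.dist_eq]
  exact hdist γ hγ γ' hγ' t ht

theorem continuousOn_value (h : S.IsFamily P₀ T K G P) (N : ℝ) {X : ℝ → State n}
    {s : Set ℝ} (hs : s ⊆ Icc 0 T) (hX : ContinuousOn X s) :
    ContinuousOn (fun z : ℝ × ℝ => (P z.1 z.2).value (X z.2)) ((G ∩ Iic N) ×ˢ s) :=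
  ContinuousOn.paraboloid_value (P := fun z : ℝ × ℝ => P z.1 z.2) (X := fun z : ℝ × ℝ => X z.2)
    ((h.continuousOn_params N).mono (prod_mono_right hs))
    (hX.comp continuousOn_snd fun _ hz => hz.2)

/-- Sign conditions extend from a set of scalings to its closure. -/
theorem value_nonpos_of_closure (h : S.IsFamily P₀ T K G P) {Γ : Set ℝ} (hΓ : G = closure Γ)
    {t : ℝ} (ht : t ∈ Icc 0 T) {X : State n} (hX : ∀ γ ∈ Γ, (P γ t).value X ≤ 0) :
    ∀ γ ∈ G, (P γ t).value X ≤ 0 := by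
  intro γ hγ
  have h1 : γ ∈ closure (Iio (γ + 1) ∩ Γ) := by
    rw [hΓ] at hγ
    exact isOpen_Iio.inter_closure ⟨lt_add_one γ, hγ⟩
  have h2 : ContinuousOn (fun z : ℝ × ℝ => (P z.1 z.2).value X) ((G ∩ Iic (γ + 1)) ×ˢ Icc 0 T) :=
    h.continuousOn_value (γ + 1) (X := fun _ => X) Subset.rfl continuousOn_const
  have h3 : ContinuousOn (fun γ' => (P γ' t).value X) (G ∩ Iic (γ + 1)) :=
    h2.comp (f := fun γ' => (γ', t)) (by fun_prop) fun γ' hγ' => ⟨hγ', ht⟩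
  refine ContinuousWithinAt.closure_le (f := fun γ' => (P γ' t).value X) (g := fun _ => (0 : ℝ)) h1
    ((h3 γ ⟨hγ, (lt_add_one γ).le⟩).mono fun γ' hγ' => ⟨?_, (mem_Iio.1 hγ'.1).le⟩)
    continuousWithinAt_const fun γ' hγ' => hX γ' hγ'.2
  rw [hΓ]
  exact subset_closure hγ'.2

/-- Touching disturbances depend Lipschitz continuously on the scaling. -/
theorem exists_wForm_le (h : S.IsFamily P₀ T K G P) (N : ℝ) {x : ℝ → Fin n → ℝ}
    (hx : ContinuousOn x (Icc 0 T)) : ∃ C : ℝ, 0 ≤ C ∧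
    ∀ γ ∈ G ∩ Iic N, ∀ γ' ∈ G ∩ Iic N, ∀ s ∈ Icc 0 T,
      -S.wForm (S.optw (P γ s).E (P γ s).f (S.u s) (x s) -
        S.optw (P γ' s).E (P γ' s).f (S.u s) (x s)) ≤ C * (γ - γ') ^ 2 := by
  obtain ⟨L, hL, hdist⟩ := h.exists_dist_le N
  obtain ⟨c, hc, hform⟩ := S.exists_wForm_bound
  have hcont : ContinuousOn (fun z : ℝ × ℝ => ((P z.1 z.2).params.1, (P z.1 z.2).params.2.1,
      S.u z.2, x z.2)) ((G ∩ Iic N) ×ˢ Icc 0 T) := by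
    have h1 := h.continuousOn_params N
    have hsnd : MapsTo Prod.snd ((G ∩ Iic N) ×ˢ Icc 0 T) (Icc 0 T) := fun z hz => hz.2
    exact h1.fst.prodMk (h1.snd.fst.prodMk
      ((S.continuousOn_u.comp continuousOn_snd hsnd).prodMk (hx.comp continuousOn_snd hsnd)))
  obtain ⟨R, hR⟩ := ((h.isCompact_inter_Iic N).prod isCompact_Icc).exists_bound_of_continuousOn hcont
  obtain ⟨M, hM⟩ := exists_lipschitzOnWith_of_contDiff S.contDiff_optw
    (isCompact_closedBall 0 R)
  refine ⟨c * (M * L) ^ 2, by positivity, fun γ hγ γ' hγ' s hs => ?_⟩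
  have h1 := hM.dist_le_mul
    ((P γ s).params.1, (P γ s).params.2.1, S.u s, x s)
    (mem_closedBall_zero_iff.2 (hR (γ, s) ⟨hγ, hs⟩))
    ((P γ' s).params.1, (P γ' s).params.2.1, S.u s, x s)
    (mem_closedBall_zero_iff.2 (hR (γ', s) ⟨hγ', hs⟩))
  have h2 : dist ((P γ s).params.1, (P γ s).params.2.1, S.u s, x s)
      ((P γ' s).params.1, (P γ' s).params.2.1, S.u s, x s) ≤ L * |γ - γ'| := by
    refine le_trans ?_ (hdist γ hγ γ' hγ' s hs)
    simp only [Prod.dist_eq, dist_self]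
    refine max_le (le_max_left _ _) (max_le ?_ ?_)
    · exact (le_max_left _ _).trans (le_max_right _ _)
    · exact le_max_of_le_left dist_nonneg
  have h3 : ‖S.optw (P γ s).E (P γ s).f (S.u s) (x s) -
      S.optw (P γ' s).E (P γ' s).f (S.u s) (x s)‖ ≤ M * L * |γ - γ'| := by
    rw [← dist_eq_norm, mul_assoc]
    exact h1.trans (by gcongr)
  refine (hform _).trans ?_
  calc c * ‖_‖ ^ 2 ≤ c * (M * L * |γ - γ'|) ^ 2 := by gcongr
    _ = c * (M * L) ^ 2 * (γ - γ') ^ 2 := by rw [mul_pow, sq_abs]; ring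

/-- First order condition: if the scaling `γ` maximizes the value of the final state of a
touching trajectory, then the value of its initial state is maximal, too. -/
theorem mul_base_nonpos (h : S.IsFamily P₀ T K G P) {γ : ℝ} (hγ : γ ∈ G) {x : ℝ → Fin n → ℝ}
    {xq : ℝ → ℝ}
    (hx : S.IsTrajectory T (fun s => S.optw (P γ s).E (P γ s).f (S.u s) (x s)) x xq)
    (h0 : γ * P₀.base (x 0) + xq 0 = 0) {t : ℝ} (ht : t ∈ Icc 0 T)
    (hmax : ∀ γ' ∈ G, (P γ' t).value (x t, xq t) ≤ 0) {γ' : ℝ} (hγ' : γ' ∈ G) :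
    (γ' - γ) * P₀.base (x 0) ≤ 0 := by
  obtain ⟨C, hC, hCle⟩ := h.exists_wForm_le (max γ γ') hx.x_continuousOn
  have hzero : (0 : ℝ) ∈ Icc 0 T := ⟨le_rfl, h.nonneg⟩
  set a := (γ' - γ) * P₀.base (x 0) with ha
  set D := C * (γ' - γ) ^ 2 * t with hD
  -- For the scaling `β` between `γ` and `γ'` the value is `s * a` at time `0` and nonpositive at
  -- time `t`, and it loses at most `D * s ^ 2` in between. Dividing by `s` and letting `s → 0`
  -- gives `a ≤ 0`.
  have key : ∀ s ∈ Ioc (0 : ℝ) 1, a ≤ D * s := by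
    intro s hs
    set β := γ + s * (γ' - γ) with hβ
    have hβle : β ≤ max γ γ' := by
      have h1 := le_max_left γ γ'
      have h2 := le_max_right γ γ'
      have : β = (1 - s) * γ + s * γ' := by rw [hβ]; ring
      nlinarith [hs.1, hs.2]
    have hβ1 : 1 ≤ β := by
      have h1 := h.one_le γ hγ
      have h2 := h.one_le γ' hγ'
      have : β = (1 - s) * γ + s * γ' := by rw [hβ]; ring
      nlinarith [hs.1, hs.2]
    have hmaxG : max γ γ' ∈ G := by
      rcases max_choice γ γ' with h1 | h1 <;> rw [h1] <;> assumption
    have hβG : β ∈ G := h.mem_of_le _ hmaxG β hβ1 hβle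
    have h1 := (hx.hasPrimitive_value h.nonneg (h.sol β hβG)).sub_eq hzero ht
    have h2 : (P β 0).value (x 0, xq 0) = s * a := by
      rw [(h.sol β hβG).init, Paraboloid.value_eq, Paraboloid.base_scale, ha, hβ]
      linarith
    have h3 : ∫ r in (0 : ℝ)..t, -S.wForm (S.optw (P γ r).E (P γ r).f (S.u r) (x r) -
        S.optw (P β r).E (P β r).f (S.u r) (x r)) ≤ ∫ r in (0 : ℝ)..t, C * (γ - β) ^ 2 := by
      refine intervalIntegral.integral_mono_on ht.1
        ((hx.hasPrimitive_value h.nonneg (h.sol β hβG)).intervalIntegrable_of_mem hzero ht).neg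
        (by simp) fun r hr => ?_
      exact hCle γ ⟨hγ, le_max_left γ γ'⟩ β ⟨hβG, hβle⟩ r ⟨hr.1, hr.2.trans ht.2⟩
    rw [intervalIntegral.integral_neg, ← h1, h2, intervalIntegral.integral_const, smul_eq_mul] at h3
    have h4 := hmax β hβG
    have h5 : s * a ≤ s * (D * s) := by
      have : (t - 0) * (C * (γ - β) ^ 2) = s * (D * s) := by rw [hβ, hD]; ring
      linarith
    exact le_of_mul_le_mul_left h5 hs.1
  have hlim : Tendsto (fun s : ℝ => D * s) (𝓝[>] 0) (𝓝 0) := by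
    have : Tendsto (fun s : ℝ => D * s) (𝓝 0) (𝓝 (D * 0)) := Continuous.tendsto (by fun_prop) 0
    rw [mul_zero] at this
    exact this.mono_left nhdsWithin_le_nhds
  exact ge_of_tendsto hlim (by
    filter_upwards [Ioc_mem_nhdsGT (zero_lt_one' ℝ)] with s hs using key s hs)

/-- All members of the family live on `[0, T]`, so the restriction to paraboloids defined at time
`t` is void. -/
theorem mem_parInter_iff {ε : ℝ} (h : S.IsFamily P₀ T K (closure (S.scalings P₀ ε)) P) {t : ℝ}
    (ht : t ∈ Icc 0 T) (X : State n) :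
    X ∈ S.parInter P₀ ε t ↔ ∀ γ ∈ S.scalings P₀ ε, (P γ t).value X ≤ 0 := by
  simp only [parInter, mem_iInter]
  refine forall₂_congr fun γ hγ => ?_
  have hsol := h.sol γ (subset_closure hγ)
  rw [hsol.timeVarying_eq ht]
  exact ⟨fun h1 => h1 ⟨ht.1, _, hsol.mono ht.2⟩, fun h1 _ => h1⟩

/-- States of nonnegative energy that lie on one of the paraboloids and in all others are
reached by a touching trajectory. -/
theorem exists_trajectory {ε : ℝ} (h : S.IsFamily P₀ T K (closure (S.scalings P₀ ε)) P)
    (hε : 0 < ε) (hne : (S.scalings P₀ ε).Nonempty) (hfall : S.FallingTouching P₀ ε T)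
    {γ : ℝ} (hγ : γ ∈ closure (S.scalings P₀ ε)) {t : ℝ} (ht : t ∈ Icc 0 T) {X : State n}
    (hX : 0 ≤ X.2) (hval : (P γ t).value X = 0)
    (hmax : ∀ γ' ∈ closure (S.scalings P₀ ε), (P γ' t).value X ≤ 0) :
    ∃ w x xq, S.IsTrajectory T w x xq ∧ (x t, xq t) = X ∧ (x 0, xq 0) ∈ P₀.toSet ∧
      ∀ s ∈ Icc 0 t, 0 ≤ xq s := by
  have hzero : (0 : ℝ) ∈ Icc 0 T := ⟨le_rfl, h.nonneg⟩
  obtain ⟨x, xq, hx, hxt⟩ := (h.sol γ hγ).exists_closedLoop ht X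
  have hconst : ∀ s ∈ Icc 0 T, (P γ s).value (x s, xq s) = 0 := fun s hs => by
    rw [hx.value_eq_of_optw (h.sol γ hγ) hs ht, hxt, hval]
  have h0 := hconst 0 hzero
  rw [(h.sol γ hγ).init, Paraboloid.value_eq, Paraboloid.base_scale] at h0
  have hslope : ∀ γ' ∈ closure (S.scalings P₀ ε), (γ' - γ) * P₀.base (x 0) ≤ 0 := fun γ' hγ' =>
    h.mul_base_nonpos hγ hx h0 ht (by rw [hxt]; exact hmax) hγ'
  -- By `hslope` every initial value is at most that of `γ`, which is `0`, and values do not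
  -- increase, so the trajectory stays in the intersection. It stays on the boundary because the
  -- value of `γ` remains `0`: raising `x_q` leaves that paraboloid, even if `γ` is only a limit of
  -- scalings.
  have htouch : S.IsTouching (S.parInter P₀ ε) T x xq := by
    refine ⟨⟨_, hx⟩, fun s hs => ⟨subset_closure ?_, fun hint => ?_⟩⟩
    · rw [h.mem_parInter_iff hs]
      intro γ' hγ'
      have h1 := hx.value_antitoneOn h.nonneg (h.sol γ' (subset_closure hγ')) hzero hs hs.1
      refine h1.trans ?_
      simp only [(h.sol γ' (subset_closure hγ')).init, Paraboloid.value_eq, Paraboloid.base_scale]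
      have := hslope γ' (subset_closure hγ')
      linarith
    · have h1 : Tendsto (fun δ : ℝ => (x s, xq s + δ)) (𝓝[>] 0) (𝓝 (x s, xq s)) := by
        have : Tendsto (fun δ : ℝ => (x s, xq s + δ)) (𝓝 0) (𝓝 (x s, xq s + 0)) :=
          Continuous.tendsto (by fun_prop) 0
        rw [add_zero] at this
        exact this.mono_left nhdsWithin_le_nhds
      obtain ⟨δ, h2, h3⟩ := ((h1.eventually (mem_interior_iff_mem_nhds.1 hint)).and
        self_mem_nhdsWithin).exists
      have h4 := h.value_nonpos_of_closure rfl hs ((h.mem_parInter_iff hs _).1 h2) γ hγ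
      have h5 := hconst s hs
      rw [Paraboloid.value_eq] at h4 h5
      have h6 : (0 : ℝ) < δ := h3
      linarith
  have hnonneg := nonneg_of_falling hε (hx.hasPrimitive_xq h.nonneg).continuousOn
    (hfall x xq htouch) ht (by rw [← hxt] at hX; exact hX)
  refine ⟨_, x, xq, hx, hxt, ?_, hnonneg⟩
  obtain ⟨γ₁, hγ₁⟩ := hne
  -- At scaling `1` the slope condition reads `base ≤ γ * base`, so the initial state has value at
  -- most `γ * base + x_q = 0` with respect to `P₀`.
  have hone := hslope 1 (subset_closure (mem_scalings_of_le hγ₁ le_rfl hγ₁.1))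
  show P₀.value (x 0, xq 0) ≤ 0
  rw [Paraboloid.value_eq]
  linarith

end IsFamily

end LTISystem

/-! ### Leaving the intersection backwards in time -/

namespace LTISystem

variable {n p m : ℕ} {S : LTISystem n p m}

/-- With a large constant disturbance, a trajectory that ends in a given state spends energy so
quickly that shortly before it lay outside the time-varying paraboloid. -/
theorem IsSolution.exists_escaping_trajectory (hm : 0 < m) {P₀ : Paraboloid n} {t : ℝ}
    {P : ℝ → Paraboloid n} (hP : S.IsSolution P₀ t P) {a : ℝ} (ha : a ∈ Ico 0 t) (X : State n) :
    ∃ t₀ ∈ Ico a t, ∃ w x xq, S.IsTrajectory t w x xq ∧ (x t, xq t) = X ∧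
      (∀ s ∈ Icc t₀ t, xq t ≤ xq s) ∧ 0 < (P t₀).value (x t₀, xq t₀) := by
  have ht0 : 0 ≤ t := ha.1.trans ha.2.le
  have htt : t ∈ Icc 0 t := ⟨ht0, le_rfl⟩
  set e : Fin m → ℝ := fun _ => 1 with he
  have hene : e ≠ 0 := fun h => by simpa [he] using congrFun h ⟨0, hm⟩
  -- The trajectory will be `y + R • ξ`: `y` is the undisturbed motion ending in `X.1`, and `ξ` the
  -- response to the constant disturbance `e` ending in `0`. After division by `R = r⁻¹` the limit
  -- `r = 0` at time `t` is explicit: both the rate and the loss of value become `wForm e < 0`.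
  obtain ⟨ξ, hξt, hξ⟩ := exists_affine_solution (N := fun _ => S.A) (k := fun _ => S.B *ᵥ e) htt
    continuousOn_const continuousOn_const 0
  obtain ⟨y, hyt, hy⟩ := exists_affine_solution (N := fun _ => S.A) (k := fun s => S.Bu *ᵥ S.u s)
    htt continuousOn_const
    ((show Continuous fun v => S.Bu *ᵥ v by fun_prop).comp_continuousOn S.continuousOn_u) X.1
  have hξc : ContinuousOn ξ (Icc 0 t) := fun s hs => (hξ s hs).continuousWithinAt
  have hyc : ContinuousOn y (Icc 0 t) := fun s hs => (hy s hs).continuousWithinAt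
  set D : Set (ℝ × ℝ) := Icc 0 t ×ˢ univ with hD
  have hfst : MapsTo Prod.fst D (Icc 0 t) := fun z hz => hz.1
  have comp : ∀ {Z : Type} [TopologicalSpace Z] {F : ℝ → Z}, ContinuousOn F (Icc 0 t) →
      ContinuousOn (fun z : ℝ × ℝ => F z.1) D := fun hF => hF.comp continuousOn_fst hfst
  have hx' : ContinuousOn (fun z : ℝ × ℝ => z.2 • y z.1 + ξ z.1) D :=
    (continuousOn_snd.smul (comp hyc)).add (comp hξc)
  have hu' : ContinuousOn (fun z : ℝ × ℝ => z.2 • S.u z.1) D :=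
    continuousOn_snd.smul (comp S.continuousOn_u)
  have hf' : ContinuousOn (fun z : ℝ × ℝ => z.2 • (P z.1).f) D :=
    continuousOn_snd.smul (comp hP.continuousOn_f)
  have h₁ : ContinuousOn (fun z : ℝ × ℝ => S.rate (z.2 • y z.1 + ξ z.1) (z.2 • S.u z.1) e) D :=
    S.continuous_rate.comp_continuousOn
      (f := fun z : ℝ × ℝ => (z.2 • y z.1 + ξ z.1, z.2 • S.u z.1, e))
      (hx'.prodMk (hu'.prodMk continuousOn_const))
  have h₂ : ContinuousOn (fun z : ℝ × ℝ => S.wForm (e - S.optw (P z.1).E (z.2 • (P z.1).f)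
      (z.2 • S.u z.1) (z.2 • y z.1 + ξ z.1))) D := by
    have h3 := S.continuous_optw.comp_continuousOn
      (f := fun z : ℝ × ℝ => ((P z.1).E, z.2 • (P z.1).f, z.2 • S.u z.1, z.2 • y z.1 + ξ z.1))
      ((comp hP.continuousOn_E).prodMk (hf'.prodMk (hu'.prodMk hx')))
    exact S.continuous_wForm.comp_continuousOn (continuousOn_const.sub h3)
  have hmem : (t, (0 : ℝ)) ∈ D := ⟨htt, mem_univ _⟩
  obtain ⟨η, hη, hηlt⟩ : ∃ η, 0 < η ∧ S.wForm e < -η :=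
    ⟨-S.wForm e / 2, by linarith [S.wForm_neg hene], by linarith [S.wForm_neg hene]⟩
  have e₁ : S.rate ((0 : ℝ) • y t + ξ t) ((0 : ℝ) • S.u t) e < -η := by
    simpa [hξt, rate_eq, wForm] using hηlt
  have e₂ : S.wForm (e - S.optw (P t).E ((0 : ℝ) • (P t).f) ((0 : ℝ) • S.u t)
      ((0 : ℝ) • y t + ξ t)) < -η := by
    simpa [hξt, optw] using hηlt
  obtain ⟨δ, hδ, hball⟩ := Metric.mem_nhdsWithin_iff.1
    (((h₁ _ hmem).eventually_lt_const e₁).and ((h₂ _ hmem).eventually_lt_const e₂))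
  set t₀ := max a (t - δ / 2) with ht₀
  have ht₀t : t₀ < t := max_lt ha.2 (by linarith)
  have ht₀0 : 0 ≤ t₀ := ha.1.trans (le_max_left _ _)
  set v := (P t).value X with hv
  -- The first bound keeps `(s, r)` in the neighbourhood where both quantities are below `-η`, the
  -- second gives `r ^ 2 ≤ r`, and the third makes the loss `R ^ 2 * η * (t - t₀)` exceed `|v|`.
  set r := min (min (δ / 2) 1) (η * (t - t₀) / (2 * (|v| + 1))) with hr
  have hr0 : 0 < r := by
    have : 0 < t - t₀ := by linarith
    exact lt_min (lt_min (by positivity) one_pos) (by positivity)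
  have hrδ : r ≤ δ / 2 := (min_le_left _ _).trans (min_le_left _ _)
  have hr1 : r ≤ 1 := (min_le_left _ _).trans (min_le_right _ _)
  have hrv : r * (2 * (|v| + 1)) ≤ η * (t - t₀) :=
    (le_div_iff₀ (by positivity)).1 (min_le_right _ _)
  have hsmall : ∀ s ∈ Icc t₀ t, S.rate (r • y s + ξ s) (r • S.u s) e < -η ∧
      S.wForm (e - S.optw (P s).E (r • (P s).f) (r • S.u s) (r • y s + ξ s)) < -η := by
    intro s hs
    refine hball (a := (s, r)) ⟨?_, ⟨ht₀0.trans hs.1, hs.2⟩, mem_univ _⟩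
    rw [Metric.mem_ball, Prod.dist_eq, Real.dist_eq, Real.dist_eq, sub_zero, abs_of_pos hr0]
    have h4 : t - δ / 2 ≤ s := (le_max_right _ _).trans hs.1
    refine max_lt ?_ (by linarith)
    rw [abs_lt]
    constructor <;> linarith [hs.2]
  set R := r⁻¹ with hR
  have hRr : R * r = 1 := inv_mul_cancel₀ hr0.ne'
  have hR0 : 0 < R := inv_pos.2 hr0
  set x : ℝ → Fin n → ℝ := fun s => y s + R • ξ s with hxdef
  have hxR : ∀ s, x s = R • (r • y s + ξ s) := fun s => by
    rw [smul_add, smul_smul, hRr, one_smul]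
  have hsmul : ∀ {k : ℕ} (z : Fin k → ℝ), z = R • (r • z) := fun z => by
    rw [smul_smul, hRr, one_smul]
  have hxd : ∀ s ∈ Icc 0 t, HasDerivWithinAt x (S.drift (x s) (S.u s) (R • e)) (Icc 0 t) s :=
    fun s hs => by
      convert! (hy s hs).add ((hξ s hs).const_smul R) using 1
      simp only [drift, hxdef, Matrix.mulVec_add, Matrix.mulVec_smul, smul_add]
      abel
  obtain ⟨xq, htraj, hxq⟩ := exists_isTrajectory (w := fun _ => R • e) t X.2 continuousOn_const hxd
  have hxt : (x t, xq t) = X := Prod.ext (by simp [hxdef, hξt, hyt]) hxq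
  refine ⟨t₀, ⟨le_max_left _ _, ht₀t⟩, _, x, xq, htraj, hxt, fun s hs => ?_, ?_⟩
  · have hs' : s ∈ Icc 0 t := ⟨ht₀0.trans hs.1, hs.2⟩
    have h5 := (htraj.hasPrimitive_xq ht0).sub_eq hs' htt
    have h6 : 0 ≤ ∫ σ in s..t, -S.rate (x σ) (S.u σ) (R • e) := by
      refine intervalIntegral.integral_nonneg hs.2 fun σ hσ => ?_
      rw [hxR, hsmul (S.u σ), rate_smul]
      have := (hsmall σ ⟨hs.1.trans hσ.1, hσ.2⟩).1
      nlinarith [sq_nonneg R]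
    rw [intervalIntegral.integral_neg] at h6
    linarith
  · have ht₀' : t₀ ∈ Icc 0 t := ⟨ht₀0, ht₀t.le⟩
    have hprim := htraj.hasPrimitive_value ht0 hP
    have h5 := hprim.sub_eq ht₀' htt
    have h6 : ∫ σ in t₀..t, R ^ 2 * η ≤
        ∫ σ in t₀..t, -S.wForm (R • e - S.optw (P σ).E (P σ).f (S.u σ) (x σ)) := by
      refine intervalIntegral.integral_mono_on ht₀t.le (by simp)
        (hprim.intervalIntegrable_of_mem ht₀' htt).neg fun σ hσ => ?_
      -- `optw` is linear in `f`, `v`, `x` jointly and `wForm` is quadratic, so undoing the scaling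
      -- yields the factor `R ^ 2`.
      have h7 : S.wForm (R • e - S.optw (P σ).E (P σ).f (S.u σ) (x σ)) = R ^ 2 *
          S.wForm (e - S.optw (P σ).E (r • (P σ).f) (r • S.u σ) (r • y σ + ξ σ)) := by
        rw [← wForm_smul, smul_sub, ← optw_smul, ← hxR, ← hsmul, ← hsmul]
      rw [h7]
      have := (hsmall σ hσ).2
      nlinarith [sq_nonneg R]
    rw [intervalIntegral.integral_neg, ← h5, hxt, ← hv, intervalIntegral.integral_const,
      smul_eq_mul] at h6
    have h8 : |v| < (t - t₀) * (R ^ 2 * η) := by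
      have h9 : r ^ 2 * (|v| + 1) ≤ η * (t - t₀) := by
        have : r ^ 2 ≤ r := by nlinarith
        nlinarith [abs_nonneg v]
      have h10 : R ^ 2 * r ^ 2 = 1 := by rw [← mul_pow, hRr, one_pow]
      have h11 : R ^ 2 * (r ^ 2 * (|v| + 1)) ≤ R ^ 2 * (η * (t - t₀)) := by gcongr
      have h12 : R ^ 2 * (r ^ 2 * (|v| + 1)) = |v| + 1 := by
        rw [← mul_assoc, h10, one_mul]
      linarith
    linarith [neg_abs_le v]

/-! ### Unbounded families -/

theorem rhsf_affine (E : Matrix (Fin n) (Fin n) ℝ) (f₁ f₂ : Fin n → ℝ) (v : Fin p → ℝ) (c : ℝ) :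
    S.rhsf E (f₁ + c • (f₂ - f₁)) v = S.rhsf E f₁ v + c • (S.rhsf E f₂ v - S.rhsf E f₁ v) := by
  simp only [rhsf, Matrix.mulVec_add, Matrix.mulVec_sub, Matrix.mulVec_smul, smul_add, smul_sub,
    smul_neg]
  abel

/-- A quadratic polynomial in `c` is fixed by its values at `c = 0` and `c = 1` and its leading
coefficient, here the form `B Mw⁻¹ Bᵀ` at `f₂ - f₁`, rewritten through `wForm` to exhibit its sign.
-/
theorem rhsg_quadratic (f₁ f₂ : Fin n → ℝ) (v : Fin p → ℝ) (c : ℝ) :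
    S.rhsg (f₁ + c • (f₂ - f₁)) v = S.rhsg f₁ v
      + c * (S.rhsg f₂ v - S.rhsg f₁ v - S.wForm (S.Mw⁻¹ *ᵥ (S.Bᵀ *ᵥ (f₂ - f₁))))
      + c ^ 2 * S.wForm (S.Mw⁻¹ *ᵥ (S.Bᵀ *ᵥ (f₂ - f₁))) := by
  have h1 : ∀ d : Fin n → ℝ, S.wForm (S.Mw⁻¹ *ᵥ (S.Bᵀ *ᵥ d)) =
      d ⬝ᵥ ((S.B * S.Mw⁻¹ * S.Bᵀ) *ᵥ d) := fun d => by
    rw [wForm, Matrix.mulVec_mulVec _ S.Mw, Matrix.mul_nonsing_inv _ S.isUnit_det_Mw,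
      Matrix.one_mulVec, dotProduct_comm, Matrix.mul_assoc, ← Matrix.mulVec_mulVec,
      dotProduct_mulVec_eq_transpose d, ← Matrix.mulVec_mulVec]
  rw [h1]
  simp only [rhsg, Matrix.mulVec_add, Matrix.mulVec_sub, Matrix.mulVec_smul, dotProduct_add,
    dotProduct_sub, dotProduct_smul, add_dotProduct, sub_dotProduct, smul_dotProduct, smul_eq_mul]
  ring

/-- This identifies the integrand of `curvature` as `wForm` of the difference of two touching
disturbances when the Riccati matrices agree. -/
theorem optw_sub_optw (E : Matrix (Fin n) (Fin n) ℝ) (f₁ f₂ : Fin n → ℝ) (v : Fin p → ℝ)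
    (x : Fin n → ℝ) :
    S.optw E f₂ v x - S.optw E f₁ v x = S.Mw⁻¹ *ᵥ (S.Bᵀ *ᵥ (f₂ - f₁)) := by
  simp only [optw, Matrix.mulVec_add, Matrix.mulVec_sub]
  abel

end LTISystem

namespace LTISystem

variable {n p m : ℕ} {S : LTISystem n p m}

/-- The coefficient of `γ²` in the value functions of a family whose Riccati matrices do not
depend on the scaling `γ`. -/
noncomputable def curvature (S : LTISystem n p m) (P Q : ℝ → Paraboloid n) (t : ℝ) : ℝ :=
  ∫ s in (0 : ℝ)..t, S.wForm (S.Mw⁻¹ *ᵥ (S.Bᵀ *ᵥ ((Q s).f - (P s).f)))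

namespace IsFamily

variable {P₀ : Paraboloid n} {T K : ℝ} {G : Set ℝ} {P : ℝ → ℝ → Paraboloid n}

/-- In an unbounded family the Riccati matrices start at zero. -/
theorem E_eq_zero (h : S.IsFamily P₀ T K G P) (hG : ¬BddAbove G) : P₀.E = 0 := by
  ext i j
  by_contra hne
  have hpos : 0 < |P₀.E i j| := abs_pos.2 hne
  refine hG ⟨K / |P₀.E i j|, fun γ hγ => ?_⟩
  rw [le_div_iff₀ hpos]
  have h1 := h.bound γ hγ 0 ⟨le_rfl, h.nonneg⟩ i j
  rw [(h.sol γ hγ).init] at h1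
  have h2 : (P₀.scale γ).E i j = γ * P₀.E i j := rfl
  rwa [h2, abs_mul, abs_of_nonneg (by linarith [h.one_le γ hγ])] at h1

theorem mem_of_not_bddAbove (h : S.IsFamily P₀ T K G P) (hG : ¬BddAbove G) {γ : ℝ} (hγ : 1 ≤ γ) :
    γ ∈ G := by
  obtain ⟨γ', h1, h2⟩ := not_bddAbove_iff.1 hG γ
  exact h.mem_of_le γ' h1 γ hγ h2.le

/-- The Riccati equation involves neither `f` nor `g`, and the initial matrices `γ • 0` all
coincide. -/
theorem E_eq (h : S.IsFamily P₀ T K G P) (h0 : P₀.E = 0) {γ γ' : ℝ} (hγ : γ ∈ G) (hγ' : γ' ∈ G)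
    {t : ℝ} (ht : t ∈ Icc 0 T) : (P γ t).E = (P γ' t).E := by
  have hsol := h.sol γ' hγ'
  obtain ⟨Q, hQ, hQE⟩ := S.exists_isSolution_of_riccati (P₀ := P₀.scale γ) h.nonneg
    (E := fun s => (P γ' s).E)
    (by rw [hsol.init]; simp [Paraboloid.scale, h0]) (fun s => (P γ' s).E_symm) hsol.E_deriv
  rw [(h.sol γ hγ).unique hQ ht, hQE]

/-- The interpolating expressions solve the initial value problem for the scaling `1 + c`, since the
equation for `f` is affine and that for `g` quadratic in `f`; uniqueness identifies them with the
member of the family. -/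
theorem f_g_eq (h : S.IsFamily P₀ T K G P) (h0 : P₀.E = 0) (h₁ : (1 : ℝ) ∈ G) (h₂ : (2 : ℝ) ∈ G)
    {c : ℝ} (hc : 1 + c ∈ G) {t : ℝ} (ht : t ∈ Icc 0 T) :
    (P (1 + c) t).f = (P 1 t).f + c • ((P 2 t).f - (P 1 t).f) ∧
    (P (1 + c) t).g = (P 1 t).g + c * ((P 2 t).g - (P 1 t).g - S.curvature (P 1) (P 2) t)
      + c ^ 2 * S.curvature (P 1) (P 2) t := by
  have s₁ := h.sol 1 h₁
  have s₂ := h.sol 2 h₂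
  have hcont : ContinuousOn
      (fun s => S.wForm (S.Mw⁻¹ *ᵥ (S.Bᵀ *ᵥ ((P 2 s).f - (P 1 s).f)))) (Icc 0 T) := by
    have : Continuous fun d : Fin n → ℝ => S.wForm (S.Mw⁻¹ *ᵥ (S.Bᵀ *ᵥ d)) :=
      S.continuous_wForm.comp (by fun_prop)
    exact this.comp_continuousOn (s₂.continuousOn_f.sub s₁.continuousOn_f)
  set Q : ℝ → Paraboloid n := fun s => ⟨(P 1 s).E, (P 1 s).f + c • ((P 2 s).f - (P 1 s).f),
    (P 1 s).g + c * ((P 2 s).g - (P 1 s).g - S.curvature (P 1) (P 2) s)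
      + c ^ 2 * S.curvature (P 1) (P 2) s, (P 1 s).E_symm⟩ with hQdef
  have hQ : S.IsSolution (P₀.scale (1 + c)) T Q := by
    refine ⟨?_, s₁.E_deriv, fun s hs => ?_, fun s hs => ?_⟩
    · simp only [hQdef, s₁.init, s₂.init, curvature, intervalIntegral.integral_same]
      ext1
      · simp [Paraboloid.scale, h0]
      · simp only [Paraboloid.scale, ← sub_smul, smul_smul, ← add_smul]
        congr 1
        ring
      · simp only [Paraboloid.scale]
        ring
    · have h3 := s₂.f_deriv s hs
      rw [h.E_eq h0 h₂ h₁ hs] at h3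
      simp only [hQdef]
      rw [rhsf_affine]
      exact (s₁.f_deriv s hs).add ((h3.sub (s₁.f_deriv s hs)).const_smul c)
    · have hi : ∀ {F : ℝ → ℝ}, ContinuousOn F (Icc 0 T) → IntervalIntegrable F volume 0 s :=
        fun hF => ContinuousOn.intervalIntegrable (by
          rw [uIcc_of_le hs.1]; exact hF.mono (Icc_subset_Icc_right hs.2))
      have i₁ := hi s₁.continuousOn_rhsg
      have i₂ := hi s₂.continuousOn_rhsg
      have i₃ := hi hcont
      simp only [hQdef, rhsg_quadratic]
      rw [intervalIntegral.integral_add (i₁.add (((i₂.sub i₁).sub i₃).const_mul c))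
          (i₃.const_mul _),
        intervalIntegral.integral_add i₁ (((i₂.sub i₁).sub i₃).const_mul c),
        intervalIntegral.integral_const_mul, intervalIntegral.integral_const_mul,
        intervalIntegral.integral_sub (i₂.sub i₁) i₃, intervalIntegral.integral_sub i₂ i₁,
        s₁.g_eq s hs, s₂.g_eq s hs, curvature]
      simp only [Paraboloid.scale]
      ring
  have h4 := (h.sol _ hc).unique hQ ht
  rw [h4]
  exact ⟨rfl, rfl⟩

/-- The value functions of an unbounded family are quadratic in the scaling. -/
theorem value_quadratic (h : S.IsFamily P₀ T K G P) (h0 : P₀.E = 0) (h₁ : (1 : ℝ) ∈ G)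
    (h₂ : (2 : ℝ) ∈ G) {c : ℝ} (hc : 1 + c ∈ G) {t : ℝ} (ht : t ∈ Icc 0 T) (X : State n) :
    (P (1 + c) t).value X = (P 1 t).value X
      + c * ((P 2 t).value X - (P 1 t).value X - S.curvature (P 1) (P 2) t)
      + c ^ 2 * S.curvature (P 1) (P 2) t := by
  obtain ⟨hf, hg⟩ := h.f_g_eq h0 h₁ h₂ hc ht
  simp only [Paraboloid.value]
  rw [hf, hg, h.E_eq h0 hc h₁ ht, h.E_eq h0 h₂ h₁ ht]
  simp only [add_dotProduct, sub_dotProduct, smul_dotProduct, smul_eq_mul]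
  ring

theorem hasPrimitive_curvature (h : S.IsFamily P₀ T K G P) (h₁ : (1 : ℝ) ∈ G)
    (h₂ : (2 : ℝ) ∈ G) : HasPrimitive (S.curvature (P 1) (P 2))
      (fun s => S.wForm (S.Mw⁻¹ *ᵥ (S.Bᵀ *ᵥ ((P 2 s).f - (P 1 s).f)))) T := by
  have hcont : ContinuousOn
      (fun s => S.wForm (S.Mw⁻¹ *ᵥ (S.Bᵀ *ᵥ ((P 2 s).f - (P 1 s).f)))) (Icc 0 T) := by
    have : Continuous fun d : Fin n → ℝ => S.wForm (S.Mw⁻¹ *ᵥ (S.Bᵀ *ᵥ d)) :=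
      S.continuous_wForm.comp (by fun_prop)
    exact this.comp_continuousOn ((h.sol 2 h₂).continuousOn_f.sub (h.sol 1 h₁).continuousOn_f)
  exact ⟨ContinuousOn.intervalIntegrable (by rwa [uIcc_of_le h.nonneg]), fun t _ => by
    simp [curvature]⟩

theorem curvature_antitoneOn (h : S.IsFamily P₀ T K G P) (h₁ : (1 : ℝ) ∈ G)
    (h₂ : (2 : ℝ) ∈ G) : AntitoneOn (S.curvature (P 1) (P 2)) (Icc 0 T) := by
  intro a ha b hb hab
  have h3 := (h.hasPrimitive_curvature h₁ h₂).sub_eq ha hb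
  have h4 := intervalIntegral.integral_nonneg (μ := volume) hab
    (f := fun s => -S.wForm (S.Mw⁻¹ *ᵥ (S.Bᵀ *ᵥ ((P 2 s).f - (P 1 s).f))))
    fun s _ => neg_nonneg.2 (S.wForm_nonpos _)
  rw [intervalIntegral.integral_neg] at h4
  linarith

/-- If the curvature vanishes at time `t`, then the difference of the value functions is constant
along trajectories on `[0, t]`. -/
theorem value_sub_value_eq (h : S.IsFamily P₀ T K G P) (h0 : P₀.E = 0) (h₁ : (1 : ℝ) ∈ G)
    (h₂ : (2 : ℝ) ∈ G) {t : ℝ} (ht : t ∈ Icc 0 T) (hκ : S.curvature (P 1) (P 2) t = 0)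
    {w : ℝ → Fin m → ℝ} {x : ℝ → Fin n → ℝ} {xq : ℝ → ℝ} (hx : S.IsTrajectory t w x xq) {s : ℝ}
    (hs : s ∈ Icc 0 t) :
    (P 2 s).value (x s, xq s) - (P 1 s).value (x s, xq s) =
      (P 2 t).value (x t, xq t) - (P 1 t).value (x t, xq t) := by
  have hint := ((h.hasPrimitive_curvature h₁ h₂).mono ht).1.neg
  have h3 : ∫ r in (0 : ℝ)..t, -S.wForm (S.Mw⁻¹ *ᵥ (S.Bᵀ *ᵥ ((P 2 r).f - (P 1 r).f))) = 0 := by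
    rw [intervalIntegral.integral_neg, neg_eq_zero]
    exact hκ
  -- Vanishing curvature means that the touching disturbances of the scalings `1` and `2` coincide
  -- almost everywhere, so both values change at the same rate along any trajectory.
  rw [intervalIntegral.integral_eq_zero_iff_of_le_of_nonneg_ae ht.1
    (ae_of_all _ fun s => neg_nonneg.2 (S.wForm_nonpos _)) hint] at h3
  have htt : t ∈ Icc 0 t := ⟨ht.1, le_rfl⟩
  have e₁ := (hx.hasPrimitive_value ht.1 ((h.sol 1 h₁).mono ht.2)).sub_eq hs htt
  have e₂ := (hx.hasPrimitive_value ht.1 ((h.sol 2 h₂).mono ht.2)).sub_eq hs htt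
  have h4 : ∫ r in s..t, S.wForm (w r - S.optw (P 2 r).E (P 2 r).f (S.u r) (x r)) =
      ∫ r in s..t, S.wForm (w r - S.optw (P 1 r).E (P 1 r).f (S.u r) (x r)) := by
    refine intervalIntegral.integral_congr_ae ?_
    rw [Filter.EventuallyEq, ae_restrict_iff' measurableSet_Ioc] at h3
    filter_upwards [h3] with r hr hrs
    rw [uIoc_of_le hs.2] at hrs
    have hr0 : r ∈ Ioc 0 t := ⟨hs.1.trans_lt hrs.1, hrs.2⟩
    have h5 := S.wForm_eq_zero (neg_eq_zero.1 (hr hr0))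
    rw [h.E_eq h0 h₂ h₁ ⟨hr0.1.le, hr0.2.trans ht.2⟩]
    rw [← S.optw_sub_optw (P 1 r).E (P 1 r).f (P 2 r).f (S.u r) (x r), sub_eq_zero] at h5
    rw [h5]
  linarith

/-- Large scalings are irrelevant along a trajectory that ends in the intersection. -/
theorem exists_scaling_bound (h : S.IsFamily P₀ T K G P) {t : ℝ} (ht : t ∈ Ioc 0 T) :
    ∃ a ∈ Ico 0 t, ∀ w x xq, S.IsTrajectory t w x xq →
      (∀ γ ∈ G, (P γ t).value (x t, xq t) ≤ 0) →
      ∃ N, 1 ≤ N ∧ ∀ γ ∈ G, N < γ → ∀ s ∈ Icc a t,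
        (P γ s).value (x s, xq s) ≤ 0 ∨ (P γ s).value (x s, xq s) ≤ (P 1 s).value (x s, xq s) := by
  by_cases hG : BddAbove G
  · obtain ⟨N, hN⟩ := hG
    exact ⟨0, ⟨le_rfl, ht.1⟩, fun w x xq _ _ => ⟨max 1 N, le_max_left _ _, fun γ hγ hlt =>
      absurd ((hN hγ).trans (le_max_right _ _)) (not_le.2 hlt)⟩⟩
  have h0 := h.E_eq_zero hG
  have h₁ := h.mem_of_not_bddAbove hG le_rfl
  have h₂ := h.mem_of_not_bddAbove hG one_le_two
  have ht' : t ∈ Icc 0 T := ⟨ht.1.le, ht.2⟩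
  have hanti := h.curvature_antitoneOn h₁ h₂
  have hzero : S.curvature (P 1) (P 2) 0 = 0 := by simp [curvature]
  have h0T : (0 : ℝ) ∈ Icc 0 T := ⟨le_rfl, h.nonneg⟩
  have hquad : ∀ γ, 1 ≤ γ → ∀ s ∈ Icc 0 T, ∀ X, (P γ s).value X = (P 1 s).value X
      + (γ - 1) * ((P 2 s).value X - (P 1 s).value X - S.curvature (P 1) (P 2) s)
      + (γ - 1) ^ 2 * S.curvature (P 1) (P 2) s := fun γ hγ s hs X => by
    have := h.value_quadratic h0 h₁ h₂ (c := γ - 1)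
      (h.mem_of_not_bddAbove hG (by linarith)) hs X
    rwa [add_sub_cancel] at this
  -- The curvature starts at `0` and does not increase. If it is negative at `t`, it is so slightly
  -- earlier, and its `γ²` term makes all large scalings nonpositive on a window `[a, t]`. If it is
  -- `0` at `t`, it vanishes on `[0, t]` and the values are affine in `γ`.
  rcases (hanti h0T ht' ht.1.le).lt_or_eq with hneg | hκ
  · rw [hzero] at hneg
    have hcont := (h.hasPrimitive_curvature h₁ h₂).continuousOn
    have hev : ∀ᶠ s in 𝓝[Icc 0 T] t, S.curvature (P 1) (P 2) s < 0 :=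
      (hcont t ht').eventually_lt_const hneg
    have hev' : ∀ᶠ s in 𝓝[<] t, S.curvature (P 1) (P 2) s < 0 ∧ s ∈ Ioo 0 t :=
      (hev.filter_mono (nhdsWithin_le_iff.2 (mem_of_superset (Ioo_mem_nhdsLT ht.1)
        fun s (hs : s ∈ Ioo 0 t) => (⟨hs.1.le, hs.2.le.trans ht.2⟩ : s ∈ Icc 0 T)))).and (Ioo_mem_nhdsLT ht.1)
    obtain ⟨a, haneg, ha⟩ := hev'.exists
    refine ⟨a, ⟨ha.1.le, ha.2⟩, fun w x xq hx _ => ?_⟩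
    have hX : ContinuousOn (fun s => (x s, xq s)) (Icc 0 t) :=
      hx.x_continuousOn.prodMk (hx.hasPrimitive_xq ht.1.le).continuousOn
    have hsub : Icc 0 t ⊆ Icc 0 T := Icc_subset_Icc_right ht.2
    have c₁ : ContinuousOn (fun s => (P 1 s).value (x s, xq s)) (Icc 0 t) :=
      ((h.sol 1 h₁).continuousOn_params.mono hsub).paraboloid_value hX
    have c₂ : ContinuousOn (fun s => (P 2 s).value (x s, xq s)) (Icc 0 t) :=
      ((h.sol 2 h₂).continuousOn_params.mono hsub).paraboloid_value hX
    obtain ⟨M₁, hM₁⟩ := isCompact_Icc.exists_bound_of_continuousOn c₁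
    obtain ⟨M₂, hM₂⟩ := isCompact_Icc.exists_bound_of_continuousOn
      ((c₂.sub c₁).sub (hcont.mono hsub))
    set k := -S.curvature (P 1) (P 2) a with hk
    have hk0 : 0 < k := by linarith
    have hM₁0 : 0 ≤ M₁ := (norm_nonneg _).trans (hM₁ 0 ⟨le_rfl, ht.1.le⟩)
    have hM₂0 : 0 ≤ M₂ := (norm_nonneg _).trans (hM₂ 0 ⟨le_rfl, ht.1.le⟩)
    -- With `c = γ - 1` this ensures `1 ≤ c` and `M₁ + M₂ ≤ c * k`, so that `M₁ + c * M₂ - c ^ 2 * k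
    -- ≤ 0`.
    refine ⟨2 + (M₁ + M₂) / k, by
      have : 0 ≤ (M₁ + M₂) / k := by positivity
      linarith, fun γ _ hlt s hs => Or.inl ?_⟩
    have hs' : s ∈ Icc 0 t := ⟨ha.1.le.trans hs.1, hs.2⟩
    have b₁ := (abs_le.1 (hM₁ s hs')).2
    have b₂ := (abs_le.1 (hM₂ s hs')).2
    have b₃ := hanti ⟨ha.1.le, ha.2.le.trans ht.2⟩ (hsub hs') hs.1
    set c := γ - 1 with hc
    have hc1 : 1 ≤ c := by
      have : 0 ≤ (M₁ + M₂) / k := by positivity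
      linarith
    have hck : M₁ + M₂ ≤ c * k := by
      rw [← div_le_iff₀ hk0]
      linarith
    rw [hquad γ (by linarith) s (hsub hs')]
    simp only [Pi.sub_apply] at b₂
    set κ := S.curvature (P 1) (P 2) s
    set v₁ := (P 1 s).value (x s, xq s)
    set b := (P 2 s).value (x s, xq s) - v₁ - κ
    have e1 : c * b ≤ c * M₂ := by gcongr
    have e2 : c ^ 2 * κ ≤ c ^ 2 * (-k) := by gcongr; linarith
    have e3 : M₁ ≤ c * M₁ := by nlinarith
    have e4 : c * (M₁ + M₂) ≤ c * (c * k) := by gcongr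
    nlinarith
  · rw [hzero] at hκ
    have hκs : ∀ s ∈ Icc 0 t, S.curvature (P 1) (P 2) s = 0 := fun s hs => by
      have hsT : s ∈ Icc 0 T := ⟨hs.1, hs.2.trans ht.2⟩
      have h3 := hanti h0T hsT hs.1
      have h4 := hanti hsT ht' hs.2
      linarith
    refine ⟨0, ⟨le_rfl, ht.1⟩, fun w x xq hx hle => ⟨1, le_rfl, fun γ hγ hlt s hs => Or.inr ?_⟩⟩
    -- A positive slope in `γ` at time `t` would make the value positive for large `γ`: the scaling
    -- tested below has value `v + |v| + 1`. As the slope is constant along the trajectory, it is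
    -- nonpositive on all of `[0, t]`.
    have hslope : (P 2 t).value (x t, xq t) - (P 1 t).value (x t, xq t) ≤ 0 := by
      by_contra! hpos
      set d := (P 2 t).value (x t, xq t) - (P 1 t).value (x t, xq t)
      set v := (P 1 t).value (x t, xq t) with hv
      have h3 : 1 ≤ 1 + (|v| + 1) / d := by
        have : 0 ≤ (|v| + 1) / d := by positivity
        linarith
      have h4 := hle _ (h.mem_of_not_bddAbove hG h3)
      rw [hquad _ h3 t ht', hκ, ← hv, sub_zero, mul_zero, add_zero, add_sub_cancel_left,
        div_mul_cancel₀ _ hpos.ne'] at h4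
      linarith [neg_abs_le v]
    rw [hquad γ hlt.le s ⟨hs.1, hs.2.trans ht.2⟩, hκs s hs, sub_zero, mul_zero, add_zero,
      h.value_sub_value_eq h0 h₁ h₂ ht' hκ hx hs]
    nlinarith

/-- Every state of the intersection in the half-space of nonnegative energy is reachable. -/
theorem mem_reach {ε : ℝ} (h : S.IsFamily P₀ T K (closure (S.scalings P₀ ε)) P) (hm : 0 < m)
    (hε : 0 < ε) (hne : (S.scalings P₀ ε).Nonempty) (hfall : S.FallingTouching P₀ ε T)
    {t : ℝ} (ht : t ∈ Ioc 0 T) {X : State n} (hX : 0 ≤ X.2)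
    (hmem : ∀ γ ∈ closure (S.scalings P₀ ε), (P γ t).value X ≤ 0) :
    X ∈ S.reach P₀.toSet t := by
  set G := closure (S.scalings P₀ ε) with hG
  have h₁ : (1 : ℝ) ∈ G := by
    obtain ⟨γ, hγ⟩ := hne
    exact subset_closure (mem_scalings_of_le hγ le_rfl hγ.1)
  obtain ⟨a, ha, hbd⟩ := h.exists_scaling_bound ht
  -- The escape is made to happen after `a`, inside the window on which large scalings are harmless.
  obtain ⟨t₀, ht₀, w, x, xq, hx, hxt, hxq, hpos⟩ :=
    ((h.sol 1 h₁).mono ht.2).exists_escaping_trajectory hm ha X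
  obtain ⟨N, hN1, hN⟩ := hbd w x xq hx (by rw [hxt]; exact hmem)
  have ht₀0 : 0 ≤ t₀ := ha.1.trans ht₀.1
  have hXc : ContinuousOn (fun s => (x s, xq s)) (Icc 0 t) :=
    hx.x_continuousOn.prodMk (hx.hasPrimitive_xq ht.1.le).continuousOn
  have hsub₀ : Icc t₀ t ⊆ Icc 0 t := Icc_subset_Icc_left ht₀0
  have hsub : Icc t₀ t ⊆ Icc 0 T := hsub₀.trans (Icc_subset_Icc_right ht.2)
  have hval := h.continuousOn_value N hsub (hXc.mono hsub₀)
  have hcomp : IsCompact ((G ∩ Iic N) ×ˢ Icc t₀ t ∩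
      (fun z : ℝ × ℝ => (P z.1 z.2).value (x z.2, xq z.2)) ⁻¹' Ici 0) := by
    have hK := (h.isCompact_inter_Iic N).prod (isCompact_Icc (a := t₀) (b := t))
    exact hK.of_isClosed_subset (hval.preimage_isClosed_of_isClosed hK.isClosed isClosed_Ici)
      inter_subset_left
  -- The last time `τ` at which some scaling up to `N` has a nonnegative value; scaling `1` at time
  -- `t₀` shows that there is one.
  obtain ⟨⟨γ, τ⟩, ⟨⟨hγ, hτ⟩, hge⟩, hlast⟩ := hcomp.exists_isMaxOn
    ⟨(1, t₀), ⟨⟨h₁, hN1⟩, ⟨le_rfl, ht₀.2.le⟩⟩, hpos.le⟩ continuousOn_snd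
  -- After `τ` all these values are negative, so by continuity they are nonpositive at `τ`; if `τ =
  -- t`, this is membership in the intersection.
  have hle : ∀ γ' ∈ G ∩ Iic N, (P γ' τ).value (x τ, xq τ) ≤ 0 := fun γ' hγ' => by
    rcases hτ.2.eq_or_lt with heq | hlt
    · have := hmem γ' hγ'.1
      rwa [← hxt, ← heq] at this
    · have hc : ContinuousOn (fun s => (P γ' s).value (x s, xq s)) (Icc t₀ t) :=
        ((h.sol γ' hγ'.1).continuousOn_params.mono hsub).paraboloid_value (hXc.mono hsub₀)
      refine ContinuousWithinAt.closure_le (f := fun s => (P γ' s).value (x s, xq s))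
        (g := fun _ => (0 : ℝ)) (s := Ioc τ t)
        (by rw [closure_Ioc hlt.ne]; exact ⟨le_rfl, hlt.le⟩)
        ((hc τ hτ).mono fun s hs => ⟨hτ.1.trans hs.1.le, hs.2⟩) continuousWithinAt_const
        fun s hs => ?_
      by_contra! hcon
      have : s ≤ τ := isMaxOn_iff.1 hlast (γ', s)
        ⟨⟨hγ', ⟨hτ.1.trans hs.1.le, hs.2⟩⟩, hcon.le⟩
      exact absurd hs.1 (not_lt.2 this)
  have hall : ∀ γ' ∈ G, (P γ' τ).value (x τ, xq τ) ≤ 0 := fun γ' hγ' => by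
    rcases le_or_gt γ' N with hle' | hlt
    · exact hle γ' ⟨hγ', hle'⟩
    · rcases hN γ' hγ' hlt τ ⟨ht₀.1.trans hτ.1, hτ.2⟩ with h3 | h3
      · exact h3
      · exact h3.trans (hle 1 ⟨h₁, hN1⟩)
  have hqt : 0 ≤ xq t := by
    have : xq t = X.2 := congrArg Prod.snd hxt
    rwa [this]
  -- At `τ` the state lies on the paraboloid of `γ` and in all others, and its energy is at least
  -- the final one, so a touching trajectory from `P₀` reaches it.
  obtain ⟨w₁, x₁, q₁, htr, hend, hinit, hnn⟩ := h.exists_trajectory hε hne hfall hγ.1 (hsub hτ)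
    (X := (x τ, xq τ)) (hqt.trans (hxq τ hτ)) ((hall γ hγ.1).antisymm hge) hall
  have hτ0 : 0 ≤ τ := ht₀0.trans hτ.1
  have hxe : x₁ τ = x τ := congrArg Prod.fst hend
  have hqe : q₁ τ = xq τ := congrArg Prod.snd hend
  refine ⟨_, _, ⟨⟨_, (htr.mono (hτ.2.trans ht.2)).concat ⟨hτ0, hτ.2⟩ hx hxe hqe⟩, ?_,
    fun s hs => ?_⟩, ?_⟩
  · simp only [if_pos hτ0]
    exact hinit
  · by_cases hsτ : s ≤ τ
    · simp only [if_pos hsτ]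
      exact hnn s ⟨hs.1, hsτ⟩
    · simp only [if_neg hsτ]
      exact hqt.trans (hxq s ⟨hτ.1.trans (not_le.1 hsτ).le, hs.2⟩)
  · by_cases htτ : t ≤ τ
    · have : τ = t := le_antisymm hτ.2 htτ
      simp only [if_pos htτ]
      rw [← hxt, ← this, hxe, hqe]
    · simp only [if_neg htτ]
      exact hxt.symm

end IsFamily

/-- Over-approximation: constrained trajectories stay in the intersection. -/
theorem reach_subset {P₀ : Paraboloid n} {ε t : ℝ} (ht : 0 ≤ t) :
    S.reach P₀.toSet t ⊆ S.parInter P₀ ε t ∩ nonnegStates n := by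
  rintro _ ⟨x, xq, ⟨⟨w, hx⟩, hinit, hnn⟩, rfl⟩
  refine ⟨?_, hnn t ⟨ht, le_rfl⟩⟩
  simp only [parInter, mem_iInter]
  rintro γ ⟨hγ, -⟩ ⟨-, P, hP⟩
  refine ⟨P, hP, ?_⟩
  have h1 := hx.value_antitoneOn ht hP ⟨le_rfl, ht⟩ ⟨ht, le_rfl⟩ ht
  refine h1.trans ?_
  -- Since `x_q ≥ 0` initially, `base` is nonpositive, and multiplying it by `γ ≥ 1` only lowers the
  -- value.
  have h2 : P₀.base (x 0) + xq 0 ≤ 0 := hinit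
  have h3 := hnn 0 ⟨le_rfl, ht⟩
  simp only [hP.init, Paraboloid.value_eq, Paraboloid.base_scale]
  nlinarith

theorem mem_reach_zero {P₀ : Paraboloid n} {X : State n} (hX : X ∈ P₀.toSet) (hq : 0 ≤ X.2) :
    X ∈ S.reach P₀.toSet 0 := by
  have key : ∀ s ∈ Icc (0 : ℝ) 0, s = 0 := fun s hs => le_antisymm hs.2 hs.1
  refine ⟨fun _ => X.1, fun _ => X.2, ⟨⟨0, ⟨MemLp.zero', continuousOn_const, fun s hs => ?_,
    fun s hs => ?_⟩⟩, hX, fun _ _ => hq⟩, rfl⟩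
  · simp [key s hs]
  · simp [key s hs]

end LTISystem

end IQCReach

theorem theorem2 {n p m : ℕ} (hm : 0 < m) (S : IQCReach.LTISystem n p m)
    (P₀ : IQCReach.Paraboloid n) (ε T : ℝ) (hε : 0 < ε) (hT : 0 ≤ T)
    (hne : (S.scalings P₀ ε).Nonempty)
    (hE : S.RiccatiBounded P₀ ε T)
    (hfall : S.FallingTouching P₀ ε T) :
    ∀ t ∈ Set.Icc 0 T,
      S.reach P₀.toSet t = S.parInter P₀ ε t ∩ IQCReach.nonnegStates n := by
  intro t ht
  refine Subset.antisymm (IQCReach.LTISystem.reach_subset ht.1) fun X hX => ?_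
  obtain ⟨K, P, h⟩ := IQCReach.LTISystem.exists_isFamily hT hE
  have hle := (h.mem_parInter_iff ht X).1 hX.1
  rcases ht.1.eq_or_lt with h0 | h0
  -- At time `0` there is no room for the backward escape; instead the member of scaling `1` is `P₀`
  -- itself.
  · subst h0
    obtain ⟨γ, hγ⟩ := hne
    have h₁ := IQCReach.LTISystem.mem_scalings_of_le hγ le_rfl hγ.1
    have h2 := hle 1 h₁
    rw [(h.sol 1 (subset_closure h₁)).init, IQCReach.Paraboloid.scale_one] at h2
    exact IQCReach.LTISystem.mem_reach_zero h2 hX.2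
  · exact h.mem_reach hm hε hne hfall ⟨h0, ht.2⟩ hX.2 (h.value_nonpos_of_closure rfl ht hle)
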